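/- Write $\hat v = v/\sqrt{1+v^2}$ and consider the one-dimensional relativistic Vlasov–Klein–Gordon system ($t\ge 0$, $x,v\in\mathbb R$) \[ \partial_t f+\hat v\,\partial_x f-\partial_x u\,\partial_v f=0,\qquad \partial_t^2u-\partial_x^2u+u=-\rho,\qquad \rho(t,x)=\int_{\mathbb R} f(t,x,v)\,dv , \] with initial conditions $f(0)=\mathring f$, $u(0)=\mathring u_1$, $\partial_tu(0)=\mathring u_2$. Let $\mathring f\in C^1_c(\mathbb R^2)$, $\mathring u_1\in C^3_b(\mathbb R)$ and $\mathring u_2\in C^2_b(\mathbb R)$, where $C^k_b$ denotes the $C^k$ functions that are bounded together with their derivatives up to order $k$. Then there exists a unique global classical solution \[ f\in C^1([0,\infty[\,\times\mathbb R^2),\qquad u\in C^2([0,\infty[\,\times\mathbb R) \] of this initial value problem, where $f(t,x,\cdot)$ is integrable for all $t\ge0$, $x\in\mathbb R$. If $\mathring f\ge 0$ then $f\ge 0$. Moreover, there is a constant $C>0$, depending only on an upper bound for the norms $\|\mathring f\|_\infty$, $\|\mathring f\|_{1}$, $\|\mathring u_1\|_{C^3_b}$, $\|\mathring u_2\|_{C^2_b}$,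 with the following property. If $\mathring R,\mathring P$ are such that $\mathring f(x,v)\neq0$ implies $|x|\le \mathring R$ and $|v|\le\mathring P$, then the integral equation \[ P(t)=\mathring P+C(1+t)^3+C\int_0^t sP(s)\,ds,\qquad t\ge 0, \] has a unique continuous solution $P$ on $[0,\infty[$, and \[ f(t,x,v)=0\quad\text{whenever } t\ge 0 \text{ and } \bigl(|x|\ge\mathring R+t\ \text{ or }\ |v|\ge P(t)\bigr). \] -/

import Mathlib

open MeasureTheory Set

/-- The relativistic velocity of a particle of unit rest mass with momentum `v`. -/
noncomputable def relVelocity (v : ℝ) : ℝ := v / Real.sqrt (1 + v ^ 2)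

/-- Initial data `(f₀, u₁, u₂)` with `f₀ ∈ C¹_c(ℝ²)`, `u₁ ∈ C³_b(ℝ)`, `u₂ ∈ C²_b(ℝ)` whose norms
`‖f₀‖_∞`, `‖f₀‖_1`, `‖u₁‖_{C³_b}`, `‖u₂‖_{C²_b}` are all at most `M`. -/
structure IsVKGData (M : ℝ) (f₀ : ℝ × ℝ → ℝ) (u₁ u₂ : ℝ → ℝ) : Prop where
  contDiff_f : ContDiff ℝ 1 f₀
  compactSupport_f : HasCompactSupport f₀
  contDiff_u₁ : ContDiff ℝ 3 u₁
  contDiff_u₂ : ContDiff ℝ 2 u₂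
  sup_f_le : ∀ z, |f₀ z| ≤ M
  integral_f_le : ∫ z, |f₀ z| ≤ M
  bound_u₁ : ∀ k ≤ 3, ∀ x, |iteratedDeriv k u₁ x| ≤ M
  bound_u₂ : ∀ k ≤ 2, ∀ x, |iteratedDeriv k u₂ x| ≤ M

/-- `(f, u)` is a global classical solution on `[0, ∞[` of the one-dimensional relativistic
Vlasov–Klein–Gordon system with initial data `(f₀, u₁, u₂)`. The arguments are
`f (t, x, v)` and `u (t, x)`; values at negative times play no role, and time derivatives are
taken within `[0, ∞[` (hence one-sided at `t = 0`). -/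
structure IsGlobalVKGSolution (f₀ : ℝ × ℝ → ℝ) (u₁ u₂ : ℝ → ℝ)
    (f : ℝ × ℝ × ℝ → ℝ) (u : ℝ × ℝ → ℝ) : Prop where
  contDiffOn_f : ContDiffOn ℝ 1 f (Ici (0 : ℝ) ×ˢ univ)
  contDiffOn_u : ContDiffOn ℝ 2 u (Ici (0 : ℝ) ×ˢ univ)
  vlasov : ∀ t ≥ 0, ∀ x v,
    derivWithin (fun s => f (s, x, v)) (Ici 0) t
      + relVelocity v * deriv (fun y => f (t, y, v)) x
      - deriv (fun y => u (t, y)) x * deriv (fun w => f (t, x, w)) v = 0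
  integrable_f : ∀ t ≥ 0, ∀ x, Integrable (fun v => f (t, x, v))
  kleinGordon : ∀ t ≥ 0, ∀ x,
    iteratedDerivWithin 2 (fun s => u (s, x)) (Ici 0) t
      - iteratedDeriv 2 (fun y => u (t, y)) x + u (t, x) = - ∫ v, f (t, x, v)
  init_f : ∀ x v, f (0, x, v) = f₀ (x, v)
  init_u : ∀ x, u (0, x) = u₁ x
  init_dtu : ∀ x, derivWithin (fun s => u (s, x)) (Ici 0) 0 = u₂ x

/-- `P` is a continuous solution on `[0, ∞[` of the integral equation
`P(t) = P₀ + C (1 + t)³ + C ∫₀ᵗ s P(s) ds`. -/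
structure SolvesMomentumEquation (C P₀ : ℝ) (P : ℝ → ℝ) : Prop where
  continuousOn : ContinuousOn P (Ici 0)
  eq : ∀ t ≥ 0, P t = P₀ + C * (1 + t) ^ 3 + C * ∫ s in (0 : ℝ)..t, s * P s

/-!
Up to initial data, the Riemann invariants `∂ₜu + σ ∂ₓu`, `σ = ±1`, are integrals of `-ρ - u` along
light rays, so the field `∂ₓu` is controlled by the charge density alone and hence by the largest
momentum. This makes the integral equation for `P` reproduce itself: momenta at most `P` generate a
field at most `P'`, which in turn keeps momenta below `P` along characteristics.

Differentiating a Riemann invariant in space would cost a derivative of `f`. As in the work of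
Glassey and Strauss, the Vlasov equation expresses `∂ₓf` through the derivative of `f` along the
light ray, which integrates to boundary terms, and a derivative in `v`, which is moved onto the
weight `1 / (σ + v̂)`. So `∂ₓ²u` is bounded, and the map from a pair `(u, E)` to the potential
generated by the density transported by `E` preserves the bounds. On each bounded time interval it
contracts the sup norm with weight `exp (-l t)` for `l` large, and its fixed point is the solution.
For uniqueness the same contraction is run inside a backward light cone, where no bounds at spatial
infinity are needed.
-/

/-! ### Ordinary differential equations -/

section ODE

open Filter Topology Metric
open scoped NNReal

variable {E : Type*} [NormedAddCommGroup E] [NormedSpace ℝ E]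

theorem gronwallBound_le_mul_exp {δ K ε x : ℝ} (hK : 0 ≤ K) (hε : 0 ≤ ε) :
    gronwallBound δ K ε x ≤ (δ + ε * x) * Real.exp (K * x) := by
  rcases hK.eq_or_lt with rfl | hK
  · simp [gronwallBound_K0]
  · have exp_sub_one_le : Real.exp (K * x) - 1 ≤ K * x * Real.exp (K * x) := by
      have h := Real.add_one_le_exp (-(K * x))
      have hinv : Real.exp (-(K * x)) * Real.exp (K * x) = 1 := by simp [← Real.exp_add]
      nlinarith [Real.exp_pos (K * x)]
    calc gronwallBound δ K ε x = δ * Real.exp (K * x) + ε / K * (Real.exp (K * x) - 1) :=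
          congrFun (gronwallBound_of_K_ne_0 hK.ne') x
      _ ≤ δ * Real.exp (K * x) + ε / K * (K * x * Real.exp (K * x)) := by gcongr
      _ = (δ + ε * x) * Real.exp (K * x) := by field_simp

theorem norm_le_gronwallBound_of_norm_deriv_le {γ γ' : ℝ → E} {K ε δ t₀ s : ℝ}
    (hd : ∀ r ∈ uIcc t₀ s, HasDerivAt γ (γ' r) r) (hb : ∀ r ∈ uIcc t₀ s, ‖γ' r‖ ≤ K * ‖γ r‖ + ε)
    (h₀ : ‖γ t₀‖ ≤ δ) : ‖γ s‖ ≤ gronwallBound δ K ε |s - t₀| := by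
  rcases le_total t₀ s with h | h
  · rw [uIcc_of_le h] at hd hb
    rw [abs_of_nonneg (sub_nonneg.2 h)]
    exact norm_le_gronwallBound_of_norm_deriv_right_le (HasDerivAt.continuousOn hd)
      (fun r hr => (hd r (Ico_subset_Icc_self hr)).hasDerivWithinAt) h₀
      (fun r hr => hb r (Ico_subset_Icc_self hr)) s (right_mem_Icc.2 h)
  · rw [uIcc_of_ge h] at hd hb
    have mem_of_neg {r : ℝ} (hr : r ∈ Icc (-t₀) (-s)) : -r ∈ Icc s t₀ :=
      ⟨le_neg.1 hr.2, neg_le.1 hr.1⟩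
    have hd' : ∀ r ∈ Icc (-t₀) (-s), HasDerivAt (fun r => γ (-r)) (-γ' (-r)) r := fun r hr => by
      simpa [Function.comp_def] using (hd (-r) (mem_of_neg hr)).scomp r (hasDerivAt_neg r)
    have := norm_le_gronwallBound_of_norm_deriv_right_le (HasDerivAt.continuousOn hd')
      (fun r hr => (hd' r (Ico_subset_Icc_self hr)).hasDerivWithinAt) (by simpa using h₀)
      (fun r hr => (norm_neg (γ' (-r))).trans_le (hb (-r) (mem_of_neg (Ico_subset_Icc_self hr))))
      (-s) (right_mem_Icc.2 (neg_le_neg h))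
    rw [abs_of_nonpos (sub_nonpos.2 h), neg_sub]
    simpa [sub_eq_add_neg, add_comm] using this

theorem norm_le_mul_exp_of_norm_deriv_le {γ γ' : ℝ → E} {K ε δ t₀ s : ℝ} (hK : 0 ≤ K) (hε : 0 ≤ ε)
    (hd : ∀ r ∈ uIcc t₀ s, HasDerivAt γ (γ' r) r) (hb : ∀ r ∈ uIcc t₀ s, ‖γ' r‖ ≤ K * ‖γ r‖ + ε)
    (h₀ : ‖γ t₀‖ ≤ δ) : ‖γ s‖ ≤ (δ + ε * |s - t₀|) * Real.exp (K * |s - t₀|) :=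
  (norm_le_gronwallBound_of_norm_deriv_le hd hb h₀).trans (gronwallBound_le_mul_exp hK hε)

/-- The radial retraction of a normed space onto the ball of radius `N`; it serves to truncate
vector fields. -/
noncomputable def radialRetraction (N : ℝ) (p : E) : E := (N / max N ‖p‖) • p

theorem radialRetraction_of_norm_le {N : ℝ} (hN : 0 < N) {p : E} (h : ‖p‖ ≤ N) :
    radialRetraction N p = p := by
  rw [radialRetraction, max_eq_left h, div_self hN.ne', one_smul]

theorem norm_radialRetraction_le {N : ℝ} (hN : 0 < N) (p : E) : ‖radialRetraction N p‖ ≤ N := by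
  have hmax : 0 < max N ‖p‖ := lt_max_of_lt_left hN
  rw [radialRetraction, norm_smul, Real.norm_of_nonneg (by positivity), div_mul_eq_mul_div,
    div_le_iff₀ hmax]
  gcongr
  exact le_max_right _ _

theorem norm_radialRetraction_le_norm {N : ℝ} (hN : 0 < N) (p : E) :
    ‖radialRetraction N p‖ ≤ ‖p‖ := by
  have hmax : 0 < max N ‖p‖ := lt_max_of_lt_left hN
  rw [radialRetraction, norm_smul, Real.norm_of_nonneg (by positivity)]
  exact mul_le_of_le_one_left (norm_nonneg p) ((div_le_one hmax).2 (le_max_left _ _))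

theorem lipschitzWith_radialRetraction {N : ℝ} (hN : 0 < N) :
    LipschitzWith 2 (radialRetraction N : E → E) := by
  refine LipschitzWith.of_dist_le_mul fun p q => ?_
  rw [dist_eq_norm, dist_eq_norm, NNReal.coe_ofNat, two_mul]
  have hp : 0 < max N ‖p‖ := lt_max_of_lt_left hN
  have hq : 0 < max N ‖q‖ := lt_max_of_lt_left hN
  have split : radialRetraction N p - radialRetraction N q
      = (N / max N ‖p‖) • (p - q) + (N / max N ‖p‖ - N / max N ‖q‖) • q := by
    simp only [radialRetraction]; module
  have factor_le : N / max N ‖p‖ ≤ 1 := (div_le_one hp).2 (le_max_left _ _)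
  have factor_sub_le : |N / max N ‖p‖ - N / max N ‖q‖| * ‖q‖ ≤ ‖p - q‖ := calc
    _ = N / max N ‖p‖ * |max N ‖q‖ - max N ‖p‖| * (‖q‖ / max N ‖q‖) := by
      rw [div_sub_div _ _ hp.ne' hq.ne', abs_div, abs_of_pos (mul_pos hp hq), mul_comm _ N,
        ← mul_sub, abs_mul, abs_of_pos hN]
      field_simp
    _ ≤ 1 * ‖p - q‖ * 1 := by
      gcongr
      · rw [norm_sub_rev]
        simpa [max_comm] using
          (abs_max_sub_max_le_abs ‖q‖ ‖p‖ N).trans (abs_norm_sub_norm_le q p)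
      · exact (div_le_one hq).2 (le_max_right _ _)
    _ = ‖p - q‖ := by ring
  calc _ ≤ ‖(N / max N ‖p‖) • (p - q)‖ + ‖(N / max N ‖p‖ - N / max N ‖q‖) • q‖ :=
        split ▸ norm_add_le _ _
    _ = N / max N ‖p‖ * ‖p - q‖ + |N / max N ‖p‖ - N / max N ‖q‖| * ‖q‖ := by
        rw [norm_smul, norm_smul, Real.norm_of_nonneg (by positivity), Real.norm_eq_abs]
    _ ≤ ‖p - q‖ + ‖p - q‖ := by
        gcongr; exact mul_le_of_le_one_left (norm_nonneg _) factor_le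

theorem integralCurve_eq_of_lipschitzWith {F : ℝ → E → E}
    (hF : ∀ T, ∃ K : ℝ≥0, ∀ t ∈ Icc (-T) T, LipschitzWith K (F t)) {γ η : ℝ → E}
    (hγ : IsIntegralCurve γ F) (hη : IsIntegralCurve η F) {t₀ : ℝ} (h : γ t₀ = η t₀) : γ = η := by
  funext s
  obtain ⟨K, hK⟩ := hF (max |t₀| |s| + 1)
  have mem {r : ℝ} (hr : |r| ≤ max |t₀| |s|) :
      r ∈ Ioo (-(max |t₀| |s| + 1)) (max |t₀| |s| + 1) := abs_lt.1 (by linarith)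
  exact ODE_solution_unique_of_mem_Ioo (s := fun _ => univ)
    (fun t ht => (hK t (Ioo_subset_Icc_self ht)).lipschitzOnWith) (mem (le_max_left _ _))
    (fun t _ => ⟨hγ t, mem_univ _⟩) (fun t _ => ⟨hη t, mem_univ _⟩) h (mem (le_max_right _ _))

variable [CompleteSpace E] {F : ℝ → E → E}

theorem exists_hasDerivAt_of_lipschitzWith_of_norm_le {T t₀ : ℝ} {K L : ℝ≥0}
    (hc : ∀ x, Continuous fun t => F t x) (hK : ∀ t ∈ Icc (-T) T, LipschitzWith K (F t))
    (hL : ∀ t ∈ Icc (-T) T, ∀ x, ‖F t x‖ ≤ L) (ht₀ : t₀ ∈ Ioo (-T) T) (z : E) :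
    ∃ γ : ℝ → E, γ t₀ = z ∧ ∀ t ∈ Ioo (-T) T, HasDerivAt γ (F t (γ t)) t := by
  have hT : 0 ≤ T := (abs_nonneg t₀).trans (abs_lt.2 ht₀).le
  have hPL : IsPicardLindelof F (⟨t₀, Ioo_subset_Icc_self ht₀⟩ : Icc (-T) T) z
      (L * NNReal.mk (2 * T) (by positivity)) 0 L K :=
    { lipschitzOnWith := fun t ht => (hK t ht).lipschitzOnWith
      continuousOn := fun x _ => (hc x).continuousOn
      norm_le := fun t ht x _ => hL t ht x
      mul_max_le := by
        rw [NNReal.coe_zero, sub_zero, NNReal.coe_mul, NNReal.coe_mk]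
        gcongr
        exact max_le (by linarith [ht₀.1]) (by linarith [ht₀.2]) }
  obtain ⟨γ, h0, hγ⟩ := hPL.exists_eq_forall_mem_Icc_hasDerivWithinAt₀
  exact ⟨γ, h0, fun t ht => (hγ t (Ioo_subset_Icc_self ht)).hasDerivAt (Icc_mem_nhds ht.1 ht.2)⟩

theorem exists_hasDerivAt_of_lipschitzWith {T t₀ : ℝ} {K : ℝ≥0}
    (hc : ∀ x, Continuous fun t => F t x) (hK : ∀ t ∈ Icc (-T) T, LipschitzWith K (F t))
    (ht₀ : t₀ ∈ Ioo (-T) T) (z : E) :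
    ∃ γ : ℝ → E, γ t₀ = z ∧ ∀ t ∈ Ioo (-T) T, HasDerivAt γ (F t (γ t)) t := by
  obtain ⟨B, hB⟩ := (isCompact_Icc (a := -T) (b := T)).exists_bound_of_continuousOn
    (hc 0).continuousOn
  have hB0 : 0 ≤ B := (norm_nonneg _).trans (hB t₀ (Ioo_subset_Icc_self ht₀))
  have hT : 0 < T := (abs_nonneg t₀).trans_lt (abs_lt.2 ht₀)
  have norm_le : ∀ t ∈ Icc (-T) T, ∀ p, ‖F t p‖ ≤ K * ‖p‖ + B := fun t ht p => calc
    ‖F t p‖ ≤ ‖F t p - F t 0‖ + ‖F t 0‖ := norm_le_norm_sub_add _ _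
    _ ≤ K * ‖p‖ + B := by
      gcongr
      · simpa using (hK t ht).norm_sub_le p 0
      · exact hB t ht
  -- Grönwall's inequality keeps the solution of the truncated equation in the ball of radius `N`.
  set N : ℝ := (‖z‖ + B * (2 * T)) * Real.exp (K * (2 * T)) + 1
  have hN : 0 < N := by positivity
  obtain ⟨γ, h0, hγ⟩ := exists_hasDerivAt_of_lipschitzWith_of_norm_le
    (F := fun t p => F t (radialRetraction N p)) (L := NNReal.mk (K * N + B) (by positivity))
    (fun x => hc _) (fun t ht => (hK t ht).comp (lipschitzWith_radialRetraction hN))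
    (fun t ht x => (norm_le t ht _).trans (by
      rw [NNReal.coe_mk]; gcongr; exact norm_radialRetraction_le hN x)) ht₀ z
  refine ⟨γ, h0, fun t ht => ?_⟩
  have hsub : uIcc t₀ t ⊆ Ioo (-T) T := ordConnected_Ioo.uIcc_subset ht₀ ht
  have hdist : |t - t₀| ≤ 2 * T :=
    abs_le.2 ⟨by linarith [ht.1, ht₀.2], by linarith [ht.2, ht₀.1]⟩
  have norm_γ_le : ‖γ t‖ ≤ N := calc
    ‖γ t‖ ≤ (‖z‖ + B * |t - t₀|) * Real.exp (K * |t - t₀|) :=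
      norm_le_mul_exp_of_norm_deriv_le K.2 hB0 (fun r hr => hγ r (hsub hr))
        (fun r hr => (norm_le r (Ioo_subset_Icc_self (hsub hr)) _).trans (by
          gcongr; exact norm_radialRetraction_le_norm hN _)) (by rw [h0])
    _ ≤ (‖z‖ + B * (2 * T)) * Real.exp (K * (2 * T)) := by gcongr
    _ ≤ N := by linarith
  simpa only [radialRetraction_of_norm_le hN norm_γ_le] using hγ t ht

theorem exists_isIntegralCurve_of_lipschitzWith (hc : ∀ x, Continuous fun t => F t x)
    (hF : ∀ T, ∃ K : ℝ≥0, ∀ t ∈ Icc (-T) T, LipschitzWith K (F t)) (t₀ : ℝ) (z : E) :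
    ∃ γ : ℝ → E, γ t₀ = z ∧ IsIntegralCurve γ F := by
  let I (n : ℕ) : Set ℝ := Ioo (-(|t₀| + n + 1)) (|t₀| + n + 1)
  have ht₀ (n : ℕ) : t₀ ∈ I n := abs_lt.1 (by linarith [n.cast_nonneg (α := ℝ)])
  have exists_on (n : ℕ) : ∃ γ : ℝ → E, γ t₀ = z ∧ ∀ t ∈ I n, HasDerivAt γ (F t (γ t)) t := by
    obtain ⟨K, hK⟩ := hF (|t₀| + n + 1)
    exact exists_hasDerivAt_of_lipschitzWith hc hK (ht₀ n) z
  choose γ h0 hγ using exists_on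
  have I_mono {m n : ℕ} (hmn : m ≤ n) : I m ⊆ I n := by
    have : (m : ℝ) ≤ n := by exact_mod_cast hmn
    exact Ioo_subset_Ioo (by linarith) (by linarith)
  have eqOn {m n : ℕ} (hmn : m ≤ n) : EqOn (γ m) (γ n) (I m) := by
    obtain ⟨K, hK⟩ := hF (|t₀| + m + 1)
    exact ODE_solution_unique_of_mem_Ioo (s := fun _ => univ)
      (fun t ht => (hK t (Ioo_subset_Icc_self ht)).lipschitzOnWith) (ht₀ m)
      (fun t ht => ⟨hγ m t ht, mem_univ _⟩) (fun t ht => ⟨hγ n t (I_mono hmn ht), mem_univ _⟩)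
      ((h0 m).trans (h0 n).symm)
  have mem_ceil (s : ℝ) : s ∈ I ⌈|s|⌉₊ :=
    abs_lt.1 (by linarith [Nat.le_ceil |s|, abs_nonneg t₀])
  have glue_eq {n : ℕ} {s : ℝ} (hs : ⌈|s|⌉₊ ≤ n) : γ ⌈|s|⌉₊ s = γ n s := eqOn hs (mem_ceil s)
  refine ⟨fun s => γ ⌈|s|⌉₊ s, h0 _, fun t => ?_⟩
  have eventually_eq : (fun s => γ ⌈|s|⌉₊ s) =ᶠ[𝓝 t] γ (⌈|t|⌉₊ + 1) := by
    filter_upwards [continuous_abs.continuousAt.eventually_lt continuousAt_const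
      (lt_add_one |t|)] with s hs
    refine glue_eq (Nat.ceil_le.2 ?_)
    push_cast
    linarith [Nat.le_ceil |t|]
  have := (hγ (⌈|t|⌉₊ + 1) t (I_mono (Nat.le_succ _) (mem_ceil t))).congr_of_eventuallyEq
    eventually_eq
  simpa only [glue_eq (Nat.le_succ ⌈|t|⌉₊)] using this

end ODE

section ParametricODE

open Filter Topology
open scoped NNReal

variable {E : Type*} [NormedAddCommGroup E] {Λ : Type*} [TopologicalSpace Λ] {F : Λ → ℝ → E → E}

theorem eventually_norm_sub_lt_of_continuous
    (hF : Continuous fun p : Λ × ℝ × E => F p.1 p.2.1 p.2.2) {η : ℝ → E} (hη : Continuous η)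
    (l₀ : Λ) (T : ℝ) {δ : ℝ} (hδ : 0 < δ) :
    ∀ᶠ l in 𝓝 l₀, ∀ s ∈ Icc (-T) T, ‖F l s (η s) - F l₀ s (η s)‖ < δ := by
  have hcont : Continuous fun p : Λ × ℝ => F p.1 p.2 (η p.2) :=
    hF.comp (continuous_fst.prodMk (continuous_snd.prodMk (hη.comp continuous_snd)))
  obtain ⟨v, hv, hvF⟩ := (isCompact_Icc (a := -T) (b := T)).mem_uniformity_of_prod
    (f := fun l s => F l s (η s)) (s := univ) (q := l₀) hcont.continuousOn (mem_univ _)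
    (Metric.dist_mem_uniformity hδ)
  rw [nhdsWithin_univ] at hv
  filter_upwards [hv] with l hl s hs
  simpa only [mem_ofPred_eq, dist_eq_norm] using hvF l hl s hs

variable [NormedSpace ℝ E]

theorem continuous_integralCurve (hF : Continuous fun p : Λ × ℝ × E => F p.1 p.2.1 p.2.2)
    (hL : ∀ l₀ T, ∃ K : ℝ≥0, ∀ᶠ l in 𝓝 l₀, ∀ s ∈ Icc (-T) T, LipschitzWith K (F l s))
    {Y : Λ → ℝ → E} (hY : ∀ l, IsIntegralCurve (Y l) (F l)) {τ : Λ → ℝ}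
    (hτ : Continuous τ) (h₀ : Continuous fun l => Y l (τ l)) :
    Continuous fun p : Λ × ℝ => Y p.1 p.2 := by
  rw [continuous_iff_continuousAt]
  rintro ⟨l₀, s₀⟩
  have hY0 : Continuous (Y l₀) := (hY l₀).continuous
  set T : ℝ := max |s₀| |τ l₀| + 1
  have hT : 0 < T := by positivity
  obtain ⟨K, hK⟩ := hL l₀ T
  rw [Metric.continuousAt_iff']
  intro e he
  set δ : ℝ := e / 4 / ((1 + 2 * T) * Real.exp (K * (2 * T)))
  have hδ : 0 < δ := by positivity
  have δ_mul : (δ + δ * (2 * T)) * Real.exp (K * (2 * T)) = e / 4 := by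
    simp only [δ]; field_simp
  have hτT : ∀ᶠ l in 𝓝 l₀, |τ l| < T := hτ.abs.continuousAt.eventually_lt continuousAt_const
    (by linarith [le_max_right |s₀| |τ l₀|])
  have initial_lt : ∀ᶠ l in 𝓝 l₀, ‖Y l (τ l) - Y l₀ (τ l)‖ < δ :=
    (h₀.sub (hY0.comp hτ)).norm.continuousAt.eventually_lt continuousAt_const (by simpa using hδ)
  have hs : ∀ᶠ s in 𝓝 s₀, |s| < T ∧ dist (Y l₀ s) (Y l₀ s₀) < e / 2 :=
    (continuous_abs.continuousAt.eventually_lt continuousAt_const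
      (by linarith [le_max_left |s₀| |τ l₀|])).and
      (Metric.continuousAt_iff'.1 hY0.continuousAt _ (half_pos he))
  rw [nhds_prod_eq]
  filter_upwards [((hK.and (eventually_norm_sub_lt_of_continuous hF hY0 l₀ T hδ)).and
    (hτT.and initial_lt)).prod_mk hs]
  rintro ⟨l, s⟩ ⟨⟨⟨hKl, hFl⟩, hτl, hil⟩, hsT, hse⟩
  have hsub : uIcc (τ l) s ⊆ Icc (-T) T :=
    ordConnected_Icc.uIcc_subset (abs_le.1 hτl.le) (abs_le.1 hsT.le)
  have hdist : |s - τ l| ≤ 2 * T := by linarith [abs_sub s (τ l)]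
  have deriv_le (r : ℝ) (hr : r ∈ uIcc (τ l) s) :
      ‖F l r (Y l r) - F l₀ r (Y l₀ r)‖ ≤ K * ‖Y l r - Y l₀ r‖ + δ :=
    (norm_sub_le_norm_sub_add_norm_sub _ _ _).trans
      (add_le_add ((hKl r (hsub hr)).norm_sub_le _ _) (hFl r (hsub hr)).le)
  have norm_sub_le : ‖Y l s - Y l₀ s‖ ≤ e / 4 := calc
    _ ≤ (δ + δ * |s - τ l|) * Real.exp (K * |s - τ l|) :=
      norm_le_mul_exp_of_norm_deriv_le K.2 hδ.le (fun r _ => (hY l r).sub (hY l₀ r)) deriv_le hil.le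
    _ ≤ (δ + δ * (2 * T)) * Real.exp (K * (2 * T)) := by gcongr
    _ = e / 4 := δ_mul
  calc dist (Y l s) (Y l₀ s₀) ≤ dist (Y l s) (Y l₀ s) + dist (Y l₀ s) (Y l₀ s₀) :=
        dist_triangle _ _ _
    _ < e := by rw [dist_eq_norm (Y l s)]; linarith

end ParametricODE

/-! ### Differentiation tools -/

section Calculus

open Filter

variable {E G : Type*} [NormedAddCommGroup E] [NormedSpace ℝ E] [NormedAddCommGroup G]
  [NormedSpace ℝ G]

theorem continuous_toSpanSingleton_comp {X : Type*} [TopologicalSpace X] {g : X → G}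
    (c : Continuous g) : Continuous fun x => ContinuousLinearMap.toSpanSingleton ℝ (g x) :=
  (ContinuousLinearMap.toSpanSingletonCLE (𝕜 := ℝ) (E := G)).continuous.comp c

theorem hasFDerivAt_of_partial {f f₁ : ℝ → E → G} {f₂ : ℝ → E → E →L[ℝ] G}
    (h₁ : ∀ t x, HasDerivAt (fun s => f s x) (f₁ t x) t)
    (h₂ : ∀ t x, HasFDerivAt (f t) (f₂ t x) x)
    (c₁ : Continuous fun p : ℝ × E => f₁ p.1 p.2)
    (c₂ : Continuous fun p : ℝ × E => f₂ p.1 p.2) (p : ℝ × E) :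
    HasFDerivAt (fun p : ℝ × E => f p.1 p.2)
      ((ContinuousLinearMap.toSpanSingleton ℝ (f₁ p.1 p.2)).coprod (f₂ p.1 p.2)) p :=
  (hasStrictFDerivAt_uncurry_coprod (𝕜 := ℝ)
    (f₁ := fun t x => ContinuousLinearMap.toSpanSingleton ℝ (f₁ t x)) (f₂ := f₂)
    (Eventually.of_forall fun v => (h₁ v.1 v.2).hasFDerivAt)
    (Eventually.of_forall fun v => h₂ v.1 v.2)
    (continuous_toSpanSingleton_comp c₁).continuousAt
    c₂.continuousAt).hasFDerivAt

theorem contDiff_one_of_partial {f f₁ : ℝ → E → G} {f₂ : ℝ → E → E →L[ℝ] G}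
    (h₁ : ∀ t x, HasDerivAt (fun s => f s x) (f₁ t x) t)
    (h₂ : ∀ t x, HasFDerivAt (f t) (f₂ t x) x)
    (c₁ : Continuous fun p : ℝ × E => f₁ p.1 p.2)
    (c₂ : Continuous fun p : ℝ × E => f₂ p.1 p.2) :
    ContDiff ℝ 1 fun p : ℝ × E => f p.1 p.2 := by
  have hfderiv := hasFDerivAt_of_partial h₁ h₂ c₁ c₂
  refine contDiff_one_iff_fderiv.2 ⟨fun p => (hfderiv p).differentiableAt, ?_⟩
  rw [funext fun p => (hfderiv p).fderiv]
  exact (ContinuousLinearMap.coprodEquivL (E := ℝ) (F := E) (G := G) ℝ).continuous.comp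
    ((continuous_toSpanSingleton_comp c₁).prodMk c₂)

theorem contDiff_one_of_partial_deriv {f f₁ f₂ : ℝ → ℝ → G}
    (h₁ : ∀ t x, HasDerivAt (fun s => f s x) (f₁ t x) t)
    (h₂ : ∀ t x, HasDerivAt (f t) (f₂ t x) x)
    (c₁ : Continuous fun p : ℝ × ℝ => f₁ p.1 p.2)
    (c₂ : Continuous fun p : ℝ × ℝ => f₂ p.1 p.2) :
    ContDiff ℝ 1 fun p : ℝ × ℝ => f p.1 p.2 :=
  contDiff_one_of_partial h₁ (fun t x => (h₂ t x).hasFDerivAt) c₁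
    (continuous_toSpanSingleton_comp c₂)

theorem contDiff_two_of_partial_deriv {f f₁ f₂ : ℝ → ℝ → G}
    (h₁ : ∀ t x, HasDerivAt (fun s => f s x) (f₁ t x) t)
    (h₂ : ∀ t x, HasDerivAt (f t) (f₂ t x) x)
    (c₁ : ContDiff ℝ 1 fun p : ℝ × ℝ => f₁ p.1 p.2)
    (c₂ : ContDiff ℝ 1 fun p : ℝ × ℝ => f₂ p.1 p.2) :
    ContDiff ℝ 2 fun p : ℝ × ℝ => f p.1 p.2 := by
  have hfderiv := hasFDerivAt_of_partial h₁ (fun t x => (h₂ t x).hasFDerivAt) c₁.continuous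
    (continuous_toSpanSingleton_comp c₂.continuous)
  have toSpanSingleton := (ContinuousLinearMap.toSpanSingletonCLE (𝕜 := ℝ) (E := G)).contDiff
    (n := 1)
  refine (contDiff_succ_iff_fderiv (n := 1)).2 ⟨fun p => (hfderiv p).differentiableAt, by simp, ?_⟩
  rw [funext fun p => (hfderiv p).fderiv]
  exact (ContinuousLinearMap.coprodEquivL (E := ℝ) (F := ℝ) (G := G) ℝ).contDiff.comp
    ((toSpanSingleton.comp c₁).prodMk (toSpanSingleton.comp c₂))

theorem derivWithin_Ici_eq {h : ℝ → G} {h' : G} {a t : ℝ} (hh : HasDerivAt h h' t) (ht : a ≤ t) :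
    derivWithin h (Ici a) t = h' :=
  hh.hasDerivWithinAt.derivWithin (uniqueDiffOn_Ici a t ht)

theorem iteratedDerivWithin_two_Ici_eq {h h' : ℝ → G} {h'' : G} {a t : ℝ}
    (hh : ∀ s, HasDerivAt h (h' s) s) (hh' : HasDerivAt h' h'' t) (ht : a ≤ t) :
    iteratedDerivWithin 2 h (Ici a) t = h'' := by
  have first_eq {s : ℝ} (hs : s ∈ Ici a) : iteratedDerivWithin 1 h (Ici a) s = h' s := by
    rw [iteratedDerivWithin_one, derivWithin_Ici_eq (hh s) hs]
  rw [iteratedDerivWithin_succ, ← derivWithin_Ici_eq hh' ht]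
  exact derivWithin_congr (fun _ => first_eq) (first_eq ht)

theorem eq_zero_of_le_abs {g : ℝ → ℝ} (hg : Continuous g) {R x : ℝ}
    (h : ∀ y, g y ≠ 0 → |y| ≤ R) (hx : R ≤ |x|) : g x = 0 := by
  by_contra hne
  have mem_interior : x ∈ interior (Icc (-R) R) :=
    interior_maximal (fun y hy => abs_le.1 (h y hy)) (hg.isOpen_preimage _ isOpen_ne) hne
  rw [interior_Icc] at mem_interior
  exact hx.not_gt (abs_lt.2 mem_interior)

theorem hasDerivAt_comp_of_partial {f f₁ f₂ : ℝ → ℝ → G}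
    (h₁ : ∀ t x, HasDerivAt (fun s => f s x) (f₁ t x) t)
    (h₂ : ∀ t x, HasDerivAt (f t) (f₂ t x) x)
    (c₁ : Continuous fun p : ℝ × ℝ => f₁ p.1 p.2)
    (c₂ : Continuous fun p : ℝ × ℝ => f₂ p.1 p.2) {a b : ℝ → ℝ} {a' b' s : ℝ}
    (ha : HasDerivAt a a' s) (hb : HasDerivAt b b' s) :
    HasDerivAt (fun s => f (a s) (b s)) (a' • f₁ (a s) (b s) + b' • f₂ (a s) (b s)) s := by
  have := (hasFDerivAt_of_partial h₁ (fun t x => (h₂ t x).hasFDerivAt) c₁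
    (continuous_toSpanSingleton_comp c₂) (a s, b s)).comp_hasDerivAt s (ha.prodMk hb)
  simpa only [Function.comp_def, ContinuousLinearMap.coprod_apply,
    ContinuousLinearMap.toSpanSingleton_apply] using this

theorem hasDerivAt_intervalIntegral {F F' : ℝ → ℝ → G} (a b : ℝ)
    (hF : ∀ p v, HasDerivAt (fun q => F q v) (F' p v) p)
    (c : ∀ p, Continuous (F p)) (c' : Continuous fun p : ℝ × ℝ => F' p.1 p.2) (p : ℝ) :
    HasDerivAt (fun q => ∫ v in a..b, F q v) (∫ v in a..b, F' p v) p := by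
  obtain ⟨M, hM⟩ := ((isCompact_Icc (a := p - 1) (b := p + 1)).prod
    (isCompact_uIcc (a := a) (b := b))).exists_bound_of_continuousOn c'.continuousOn
  refine (intervalIntegral.hasDerivAt_integral_of_dominated_loc_of_deriv_le (μ := volume)
    (F := F) (F' := F') (bound := fun _ => M) (s := Icc (p - 1) (p + 1))
    (Icc_mem_nhds (by linarith) (by linarith)) ?_ ((c p).intervalIntegrable _ _) ?_ ?_
    (by simp) ?_).2
  · exact Eventually.of_forall fun q => (c q).aestronglyMeasurable
  · exact (c'.comp (continuous_const.prodMk continuous_id)).aestronglyMeasurable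
  · exact ae_of_all _ fun v hv q hq => hM (q, v) ⟨hq, uIoc_subset_uIcc hv⟩
  · exact ae_of_all _ fun v _ q _ => hF q v

theorem hasFDerivAt_of_sub_eq {f : E → G} {A : E → E →L[ℝ] G} {x : E} (hA : ContinuousAt A x)
    (h : ∀ y, f y - f x = A y (y - x)) : HasFDerivAt f (A x) x := by
  rw [hasFDerivAt_iff_isLittleO, Asymptotics.isLittleO_iff]
  intro c hc
  filter_upwards [Metric.continuousAt_iff'.1 hA c hc] with y hy
  rw [h, ← sub_apply]
  exact (A y - A x).le_of_opNorm_le (dist_eq_norm (A y) (A x) ▸ hy.le) _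

theorem hasDerivAt_clm_apply_of_eq_zero {A : ℝ → E →L[ℝ] G} {b : ℝ → E} {b' : E} {t : ℝ}
    (hA : ContinuousAt A t) (hb : HasDerivAt b b' t) (h₀ : b t = 0) :
    HasDerivAt (fun s => A s (b s)) (A t b') t := by
  rw [hasDerivAt_iff_tendsto_slope] at hb ⊢
  have hpair := (hA.mono_left nhdsWithin_le_nhds).prodMk_nhds hb
  refine ((isBoundedBilinearMap_apply.continuous.tendsto (A t, b')).comp hpair).congr fun s => ?_
  simp only [Function.comp_apply, slope_def_module, h₀, sub_zero, map_zero, map_smul]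

/-- The mean value of the derivative `f'` over the segment from `a` to `b`. -/
noncomputable def meanFDeriv (f' : E → E →L[ℝ] G) (a b : E) : E →L[ℝ] G :=
  ∫ θ in (0 : ℝ)..1, f' (a + θ • (b - a))

theorem continuous_meanFDeriv {Λ : Type*} [TopologicalSpace Λ] {f' : Λ → E → E →L[ℝ] G}
    (c : Continuous fun p : Λ × E => f' p.1 p.2) :
    Continuous fun p : Λ × E × E => meanFDeriv (f' p.1) p.2.1 p.2.2 :=
  intervalIntegral.continuous_parametric_intervalIntegral_of_continuous'
    (f := fun (p : Λ × E × E) θ => f' p.1 (p.2.1 + θ • (p.2.2 - p.2.1)))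
    (c.comp (show Continuous fun q : (Λ × E × E) × ℝ =>
      (q.1.1, q.1.2.1 + q.2 • (q.1.2.2 - q.1.2.1)) by fun_prop)) 0 1

theorem norm_meanFDeriv_le {f' : E → E →L[ℝ] G} {K : ℝ} (h : ∀ x, ‖f' x‖ ≤ K) (a b : E) :
    ‖meanFDeriv f' a b‖ ≤ K := by
  have := intervalIntegral.norm_integral_le_of_norm_le_const (a := 0) (b := 1)
    (f := fun θ : ℝ => f' (a + θ • (b - a))) (C := K) fun θ _ => h _
  simpa [meanFDeriv] using this

theorem sub_eq_meanFDeriv_apply [CompleteSpace G] {f : E → G} {f' : E → E →L[ℝ] G}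
    (hf : ∀ x, HasFDerivAt f (f' x) x) (c : Continuous f') (a b : E) :
    f b - f a = meanFDeriv f' a b (b - a) := by
  have segment (θ : ℝ) : HasDerivAt (fun θ : ℝ => a + θ • (b - a)) (b - a) θ := by
    simpa using ((hasDerivAt_id θ).smul_const (b - a)).const_add a
  have c' : Continuous fun θ : ℝ => f' (a + θ • (b - a)) := c.comp (by fun_prop)
  rw [meanFDeriv, ContinuousLinearMap.intervalIntegral_apply (c'.intervalIntegrable _ _),
    intervalIntegral.integral_eq_sub_of_hasDerivAt
      (fun θ _ => (hf _).comp_hasDerivAt θ (segment θ))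
      ((c'.clm_apply continuous_const).intervalIntegrable _ _)]
  simp

theorem abs_half_add_le {a b c : ℝ} (ha : |a| ≤ c) (hb : |b| ≤ c) : |(a + b) / 2| ≤ c := by
  rw [abs_div, abs_two]
  linarith [abs_add_le a b]

theorem abs_half_sub_le {a b c : ℝ} (ha : |a| ≤ c) (hb : |b| ≤ c) : |(a - b) / 2| ≤ c := by
  rw [sub_eq_add_neg]
  exact abs_half_add_le ha (by rwa [abs_neg])

theorem abs_intervalIntegral_le {g B : ℝ → ℝ} {t : ℝ} (ht : 0 ≤ t) (cB : Continuous B)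
    (h : ∀ s ∈ Icc 0 t, |g s| ≤ B s) : |∫ s in (0 : ℝ)..t, g s| ≤ ∫ s in (0 : ℝ)..t, B s :=
  intervalIntegral.norm_integral_le_of_norm_le (f := g) (μ := volume) ht
    (ae_of_all _ fun s hs => h s (Ioc_subset_Icc_self hs)) (cB.intervalIntegrable _ _)

end Calculus

/-! ### Integration along characteristic lines of the wave operator -/

section LineIntegral

/-- The integral of `g` along the line `s ↦ (s, x + σ (t - s))`. -/
noncomputable def lineIntegral (σ : ℝ) (g : ℝ → ℝ → ℝ) (t x : ℝ) : ℝ :=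
  ∫ s in (0 : ℝ)..t, g s (x + σ * (t - s))

variable {σ : ℝ} {g g' : ℝ → ℝ → ℝ}

theorem continuous_lineIntegral (σ : ℝ) (c : Continuous fun p : ℝ × ℝ => g p.1 p.2) :
    Continuous fun p : ℝ × ℝ => lineIntegral σ g p.1 p.2 := by
  unfold lineIntegral
  refine intervalIntegral.continuous_parametric_intervalIntegral_of_continuous
    (f := fun (p : ℝ × ℝ) s => g s (p.2 + σ * (p.1 - s))) ?_ continuous_fst
  have : Continuous fun q : (ℝ × ℝ) × ℝ => (q.2, q.1.2 + σ * (q.1.1 - q.2)) := by fun_prop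
  exact c.comp this

theorem hasDerivAt_lineIntegral_right (σ : ℝ) (c : Continuous fun p : ℝ × ℝ => g p.1 p.2)
    (c' : Continuous fun p : ℝ × ℝ => g' p.1 p.2) (h : ∀ t x, HasDerivAt (g t) (g' t x) x)
    (t x : ℝ) : HasDerivAt (lineIntegral σ g t) (lineIntegral σ g' t x) x := by
  unfold lineIntegral
  refine hasDerivAt_intervalIntegral (F := fun x s => g s (x + σ * (t - s)))
    (F' := fun x s => g' s (x + σ * (t - s))) 0 t ?_ ?_ ?_ x
  · intro p v
    simpa using (h v (p + σ * (t - v))).comp_add_const p (σ * (t - v))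
  · intro p
    have : Continuous fun s : ℝ => (s, p + σ * (t - s)) := by fun_prop
    exact c.comp this
  · have : Continuous fun q : ℝ × ℝ => (q.2, q.1 + σ * (t - q.2)) := by fun_prop
    exact c'.comp this

theorem hasDerivAt_lineIntegral_left (σ : ℝ) (c : Continuous fun p : ℝ × ℝ => g p.1 p.2)
    (c' : Continuous fun p : ℝ × ℝ => g' p.1 p.2) (h : ∀ t x, HasDerivAt (g t) (g' t x) x)
    (t x : ℝ) :
    HasDerivAt (fun s => lineIntegral σ g s x) (σ * lineIntegral σ g' t x + g t x) t := by
  set G : ℝ → ℝ → ℝ := fun t y => ∫ s in (0 : ℝ)..t, g s (y - σ * s)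
  set G' : ℝ → ℝ → ℝ := fun t y => ∫ s in (0 : ℝ)..t, g' s (y - σ * s)
  have hG_left : ∀ t y, HasDerivAt (fun s => G s y) (g t (y - σ * t)) t := fun t y => by
    have : Continuous fun s : ℝ => g s (y - σ * s) :=
      c.comp (show Continuous fun s : ℝ => (s, y - σ * s) by fun_prop)
    exact intervalIntegral.integral_hasDerivAt_right (this.intervalIntegrable _ _)
      (this.stronglyMeasurableAtFilter _ _) this.continuousAt
  have hG_right : ∀ t y, HasDerivAt (G t) (G' t y) y := fun t y => by
    refine hasDerivAt_intervalIntegral (F := fun x s => g s (x - σ * s))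
      (F' := fun x s => g' s (x - σ * s)) 0 t ?_ ?_ ?_ y
    · intro p v
      simpa using (h v (p - σ * v)).comp_sub_const p (σ * v)
    · exact fun p => c.comp (show Continuous fun s : ℝ => (s, p - σ * s) by fun_prop)
    · exact c'.comp (show Continuous fun q : ℝ × ℝ => (q.2, q.1 - σ * q.2) by fun_prop)
  have cg : Continuous fun p : ℝ × ℝ => g p.1 (p.2 - σ * p.1) :=
    c.comp (show Continuous fun q : ℝ × ℝ => (q.1, q.2 - σ * q.1) by fun_prop)
  have cG' : Continuous fun p : ℝ × ℝ => G' p.1 p.2 :=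
    intervalIntegral.continuous_parametric_intervalIntegral_of_continuous
      (f := fun (p : ℝ × ℝ) s => g' s (p.2 - σ * s))
      (c'.comp (show Continuous fun q : (ℝ × ℝ) × ℝ => (q.2, q.1.2 - σ * q.2) by fun_prop))
      continuous_fst
  have hline : HasDerivAt (fun s : ℝ => x + σ * s) σ t := by
    simpa using ((hasDerivAt_id t).const_mul σ).const_add x
  have := hasDerivAt_comp_of_partial hG_left hG_right cg cG' (hasDerivAt_id t) hline
  have lineIntegral_eq (k : ℝ → ℝ → ℝ) (t : ℝ) :
      lineIntegral σ k t x = ∫ s in (0 : ℝ)..t, k s (x + σ * t - σ * s) := by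
    simp only [lineIntegral, mul_sub, add_sub_assoc]
  simp only [lineIntegral_eq]
  refine this.congr_deriv ?_
  simp only [G', id, smul_eq_mul, one_mul, add_sub_cancel_right]
  ring

theorem lineIntegral_add {h : ℝ → ℝ → ℝ} (σ t x : ℝ) (cg : Continuous fun p : ℝ × ℝ => g p.1 p.2)
    (ch : Continuous fun p : ℝ × ℝ => h p.1 p.2) :
    lineIntegral σ (fun s y => g s y + h s y) t x =
      lineIntegral σ g t x + lineIntegral σ h t x := by
  have line : Continuous fun s : ℝ => (s, x + σ * (t - s)) := by fun_prop
  exact intervalIntegral.integral_add ((cg.comp line).intervalIntegrable _ _)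
    ((ch.comp line).intervalIntegrable _ _)

theorem lineIntegral_neg (g : ℝ → ℝ → ℝ) (σ t x : ℝ) :
    lineIntegral σ (fun s y => -g s y) t x = -lineIntegral σ g t x :=
  intervalIntegral.integral_neg

theorem lineIntegral_sub {h : ℝ → ℝ → ℝ} (σ t x : ℝ) (cg : Continuous fun p : ℝ × ℝ => g p.1 p.2)
    (ch : Continuous fun p : ℝ × ℝ => h p.1 p.2) :
    lineIntegral σ (fun s y => g s y - h s y) t x =
      lineIntegral σ g t x - lineIntegral σ h t x := by
  simpa only [sub_eq_add_neg, lineIntegral_neg] using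
    lineIntegral_add (h := fun s y => -h s y) σ t x cg ch.neg

theorem abs_lineIntegral_le {B : ℝ → ℝ} {t x : ℝ} (ht : 0 ≤ t) (cB : Continuous B)
    (h : ∀ s ∈ Icc 0 t, |g s (x + σ * (t - s))| ≤ B s) :
    |lineIntegral σ g t x| ≤ ∫ s in (0 : ℝ)..t, B s :=
  abs_intervalIntegral_le ht cB h

theorem abs_lineIntegral_le_mul {B t x T : ℝ} (ht : t ∈ Icc 0 T) (hB : 0 ≤ B)
    (h : ∀ s ∈ Icc 0 t, |g s (x + σ * (t - s))| ≤ B) : |lineIntegral σ g t x| ≤ T * B := by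
  refine (abs_lineIntegral_le ht.1 continuous_const h).trans ?_
  rw [intervalIntegral.integral_const, sub_zero]
  exact mul_le_mul_of_nonneg_right ht.2 hB

end LineIntegral

/-! ### The relativistic velocity -/

section RelVelocity

theorem sqrt_one_add_sq_pos (v : ℝ) : 0 < Real.sqrt (1 + v ^ 2) := Real.sqrt_pos.2 (by positivity)

theorem abs_lt_sqrt_one_add_sq (v : ℝ) : |v| < Real.sqrt (1 + v ^ 2) := by
  rw [← Real.sqrt_sq_eq_abs]
  exact Real.sqrt_lt_sqrt (sq_nonneg v) (by linarith)

theorem abs_relVelocity_lt_one (v : ℝ) : |relVelocity v| < 1 := by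
  rw [relVelocity, abs_div, abs_of_pos (sqrt_one_add_sq_pos v), div_lt_one (sqrt_one_add_sq_pos v)]
  exact abs_lt_sqrt_one_add_sq v

/-- The derivative `(1 + v²)^(-3/2)` of the relativistic velocity. -/
noncomputable def relVelocityDeriv (v : ℝ) : ℝ := 1 / (Real.sqrt (1 + v ^ 2)) ^ 3

theorem hasDerivAt_relVelocity (v : ℝ) : HasDerivAt relVelocity (relVelocityDeriv v) v := by
  have hsq : Real.sqrt (1 + v ^ 2) ^ 2 = 1 + v ^ 2 := Real.sq_sqrt (by positivity)
  have hsqrt := ((hasDerivAt_pow 2 v).const_add 1).sqrt (by positivity)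
  refine ((hasDerivAt_id v).div hsqrt (sqrt_one_add_sq_pos v).ne').congr_deriv ?_
  simp only [relVelocityDeriv, id]
  field_simp
  rw [hsq]
  ring

theorem continuous_relVelocityDeriv : Continuous relVelocityDeriv := by
  unfold relVelocityDeriv
  refine continuous_const.div (by fun_prop) fun v => ?_
  exact pow_ne_zero _ (sqrt_one_add_sq_pos v).ne'

theorem continuous_relVelocity : Continuous relVelocity :=
  continuous_iff_continuousAt.2 fun v => (hasDerivAt_relVelocity v).continuousAt

theorem abs_relVelocityDeriv_le_one (v : ℝ) : |relVelocityDeriv v| ≤ 1 := by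
  have one_le_sqrt : 1 ≤ Real.sqrt (1 + v ^ 2) := Real.one_le_sqrt.2 (by nlinarith [sq_nonneg v])
  rw [relVelocityDeriv, abs_of_nonneg (by positivity)]
  exact (div_le_one (by positivity)).2 (one_le_pow₀ one_le_sqrt)

theorem lipschitzWith_relVelocity : LipschitzWith 1 relVelocity :=
  lipschitzWith_of_nnnorm_deriv_le (fun v => (hasDerivAt_relVelocity v).differentiableAt)
    fun v => (hasDerivAt_relVelocity v).deriv ▸ abs_relVelocityDeriv_le_one v

theorem add_relVelocity_ne_zero {σ : ℝ} (hσ : |σ| = 1) (v : ℝ) : σ + relVelocity v ≠ 0 := by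
  intro h
  have := abs_relVelocity_lt_one v
  rw [show relVelocity v = -σ by linarith, abs_neg, hσ] at this
  exact lt_irrefl _ this

end RelVelocity

/-! ### Flows of Lipschitz fields and the transport equation -/

section Flow

open Filter
open scoped NNReal

variable {E G : Type*} [NormedAddCommGroup E] [NormedAddCommGroup G]

/-- A time-dependent field that is jointly continuous, and Lipschitz in space locally uniformly in
time. It may be a vector field or a force field. -/
structure IsLipField (F : ℝ → E → G) : Prop where
  continuous : Continuous fun p : ℝ × E => F p.1 p.2
  lipschitzWith : ∀ T, ∃ K : ℝ≥0, ∀ t ∈ Icc (-T) T, LipschitzWith K (F t)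

variable [NormedSpace ℝ E] {F : ℝ → E → E}

open Classical in
/-- The integral curve of the vector field `F` that passes through `z` at time `t`, with the
constant curve as junk value if there is none. -/
noncomputable def fieldFlow (F : ℝ → E → E) (t : ℝ) (z : E) : ℝ → E :=
  if h : ∃ γ : ℝ → E, γ t = z ∧ IsIntegralCurve γ F then h.choose else fun _ => z

/-- The initial density `f₀` carried along by the flow of `F`. -/
noncomputable def transportAlong (f₀ : E → G) (F : ℝ → E → E) (t : ℝ) (z : E) : G :=
  f₀ (fieldFlow F t z 0)

theorem IsLipField.fieldFlow_spec [CompleteSpace E] (hF : IsLipField F) (t : ℝ) (z : E) :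
    fieldFlow F t z t = z ∧ IsIntegralCurve (fieldFlow F t z) F := by
  have h : ∃ γ : ℝ → E, γ t = z ∧ IsIntegralCurve γ F := exists_isIntegralCurve_of_lipschitzWith
    (fun _ => hF.continuous.comp (continuous_id.prodMk continuous_const)) hF.lipschitzWith t z
  rw [fieldFlow, dif_pos h]
  exact h.choose_spec

namespace IsLipField

variable [CompleteSpace E]

theorem fieldFlow_self (hF : IsLipField F) (t : ℝ) (z : E) : fieldFlow F t z t = z :=
  (hF.fieldFlow_spec t z).1

theorem isIntegralCurve_fieldFlow (hF : IsLipField F) (t : ℝ) (z : E) :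
    IsIntegralCurve (fieldFlow F t z) F :=
  (hF.fieldFlow_spec t z).2

theorem fieldFlow_fieldFlow (hF : IsLipField F) (t s : ℝ) (z : E) :
    fieldFlow F s (fieldFlow F t z s) = fieldFlow F t z :=
  integralCurve_eq_of_lipschitzWith hF.lipschitzWith (hF.isIntegralCurve_fieldFlow _ _)
    (hF.isIntegralCurve_fieldFlow _ _) (hF.fieldFlow_self _ _)

theorem continuous_fieldFlow (hF : IsLipField F) :
    Continuous fun p : (ℝ × E) × ℝ => fieldFlow F p.1.1 p.1.2 p.2 := by
  refine continuous_integralCurve (F := fun _ => F) (τ := Prod.fst)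
    (hF.continuous.comp continuous_snd) (fun _ T => ?_)
    (fun l => hF.isIntegralCurve_fieldFlow l.1 l.2) continuous_fst ?_
  · obtain ⟨K, hK⟩ := hF.lipschitzWith T
    exact ⟨K, Eventually.of_forall fun _ => hK⟩
  · simp only [hF.fieldFlow_self]
    exact continuous_snd

end IsLipField

/-- The linear operator that governs the difference of the trajectories of `F` which pass at time
`l.1` through `l.2.1` and `l.2.2`. -/
noncomputable def differenceGenerator (F : ℝ → E → E) (F' : ℝ → E → E →L[ℝ] E) (l : ℝ × E × E)
    (s : ℝ) : E →L[ℝ] E :=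
  meanFDeriv (F' s) (fieldFlow F l.1 l.2.1 s) (fieldFlow F l.1 l.2.2 s)

namespace IsLipField

variable {F' : ℝ → E → E →L[ℝ] E}

theorem exists_norm_differenceGenerator_le (hF : IsLipField F)
    (hF' : ∀ t z, HasFDerivAt (F t) (F' t z) z) (T : ℝ) :
    ∃ K : ℝ≥0, ∀ l, ∀ s ∈ Icc (-T) T, ‖differenceGenerator F F' l s‖ ≤ K := by
  obtain ⟨K, hK⟩ := hF.lipschitzWith T
  exact ⟨K, fun l s hs => norm_meanFDeriv_le (fun z => (hF' s z).le_of_lipschitz (hK s hs)) _ _⟩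

variable [CompleteSpace E]

theorem continuous_differenceGenerator (hF : IsLipField F)
    (cF' : Continuous fun p : ℝ × E => F' p.1 p.2) :
    Continuous fun p : (ℝ × E × E) × ℝ => differenceGenerator F F' p.1 p.2 :=
  (continuous_meanFDeriv cF').comp (continuous_snd.prodMk
    ((hF.continuous_fieldFlow.comp (show Continuous fun p : (ℝ × E × E) × ℝ =>
      ((p.1.1, p.1.2.1), p.2) by fun_prop)).prodMk
    (hF.continuous_fieldFlow.comp (show Continuous fun p : (ℝ × E × E) × ℝ =>
      ((p.1.1, p.1.2.2), p.2) by fun_prop))))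

theorem exists_fieldFlow_sub_eq (hF : IsLipField F) (hF' : ∀ t z, HasFDerivAt (F t) (F' t z) z)
    (cF' : Continuous fun p : ℝ × E => F' p.1 p.2) :
    ∃ A : ℝ × E × E → E →L[ℝ] E, Continuous A ∧
      ∀ t z w, fieldFlow F t w 0 - fieldFlow F t z 0 = A (t, z, w) (w - z) := by
  have cM := hF.continuous_differenceGenerator cF'
  have hM := hF.exists_norm_differenceGenerator_le hF'
  have cG : Continuous fun p : (ℝ × E × E) × ℝ × (E →L[ℝ] E) =>
      (differenceGenerator F F' p.1 p.2.1).comp p.2.2 :=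
    (cM.comp (show Continuous fun p : (ℝ × E × E) × ℝ × (E →L[ℝ] E) => (p.1, p.2.1) by
      fun_prop)).clm_comp continuous_snd.snd
  have lipG (T : ℝ) : ∃ K : ℝ≥0, ∀ l, ∀ s ∈ Icc (-T) T,
      LipschitzWith K fun Y : E →L[ℝ] E => (differenceGenerator F F' l s).comp Y := by
    obtain ⟨K, hK⟩ := hM T
    refine ⟨K, fun l s hs => LipschitzWith.of_dist_le_mul fun Y Z => ?_⟩
    rw [dist_eq_norm, dist_eq_norm, ← ContinuousLinearMap.comp_sub]
    exact (ContinuousLinearMap.opNorm_comp_le _ _).trans (by gcongr; exact hK l s hs)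
  have exists_resolvent (l : ℝ × E × E) : ∃ Y : ℝ → E →L[ℝ] E,
      Y l.1 = ContinuousLinearMap.id ℝ E ∧
        IsIntegralCurve Y fun s Z => (differenceGenerator F F' l s).comp Z :=
    exists_isIntegralCurve_of_lipschitzWith
      (fun Z => cG.comp (show Continuous fun s : ℝ => (l, s, Z) by fun_prop))
      (fun T => (lipG T).imp fun _ h => h l) _ _
  choose Y Y_self hY using exists_resolvent
  have cY : Continuous fun p : (ℝ × E × E) × ℝ => Y p.1 p.2 :=
    continuous_integralCurve cG
      (fun _ T => (lipG T).imp fun _ h => Eventually.of_forall h) hY continuous_fst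
      (by simpa only [Y_self] using continuous_const)
  refine ⟨fun l => Y l 0, cY.comp (continuous_id.prodMk continuous_const), fun t z w => ?_⟩
  have difference : IsIntegralCurve (fun s => fieldFlow F t w s - fieldFlow F t z s)
      fun s y => differenceGenerator F F' (t, z, w) s y := fun s => by
    have h := (hF.isIntegralCurve_fieldFlow t w s).sub (hF.isIntegralCurve_fieldFlow t z s)
    rwa [sub_eq_meanFDeriv_apply (hF' s) (cF'.comp (continuous_const.prodMk continuous_id))] at h
  have resolvent : IsIntegralCurve (fun s => Y (t, z, w) s (w - z))
      fun s y => differenceGenerator F F' (t, z, w) s y := fun s =>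
    by simpa using (hY (t, z, w) s).clm_apply (hasDerivAt_const s (w - z))
  have lip (T : ℝ) : ∃ K : ℝ≥0, ∀ s ∈ Icc (-T) T,
      LipschitzWith K (differenceGenerator F F' (t, z, w) s) :=
    (hM T).imp fun _ h s hs => (ContinuousLinearMap.lipschitz _).weaken (h _ s hs)
  exact congrFun (integralCurve_eq_of_lipschitzWith lip difference resolvent (t₀ := t)
    (by simp [hF.fieldFlow_self, Y_self (t, z, w)])) 0

variable [NormedSpace ℝ G] [CompleteSpace G] {f₀ : E → G}

theorem exists_transportAlong_sub_eq (hF : IsLipField F)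
    (hF' : ∀ t z, HasFDerivAt (F t) (F' t z) z) (cF' : Continuous fun p : ℝ × E => F' p.1 p.2)
    (hf : ContDiff ℝ 1 f₀) :
    ∃ A : ℝ × E × E → E →L[ℝ] G, Continuous A ∧
      ∀ t z w, transportAlong f₀ F t w - transportAlong f₀ F t z = A (t, z, w) (w - z) := by
  obtain ⟨A, cA, hA⟩ := hF.exists_fieldFlow_sub_eq hF' cF'
  have cf' : Continuous (fderiv ℝ f₀) := hf.continuous_fderiv one_ne_zero
  have cflow {e : ℝ × E × E → E} (he : Continuous e) :
      Continuous fun l : ℝ × E × E => fieldFlow F l.1 (e l) 0 :=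
    hF.continuous_fieldFlow.comp ((continuous_fst.prodMk he).prodMk continuous_const)
  refine ⟨fun l => (meanFDeriv (fderiv ℝ f₀) (fieldFlow F l.1 l.2.1 0)
    (fieldFlow F l.1 l.2.2 0)).comp (A l), ?_, fun t z w => ?_⟩
  · exact ((continuous_meanFDeriv (Λ := ℝ × E × E) (f' := fun _ => fderiv ℝ f₀)
      (cf'.comp continuous_snd)).comp (continuous_id.prodMk
        ((cflow continuous_snd.fst).prodMk (cflow continuous_snd.snd)))).clm_comp cA
  · rw [transportAlong, transportAlong, sub_eq_meanFDeriv_apply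
      (fun z => (hf.differentiable one_ne_zero z).hasFDerivAt) cf', hA]
    rfl

theorem exists_fderiv_transportAlong (hF : IsLipField F)
    (hF' : ∀ t z, HasFDerivAt (F t) (F' t z) z) (cF' : Continuous fun p : ℝ × E => F' p.1 p.2)
    (hf : ContDiff ℝ 1 f₀) :
    ∃ D : ℝ → E → E →L[ℝ] G, (Continuous fun p : ℝ × E => D p.1 p.2) ∧
      (∀ t z, HasFDerivAt (transportAlong f₀ F t) (D t z) z) ∧
      ∀ t z, HasDerivAt (fun s => transportAlong f₀ F s z) (-D t z (F t z)) t := by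
  obtain ⟨A, cA, hA⟩ := hF.exists_transportAlong_sub_eq hF' cF' hf
  refine ⟨fun t z => A (t, z, z), cA.comp (by fun_prop), fun t z => ?_, fun t z => ?_⟩
  · exact hasFDerivAt_of_sub_eq (A := fun w => A (t, z, w)) (cA.comp (by fun_prop)).continuousAt
      (hA t z)
  · have hγ := hF.isIntegralCurve_fieldFlow t z
    have eq_along_flow (s : ℝ) : transportAlong f₀ F s z =
        transportAlong f₀ F t z + A (s, fieldFlow F t z s, z) (z - fieldFlow F t z s) := by
      rw [← hA, transportAlong, transportAlong, transportAlong, hF.fieldFlow_fieldFlow]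
      abel
    have h := (hasDerivAt_clm_apply_of_eq_zero (A := fun s => A (s, fieldFlow F t z s, z))
      (cA.comp (continuous_id.prodMk (hγ.continuous.prodMk continuous_const))).continuousAt
      ((hγ t).const_sub z) (by rw [hF.fieldFlow_self, sub_self])).const_add
        (transportAlong f₀ F t z)
    simpa only [← eq_along_flow, hF.fieldFlow_self, map_neg] using h

end IsLipField

end Flow

/-! ### Characteristics of the Vlasov equation -/

section Characteristics

/-- The vector field in phase space whose integral curves are the characteristics. -/
noncomputable def charField (E : ℝ → ℝ → ℝ) (t : ℝ) (z : ℝ × ℝ) : ℝ × ℝ :=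
  (relVelocity z.2, -E t z.1)

/-- The density obtained from `f₀` by transport along the characteristics of the field `E`. -/
noncomputable def transport (f₀ : ℝ × ℝ → ℝ) (E : ℝ → ℝ → ℝ) (t x v : ℝ) : ℝ :=
  transportAlong f₀ (charField E) t (x, v)

theorem norm_charField_sub_le {E : ℝ → ℝ → ℝ} {L : ℝ} (hL : 0 ≤ L) {t : ℝ}
    {y z : ℝ × ℝ} (h : |E t y.1 - E t z.1| ≤ L * |y.1 - z.1|) :
    ‖charField E t y - charField E t z‖ ≤ (1 + L) * ‖y - z‖ := by
  have hfst : |y.1 - z.1| ≤ ‖y - z‖ := norm_fst_le (y - z)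
  have hsnd : |y.2 - z.2| ≤ ‖y - z‖ := norm_snd_le (y - z)
  have hvel : |relVelocity y.2 - relVelocity z.2| ≤ |y.2 - z.2| := by
    simpa using lipschitzWith_relVelocity.norm_sub_le y.2 z.2
  simp only [charField, Prod.mk_sub_mk, neg_sub_neg, norm_prod_le_iff, Real.norm_eq_abs]
  rw [abs_sub_comm (E t z.1)]
  constructor <;> nlinarith [norm_nonneg (y - z)]

/-- The derivative of `charField E t` in phase space, where `E'` is the space derivative of `E`. -/
noncomputable def charFieldFDeriv (E' : ℝ → ℝ → ℝ) (t : ℝ) (z : ℝ × ℝ) : ℝ × ℝ →L[ℝ] ℝ × ℝ :=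
  (relVelocityDeriv z.2 • ContinuousLinearMap.snd ℝ ℝ ℝ).prod
    (-(E' t z.1 • ContinuousLinearMap.fst ℝ ℝ ℝ))

section

variable {E E' : ℝ → ℝ → ℝ}

theorem hasFDerivAt_charField (hE' : ∀ t x, HasDerivAt (E t) (E' t x) x) (t : ℝ) (z : ℝ × ℝ) :
    HasFDerivAt (charField E t) (charFieldFDeriv E' t z) z :=
  ((hasDerivAt_relVelocity z.2).comp_hasFDerivAt z hasFDerivAt_snd).prodMk
    ((hE' t z.1).comp_hasFDerivAt z hasFDerivAt_fst).neg

theorem continuous_charFieldFDeriv (cE' : Continuous fun p : ℝ × ℝ => E' p.1 p.2) :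
    Continuous fun p : ℝ × ℝ × ℝ => charFieldFDeriv E' p.1 p.2 :=
  (ContinuousLinearMap.prodₗᵢ ℝ : ((ℝ × ℝ →L[ℝ] ℝ) × (ℝ × ℝ →L[ℝ] ℝ)) ≃ₗᵢ[ℝ]
    (ℝ × ℝ →L[ℝ] ℝ × ℝ)).continuous.comp
    (((continuous_relVelocityDeriv.comp continuous_snd.snd).smul continuous_const).prodMk
      ((cE'.comp (continuous_fst.prodMk continuous_snd.fst)).smul continuous_const).neg)

end

namespace IsLipField

variable {E E' : ℝ → ℝ → ℝ}

theorem charField (hE : IsLipField E) : IsLipField (charField E) where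
  continuous := (continuous_relVelocity.comp continuous_snd.snd).prodMk
    (hE.continuous.comp (continuous_fst.prodMk continuous_snd.fst)).neg
  lipschitzWith T := by
    obtain ⟨L, hL⟩ := hE.lipschitzWith T
    exact ⟨1 + L, fun t ht => LipschitzWith.of_dist_le_mul fun y z =>
      norm_charField_sub_le L.2 ((hL t ht).norm_sub_le y.1 z.1)⟩

theorem continuous_transport (hE : IsLipField E) {f₀ : ℝ × ℝ → ℝ} (hf : Continuous f₀) :
    Continuous fun p : ℝ × ℝ × ℝ => transport f₀ E p.1 p.2.1 p.2.2 :=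
  hf.comp (hE.charField.continuous_fieldFlow.comp (continuous_id.prodMk continuous_const))

theorem transport_zero (hE : IsLipField E) (f₀ : ℝ × ℝ → ℝ) (x v : ℝ) :
    transport f₀ E 0 x v = f₀ (x, v) :=
  congrArg f₀ (hE.charField.fieldFlow_self 0 (x, v))

theorem exists_transport_deriv (hE : IsLipField E)
    (hE' : ∀ t x, HasDerivAt (E t) (E' t x) x) (cE' : Continuous fun p : ℝ × ℝ => E' p.1 p.2)
    {f₀ : ℝ × ℝ → ℝ} (hf : ContDiff ℝ 1 f₀) :
    ∃ fx fv : ℝ → ℝ → ℝ → ℝ, (Continuous fun p : ℝ × ℝ × ℝ => fx p.1 p.2.1 p.2.2) ∧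
      (Continuous fun p : ℝ × ℝ × ℝ => fv p.1 p.2.1 p.2.2) ∧
      (∀ t x v, HasDerivAt (fun y => transport f₀ E t y v) (fx t x v) x) ∧
      (∀ t x v, HasDerivAt (transport f₀ E t x) (fv t x v) v) ∧
      (∀ t x v, HasDerivAt (fun s => transport f₀ E s x v)
        (-relVelocity v * fx t x v + E t x * fv t x v) t) ∧
      ContDiff ℝ 1 fun p : ℝ × ℝ × ℝ => transport f₀ E p.1 p.2.1 p.2.2 := by
  obtain ⟨D, cD, hD, hDt⟩ := hE.charField.exists_fderiv_transportAlong (hasFDerivAt_charField hE')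
    (continuous_charFieldFDeriv cE') hf
  have cDe (e : ℝ × ℝ) : Continuous fun p : ℝ × ℝ × ℝ => D p.1 (p.2.1, p.2.2) e :=
    cD.clm_apply continuous_const
  have charField_eq (t x v : ℝ) : _root_.charField E t (x, v) =
      relVelocity v • (1, 0) + (-E t x) • (0, 1) := by simp [_root_.charField]
  have ht (t x v : ℝ) : HasDerivAt (fun s => transport f₀ E s x v)
      (-relVelocity v * D t (x, v) (1, 0) + E t x * D t (x, v) (0, 1)) t := by
    refine (hDt t (x, v)).congr_deriv ?_
    rw [charField_eq, map_add, map_smul, map_smul, smul_eq_mul, smul_eq_mul]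
    ring
  refine ⟨fun t x v => D t (x, v) (1, 0), fun t x v => D t (x, v) (0, 1), cDe _, cDe _,
    fun t x v => ?_, fun t x v => ?_, ht, contDiff_one_of_partial (fun t z => hDt t z) hD ?_ cD⟩
  · exact (hD t (x, v)).comp_hasDerivAt x ((hasDerivAt_id x).prodMk (hasDerivAt_const x v))
  · exact (hD t (x, v)).comp_hasDerivAt v ((hasDerivAt_const v x).prodMk (hasDerivAt_id v))
  · exact (cD.clm_apply hE.charField.continuous).neg

end IsLipField

end Characteristics

/-! ### Velocity moments -/

section Moments

open Filter Topology

/-- The velocity support of `f` is bounded, locally uniformly in time. -/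
def HasBddVelocitySupport (f : ℝ → ℝ → ℝ → ℝ) : Prop :=
  ∀ T, ∃ Q, 0 ≤ Q ∧ ∀ t ∈ Icc (-T) T, ∀ x v, Q ≤ |v| → f t x v = 0

/-- The velocity moment of `f` with weight `a`. -/
noncomputable def moment (a : ℝ → ℝ) (f : ℝ → ℝ → ℝ → ℝ) (t x : ℝ) : ℝ := ∫ v, a v * f t x v

variable {f fx fv ft : ℝ → ℝ → ℝ → ℝ} {a a' : ℝ → ℝ}

theorem moment_eq_intervalIntegral {t x Q : ℝ} (hQ : ∀ v, Q ≤ |v| → f t x v = 0) :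
    moment a f t x = ∫ v in (-Q)..Q, a v * f t x v := by
  refine (intervalIntegral.integral_eq_integral_of_support_subset fun v hv => ?_).symm
  have : |v| < Q := not_le.1 fun h => hv (mul_eq_zero_of_right _ (hQ v h))
  exact Ioo_subset_Ioc_self (abs_lt.1 this)

theorem abs_moment_sub_le {g : ℝ → ℝ → ℝ → ℝ} {t x s y Q c ε : ℝ} (hQ0 : 0 ≤ Q)
    (hf : ∀ v, Q ≤ |v| → f t x v = 0) (hg : ∀ v, Q ≤ |v| → g s y v = 0)
    (cf : Continuous (f t x)) (cg : Continuous (g s y)) (ca : Continuous a)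
    (ha : ∀ v, |v| ≤ Q → |a v| ≤ c) (hε : ∀ v, |f t x v - g s y v| ≤ ε) :
    |moment a f t x - moment a g s y| ≤ 2 * Q * c * ε := by
  have bound (v : ℝ) (hv : v ∈ uIoc (-Q) Q) : ‖a v * f t x v - a v * g s y v‖ ≤ c * ε := by
    rw [uIoc_of_le (by linarith)] at hv
    have hv' : |v| ≤ Q := abs_le.2 ⟨hv.1.le, hv.2⟩
    rw [← mul_sub, norm_mul]
    exact mul_le_mul (ha v hv') (hε v) (norm_nonneg _) ((abs_nonneg _).trans (ha v hv'))
  have int {h : ℝ → ℝ} (ch : Continuous h) :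
      IntervalIntegrable (fun v => a v * h v) volume (-Q) Q := (ca.mul ch).intervalIntegrable _ _
  rw [moment_eq_intervalIntegral hf, moment_eq_intervalIntegral hg,
    ← intervalIntegral.integral_sub (int cf) (int cg)]
  refine (intervalIntegral.norm_integral_le_of_norm_le_const bound).trans_eq ?_
  rw [sub_neg_eq_add, abs_of_nonneg (by linarith)]
  ring

theorem abs_moment_le {t x Q c M : ℝ} (hQ0 : 0 ≤ Q) (hf : ∀ v, Q ≤ |v| → f t x v = 0)
    (cf : Continuous (f t x)) (ca : Continuous a)
    (ha : ∀ v, |v| ≤ Q → |a v| ≤ c) (hM : ∀ v, |f t x v| ≤ M) :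
    |moment a f t x| ≤ 2 * Q * c * M := by
  simpa [moment] using abs_moment_sub_le (g := fun _ _ _ => 0) (s := 0) (y := 0) hQ0 hf
    (fun _ _ => rfl) cf continuous_const ca ha (by simpa using hM)

namespace HasBddVelocitySupport

theorem eventually_eq_zero (hs : HasBddVelocitySupport f) (t : ℝ) :
    ∀ᶠ Q in atTop, ∀ᶠ s in 𝓝 t, ∀ x v, Q ≤ |v| → f s x v = 0 := by
  obtain ⟨Q₀, -, hQ₀⟩ := hs (|t| + 1)
  have near : ∀ᶠ s in 𝓝 t, |s| < |t| + 1 :=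
    continuous_abs.continuousAt.eventually_lt continuousAt_const (lt_add_one |t|)
  filter_upwards [eventually_ge_atTop Q₀] with Q hQ
  filter_upwards [near] with s hs x v hv
  exact hQ₀ s (abs_le.1 hs.le) x v (hQ.trans hv)

theorem hasCompactSupport (hs : HasBddVelocitySupport f) (t x : ℝ) :
    HasCompactSupport (f t x) := by
  obtain ⟨Q, -, hQ⟩ := hs |t|
  refine HasCompactSupport.intro (isCompact_Icc (a := -Q) (b := Q)) fun v hv => ?_
  exact hQ t (abs_le.1 le_rfl) x v (not_le.1 fun h => hv (abs_le.1 h)).le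

theorem integrable_mul (hs : HasBddVelocitySupport f)
    (cf : Continuous fun p : ℝ × ℝ × ℝ => f p.1 p.2.1 p.2.2) (ca : Continuous a) (t x : ℝ) :
    Integrable fun v => a v * f t x v :=
  have cline : Continuous fun v : ℝ => (t, x, v) := by fun_prop
  (ca.mul (cf.comp cline)).integrable_of_hasCompactSupport (hs.hasCompactSupport t x).mul_left

theorem continuous_moment (hs : HasBddVelocitySupport f)
    (cf : Continuous fun p : ℝ × ℝ × ℝ => f p.1 p.2.1 p.2.2) (ca : Continuous a) :
    Continuous fun p : ℝ × ℝ => moment a f p.1 p.2 := by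
  rw [continuous_iff_continuousAt]
  intro p
  obtain ⟨Q, hQ⟩ := (hs.eventually_eq_zero p.1).exists
  have hc : Continuous fun q : ℝ × ℝ => ∫ v in (-Q)..Q, a v * f q.1 q.2 v :=
    intervalIntegral.continuous_parametric_intervalIntegral_of_continuous'
      (f := fun (q : ℝ × ℝ) v => a v * f q.1 q.2 v)
      ((ca.comp continuous_snd).mul (cf.comp (show Continuous fun q : (ℝ × ℝ) × ℝ =>
        (q.1.1, q.1.2, q.2) by fun_prop))) _ _
  refine hc.continuousAt.congr ?_
  filter_upwards [continuous_fst.continuousAt.eventually hQ] with q hq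
  exact (moment_eq_intervalIntegral (hq q.2)).symm

theorem deriv_right (hs : HasBddVelocitySupport f)
    (hx : ∀ t x v, HasDerivAt (fun y => f t y v) (fx t x v) x) : HasBddVelocitySupport fx := by
  intro T
  obtain ⟨Q, hQ, h⟩ := hs T
  refine ⟨Q, hQ, fun t ht x v hv => (hx t x v).unique ?_⟩
  simp only [h t ht _ v hv]
  exact hasDerivAt_const _ _

theorem deriv_velocity (hs : HasBddVelocitySupport f)
    (hv : ∀ t x v, HasDerivAt (f t x) (fv t x v) v) : HasBddVelocitySupport fv := by
  intro T
  obtain ⟨Q, hQ, h⟩ := hs T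
  refine ⟨Q + 1, by positivity, fun t ht x v hv' => (hv t x v).unique ?_⟩
  have outside : ∀ᶠ w in 𝓝 v, Q < |w| :=
    continuousAt_const.eventually_lt continuous_abs.continuousAt (by linarith)
  exact (hasDerivAt_const v (0 : ℝ)).congr_of_eventuallyEq
    (outside.mono fun w hw => h t ht x w hw.le)

theorem hasDerivAt_moment_right (hs : HasBddVelocitySupport f)
    (cf : Continuous fun p : ℝ × ℝ × ℝ => f p.1 p.2.1 p.2.2)
    (cfx : Continuous fun p : ℝ × ℝ × ℝ => fx p.1 p.2.1 p.2.2) (ca : Continuous a)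
    (hx : ∀ t x v, HasDerivAt (fun y => f t y v) (fx t x v) x) (t x : ℝ) :
    HasDerivAt (moment a f t) (moment a fx t x) x := by
  obtain ⟨Q, hf, hfx⟩ :=
    ((hs.eventually_eq_zero t).and ((hs.deriv_right hx).eventually_eq_zero t)).exists
  have moment_eq : moment a f t = fun x => ∫ v in (-Q)..Q, a v * f t x v :=
    funext fun x => moment_eq_intervalIntegral (hf.self_of_nhds x)
  rw [moment_eq, moment_eq_intervalIntegral (hfx.self_of_nhds x)]
  refine hasDerivAt_intervalIntegral (F := fun x v => a v * f t x v)
    (F' := fun x v => a v * fx t x v) _ _ (fun x v => (hx t x v).const_mul _) (fun x => ?_) ?_ x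
  · exact ca.mul (cf.comp (show Continuous fun v : ℝ => (t, x, v) by fun_prop))
  · exact (ca.comp continuous_snd).mul
      (cfx.comp (show Continuous fun q : ℝ × ℝ => (t, q.1, q.2) by fun_prop))

theorem hasDerivAt_moment_left (hs : HasBddVelocitySupport f) (hs' : HasBddVelocitySupport ft)
    (cf : Continuous fun p : ℝ × ℝ × ℝ => f p.1 p.2.1 p.2.2)
    (cft : Continuous fun p : ℝ × ℝ × ℝ => ft p.1 p.2.1 p.2.2) (ca : Continuous a)
    (ht : ∀ t x v, HasDerivAt (fun s => f s x v) (ft t x v) t) (t x : ℝ) :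
    HasDerivAt (fun s => moment a f s x) (moment a ft t x) t := by
  obtain ⟨Q, hf, hft⟩ := ((hs.eventually_eq_zero t).and (hs'.eventually_eq_zero t)).exists
  rw [moment_eq_intervalIntegral (hft.self_of_nhds x)]
  refine HasDerivAt.congr_of_eventuallyEq ?_
    (hf.mono fun s hs => moment_eq_intervalIntegral (hs x))
  refine hasDerivAt_intervalIntegral (F := fun s v => a v * f s x v)
    (F' := fun s v => a v * ft s x v) _ _ (fun s v => (ht s x v).const_mul _) (fun s => ?_) ?_ t
  · exact ca.mul (cf.comp (show Continuous fun v : ℝ => (s, x, v) by fun_prop))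
  · exact (ca.comp continuous_snd).mul
      (cft.comp (show Continuous fun q : ℝ × ℝ => (q.1, x, q.2) by fun_prop))

theorem moment_deriv_velocity (hs : HasBddVelocitySupport f)
    (cf : Continuous fun p : ℝ × ℝ × ℝ => f p.1 p.2.1 p.2.2)
    (cfv : Continuous fun p : ℝ × ℝ × ℝ => fv p.1 p.2.1 p.2.2)
    (hv : ∀ t x v, HasDerivAt (f t x) (fv t x v) v)
    (ha : ∀ v, HasDerivAt a (a' v) v) (ca' : Continuous a') (t x : ℝ) :
    moment a fv t x = -moment a' f t x := by
  have ca : Continuous a := continuous_iff_continuousAt.2 fun v => (ha v).continuousAt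
  exact integral_mul_deriv_eq_deriv_mul_of_integrable (fun v _ => ha v) (fun v _ => hv t x v)
    ((hs.deriv_velocity hv).integrable_mul cfv ca t x) (hs.integrable_mul cf ca' t x)
    (hs.integrable_mul cf ca t x)

end HasBddVelocitySupport

end Moments

/-! ### The decomposition of the derivatives of the density along light cones -/

section GlasseyStrauss

/-- The velocity weight in the moments to which integration along the cone `x + σ t = const`
reduces the derivatives of the density. -/
noncomputable def coneWeight (σ v : ℝ) : ℝ := 1 / (σ + relVelocity v)

/-- Minus the derivative of `coneWeight σ`. -/
noncomputable def coneWeightDeriv (σ v : ℝ) : ℝ := relVelocityDeriv v / (σ + relVelocity v) ^ 2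

variable {σ : ℝ}

theorem continuous_coneWeight (hσ : |σ| = 1) : Continuous (coneWeight σ) :=
  continuous_const.div (continuous_const.add continuous_relVelocity)
    (add_relVelocity_ne_zero hσ)

theorem continuous_coneWeightDeriv (hσ : |σ| = 1) : Continuous (coneWeightDeriv σ) :=
  continuous_relVelocityDeriv.div ((continuous_const.add continuous_relVelocity).pow 2)
    fun v => pow_ne_zero 2 (add_relVelocity_ne_zero hσ v)

theorem hasDerivAt_coneWeight (hσ : |σ| = 1) (v : ℝ) :
    HasDerivAt (coneWeight σ) (-coneWeightDeriv σ v) v := by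
  have h := (hasDerivAt_const v (1 : ℝ)).div ((hasDerivAt_relVelocity v).const_add σ)
    (add_relVelocity_ne_zero hσ v)
  refine h.congr_deriv ?_
  simp [coneWeightDeriv, neg_div]

variable {f fx fv : ℝ → ℝ → ℝ → ℝ} {E : ℝ → ℝ → ℝ}

namespace HasBddVelocitySupport

/-- The decomposition `∂ₓ = (∂ₜ + v̂ ∂ₓ - (∂ₜ - σ ∂ₓ)) / (σ + v̂)` of the space derivative into the
transport derivative, which the Vlasov equation eliminates, and the derivative along a cone. -/
theorem moment_vlasov (hs : HasBddVelocitySupport f)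
    (cf : Continuous fun p : ℝ × ℝ × ℝ => f p.1 p.2.1 p.2.2)
    (cfx : Continuous fun p : ℝ × ℝ × ℝ => fx p.1 p.2.1 p.2.2)
    (cfv : Continuous fun p : ℝ × ℝ × ℝ => fv p.1 p.2.1 p.2.2)
    (hx : ∀ t x v, HasDerivAt (fun y => f t y v) (fx t x v) x)
    (hv : ∀ t x v, HasDerivAt (f t x) (fv t x v) v) (hσ : |σ| = 1) (t x : ℝ) :
    moment (coneWeight σ) (fun t x v => -relVelocity v * fx t x v + E t x * fv t x v) t x
      - σ * moment (coneWeight σ) fx t x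
      = -moment (fun _ => 1) fx t x + E t x * moment (coneWeightDeriv σ) f t x := by
  have cw := continuous_coneWeight hσ
  have parts : moment (coneWeight σ) fv t x = moment (coneWeightDeriv σ) f t x := by
    rw [hs.moment_deriv_velocity cf cfv hv (hasDerivAt_coneWeight hσ)
      (continuous_coneWeightDeriv hσ).neg]
    simp only [moment, neg_mul, integral_neg, neg_neg]
  have integrand_eq (v : ℝ) : coneWeight σ v * (-relVelocity v * fx t x v + E t x * fv t x v) =
      σ * (coneWeight σ v * fx t x v) - 1 * fx t x v + E t x * (coneWeight σ v * fv t x v) := by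
    have := add_relVelocity_ne_zero hσ v
    rw [coneWeight]
    field_simp
    ring
  have int_x : Integrable fun v => σ * (coneWeight σ v * fx t x v) :=
    ((hs.deriv_right hx).integrable_mul cfx cw t x).const_mul σ
  have int_one : Integrable fun v => 1 * fx t x v :=
    (hs.deriv_right hx).integrable_mul cfx continuous_const t x
  have int_v : Integrable fun v => E t x * (coneWeight σ v * fv t x v) :=
    ((hs.deriv_velocity hv).integrable_mul cfv cw t x).const_mul (E t x)
  have int_sub : Integrable fun v => σ * (coneWeight σ v * fx t x v) - 1 * fx t x v :=
    int_x.sub int_one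
  rw [← parts]
  simp only [moment, integrand_eq]
  rw [integral_add int_sub int_v, integral_sub int_x int_one, integral_const_mul σ,
    integral_const_mul (E t x)]
  ring

theorem vlasov_deriv (hs : HasBddVelocitySupport f)
    (hx : ∀ t x v, HasDerivAt (fun y => f t y v) (fx t x v) x)
    (hv : ∀ t x v, HasDerivAt (f t x) (fv t x v) v) (E : ℝ → ℝ → ℝ) :
    HasBddVelocitySupport fun t x v => -relVelocity v * fx t x v + E t x * fv t x v := by
  intro T
  obtain ⟨Q₁, hQ₁, hfx⟩ := hs.deriv_right hx T
  obtain ⟨Q₂, -, hfv⟩ := hs.deriv_velocity hv T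
  refine ⟨max Q₁ Q₂, hQ₁.trans (le_max_left _ _), fun t ht x v hv => ?_⟩
  simp [hfx t ht x v ((le_max_left _ _).trans hv), hfv t ht x v ((le_max_right _ _).trans hv)]

theorem lineIntegral_moment_deriv (hs : HasBddVelocitySupport f)
    (cE : Continuous fun p : ℝ × ℝ => E p.1 p.2)
    (cf : Continuous fun p : ℝ × ℝ × ℝ => f p.1 p.2.1 p.2.2)
    (cfx : Continuous fun p : ℝ × ℝ × ℝ => fx p.1 p.2.1 p.2.2)
    (cfv : Continuous fun p : ℝ × ℝ × ℝ => fv p.1 p.2.1 p.2.2)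
    (hx : ∀ t x v, HasDerivAt (fun y => f t y v) (fx t x v) x)
    (hv : ∀ t x v, HasDerivAt (f t x) (fv t x v) v)
    (ht : ∀ t x v, HasDerivAt (fun s => f s x v) (-relVelocity v * fx t x v + E t x * fv t x v) t)
    (hσ : |σ| = 1) (t x : ℝ) :
    lineIntegral σ (moment (fun _ => 1) fx) t x =
      moment (coneWeight σ) f 0 (x + σ * t) - moment (coneWeight σ) f t x +
        lineIntegral σ (fun s y => E s y * moment (coneWeightDeriv σ) f s y) t x := by
  have hsx := hs.deriv_right hx
  have hst := hs.vlasov_deriv hx hv E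
  have cft : Continuous fun p : ℝ × ℝ × ℝ =>
      -relVelocity p.2.2 * fx p.1 p.2.1 p.2.2 + E p.1 p.2.1 * fv p.1 p.2.1 p.2.2 :=
    ((continuous_relVelocity.comp continuous_snd.snd).neg.mul cfx).add
      ((cE.comp (show Continuous fun p : ℝ × ℝ × ℝ => (p.1, p.2.1) by fun_prop)).mul cfv)
  have cw := continuous_coneWeight hσ
  have hasDerivAt_along (s : ℝ) :
      HasDerivAt (fun s => moment (coneWeight σ) f s (x + σ * (t - s)))
        (-moment (fun _ => 1) fx s (x + σ * (t - s)) +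
          E s (x + σ * (t - s)) * moment (coneWeightDeriv σ) f s (x + σ * (t - s))) s := by
    have line : HasDerivAt (fun s : ℝ => x + σ * (t - s)) (-σ) s := by
      simpa using (((hasDerivAt_id s).const_sub t).const_mul σ).const_add x
    refine (hasDerivAt_comp_of_partial (hs.hasDerivAt_moment_left hst cf cft cw ht)
      (hs.hasDerivAt_moment_right cf cfx cw hx) (hst.continuous_moment cft cw)
      (hsx.continuous_moment cfx cw) (hasDerivAt_id s) line).congr_deriv ?_
    rw [← hs.moment_vlasov cf cfx cfv hx hv hσ]
    simp only [id, smul_eq_mul]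
    ring
  have cline : Continuous fun s : ℝ => (s, x + σ * (t - s)) := by fun_prop
  have c_fx : Continuous fun s : ℝ => -moment (fun _ => 1) fx s (x + σ * (t - s)) :=
    ((hsx.continuous_moment cfx continuous_const).comp cline).neg
  have c_field : Continuous fun s : ℝ => E s (x + σ * (t - s)) *
      moment (coneWeightDeriv σ) f s (x + σ * (t - s)) :=
    (cE.comp cline).mul ((hs.continuous_moment cf (continuous_coneWeightDeriv hσ)).comp cline)
  have ftc := intervalIntegral.integral_eq_sub_of_hasDerivAt (a := 0) (b := t)
    (fun s _ => hasDerivAt_along s) ((c_fx.add c_field).intervalIntegrable _ _)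
  rw [intervalIntegral.integral_add (c_fx.intervalIntegrable _ _)
    (c_field.intervalIntegrable _ _), intervalIntegral.integral_neg] at ftc
  simp only [sub_self, mul_zero, add_zero, sub_zero] at ftc
  simp only [lineIntegral]
  linarith

end HasBddVelocitySupport

end GlasseyStrauss

/-! ### Estimates along characteristics -/

section CharEstimates

open scoped NNReal

/-- `γ` is a characteristic of the field `E` on `[0, t]`. -/
def IsCharOn (E : ℝ → ℝ → ℝ) (t : ℝ) (γ : ℝ → ℝ × ℝ) : Prop :=
  ∀ s ∈ Icc 0 t, HasDerivAt γ (charField E s (γ s)) s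

/-- The value `f t x v` is obtained by transporting `f₀` along a characteristic of `E`. -/
def IsTransported (f₀ : ℝ × ℝ → ℝ) (E : ℝ → ℝ → ℝ) (f : ℝ → ℝ → ℝ → ℝ) (t x v : ℝ) : Prop :=
  ∃ γ : ℝ → ℝ × ℝ, γ t = (x, v) ∧ IsCharOn E t γ ∧ f t x v = f₀ (γ 0)

variable {E E₂ : ℝ → ℝ → ℝ} {f₀ : ℝ × ℝ → ℝ} {f f₂ : ℝ → ℝ → ℝ → ℝ} {s t x v : ℝ}
  {γ η : ℝ → ℝ × ℝ}

theorem hasDerivAt_fst_of_charField (h : HasDerivAt γ (charField E s (γ s)) s) :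
    HasDerivAt (fun s => (γ s).1) (relVelocity (γ s).2) s :=
  (ContinuousLinearMap.fst ℝ ℝ ℝ).hasFDerivAt.comp_hasDerivAt s h

theorem hasDerivAt_snd_of_charField (h : HasDerivAt γ (charField E s (γ s)) s) :
    HasDerivAt (fun s => (γ s).2) (-E s (γ s).1) s :=
  (ContinuousLinearMap.snd ℝ ℝ ℝ).hasFDerivAt.comp_hasDerivAt s h

namespace IsCharOn

theorem abs_fst_sub_le (h : IsCharOn E t γ) (hs : s ∈ Icc 0 t) :
    |(γ s).1 - (γ t).1| ≤ t - s := by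
  have norm_le := Convex.norm_image_sub_le_of_norm_hasDerivWithin_le (C := 1)
    (fun r hr => (hasDerivAt_fst_of_charField (h r hr)).hasDerivWithinAt)
    (fun r _ => (abs_relVelocity_lt_one _).le) (convex_Icc 0 t) ⟨hs.1.trans hs.2, le_rfl⟩ hs
  rwa [one_mul, norm_sub_rev s t, Real.norm_of_nonneg (sub_nonneg.2 hs.2)] at norm_le

theorem abs_snd_sub_le (h : IsCharOn E t γ) (ht : 0 ≤ t) {B B' : ℝ → ℝ}
    (hB : ∀ s, HasDerivAt B (B' s) s)
    (hE : ∀ s ∈ Icc 0 t, ∀ y, |y - (γ t).1| ≤ t - s → |E s y| ≤ B' s) :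
    |(γ t).2 - (γ 0).2| ≤ B t - B 0 := by
  have hd (s : ℝ) (hs : s ∈ Icc 0 t) :
      HasDerivAt (fun s => (γ s).2 - (γ 0).2) (-E s (γ s).1) s :=
    (hasDerivAt_snd_of_charField (h s hs)).sub_const _
  refine image_norm_le_of_norm_deriv_right_le_deriv_boundary
    (fun s hs => (hd s hs).continuousAt.continuousWithinAt)
    (fun s hs => (hd s (Ico_subset_Icc_self hs)).hasDerivWithinAt) (by simp)
    (fun s => (hB s).sub_const (B 0)) (fun s hs => ?_) (right_mem_Icc.2 ht)
  rw [norm_neg]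
  exact hE s (Ico_subset_Icc_self hs) _ (h.abs_fst_sub_le (Ico_subset_Icc_self hs))

theorem norm_sub_le (h : IsCharOn E t γ) (h₂ : IsCharOn E₂ t η) (ht : 0 ≤ t)
    (heq : γ t = η t) {L ε : ℝ} (hL : 0 ≤ L) (hε : 0 ≤ ε)
    (hlip : ∀ s ∈ Icc 0 t, ∀ y y', |y - (γ t).1| ≤ t - s → |y' - (γ t).1| ≤ t - s →
      |E s y - E s y'| ≤ L * |y - y'|)
    (hdiff : ∀ s ∈ Icc 0 t, ∀ y, |y - (γ t).1| ≤ t - s → |E s y - E₂ s y| ≤ ε) :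
    ‖γ 0 - η 0‖ ≤ ε * t * Real.exp ((1 + L) * t) := by
  have field_sub_le (s : ℝ) (hs : s ∈ uIcc t 0) :
      ‖charField E s (γ s) - charField E₂ s (η s)‖ ≤ (1 + L) * ‖γ s - η s‖ + ε := by
    rw [uIcc_of_ge ht] at hs
    have γ_cone := h.abs_fst_sub_le hs
    have η_cone := h₂.abs_fst_sub_le hs
    rw [← heq] at η_cone
    have fields_sub_le : ‖charField E s (η s) - charField E₂ s (η s)‖ ≤ ε := by
      simp only [charField, Prod.mk_sub_mk, sub_self, neg_sub_neg, norm_prod_le_iff, norm_zero]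
      exact ⟨hε, (norm_sub_rev _ _).trans_le (hdiff s hs _ η_cone)⟩
    exact (norm_sub_le_norm_sub_add_norm_sub _ (charField E s (η s)) _).trans
      (add_le_add (norm_charField_sub_le hL (hlip s hs _ _ γ_cone η_cone)) fields_sub_le)
  simpa [abs_of_nonneg ht] using norm_le_mul_exp_of_norm_deriv_le (δ := 0) (by positivity) hε
    (fun s hs => (h s (uIcc_of_ge ht ▸ hs)).sub (h₂ s (uIcc_of_ge ht ▸ hs))) field_sub_le
    (by simp [heq])

end IsCharOn

namespace IsTransported

theorem abs_sub_le (h : IsTransported f₀ E f t x v)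
    (h₂ : IsTransported f₀ E₂ f₂ t x v) (ht : 0 ≤ t) {Λ : ℝ≥0} {L ε : ℝ}
    (hf₀ : LipschitzWith Λ f₀) (hL : 0 ≤ L) (hε : 0 ≤ ε)
    (hlip : ∀ s ∈ Icc 0 t, ∀ y y', |y - x| ≤ t - s → |y' - x| ≤ t - s →
      |E s y - E s y'| ≤ L * |y - y'|)
    (hdiff : ∀ s ∈ Icc 0 t, ∀ y, |y - x| ≤ t - s → |E s y - E₂ s y| ≤ ε) :
    |f t x v - f₂ t x v| ≤ Λ * (ε * t * Real.exp ((1 + L) * t)) := by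
  obtain ⟨γ, hγ, cγ, f_eq⟩ := h
  obtain ⟨η, hη, cη, f₂_eq⟩ := h₂
  rw [f_eq, f₂_eq]
  refine (hf₀.norm_sub_le _ _).trans (mul_le_mul_of_nonneg_left ?_ Λ.2)
  refine cγ.norm_sub_le cη ht (hγ.trans hη.symm) hL hε ?_ ?_ <;> simpa only [hγ]

theorem eq_zero_of_velocity (h : IsTransported f₀ E f t x v) (ht : 0 ≤ t)
    {B B' : ℝ → ℝ} (hB : ∀ s, HasDerivAt B (B' s) s)
    (hE : ∀ s ∈ Icc 0 t, ∀ y, |y - x| ≤ t - s → |E s y| ≤ B' s)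
    (hf₀ : ∀ x v, B 0 ≤ |v| → f₀ (x, v) = 0) (hv : B t ≤ |v|) : f t x v = 0 := by
  obtain ⟨γ, hγ, cγ, f_eq⟩ := h
  have change_le := cγ.abs_snd_sub_le ht hB (by simpa only [hγ] using hE)
  rw [hγ] at change_le
  rw [f_eq]
  refine hf₀ _ _ ?_
  linarith [abs_sub_abs_le_abs_sub v (γ 0).2]

theorem eq_zero_of_position (h : IsTransported f₀ E f t x v) (ht : 0 ≤ t) {R : ℝ}
    (hf₀ : ∀ x v, R ≤ |x| → f₀ (x, v) = 0) (hx : R + t ≤ |x|) : f t x v = 0 := by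
  obtain ⟨γ, hγ, cγ, f_eq⟩ := h
  have change_le := cγ.abs_fst_sub_le ⟨le_rfl, ht⟩
  rw [hγ, abs_sub_comm] at change_le
  rw [f_eq]
  refine hf₀ _ _ ?_
  linarith [abs_sub_abs_le_abs_sub x (γ 0).1]

end IsTransported

namespace IsLipField

theorem isTransported (hE : IsLipField E) (f₀ : ℝ × ℝ → ℝ) (t x v : ℝ) :
    IsTransported f₀ E (transport f₀ E) t x v :=
  ⟨fieldFlow (_root_.charField E) t (x, v), hE.charField.fieldFlow_self _ _,
    fun s _ => hE.charField.isIntegralCurve_fieldFlow _ _ s, rfl⟩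

theorem hasBddVelocitySupport (hE : IsLipField E)
    (hb : ∀ T, ∃ K, 0 ≤ K ∧ ∀ t ∈ Icc (-T) T, ∀ x, |E t x| ≤ K)
    (hf₀ : ∃ Q, 0 ≤ Q ∧ ∀ x v, Q ≤ |v| → f₀ (x, v) = 0) :
    HasBddVelocitySupport (transport f₀ E) := by
  intro T
  obtain ⟨K, hK, hKE⟩ := hb |T|
  obtain ⟨Q, hQ, h⟩ := hf₀
  refine ⟨Q + K * |T|, by positivity, fun t ht x v hv => h _ _ ?_⟩
  have ht' : |t| ≤ |T| := abs_le_abs (by linarith [ht.2]) (by linarith [ht.1])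
  set γ := fieldFlow (_root_.charField E) t (x, v)
  have γ_self : γ t = (x, v) := hE.charField.fieldFlow_self t (x, v)
  have change_le : |(γ t).2 - (γ 0).2| ≤ K * |t - 0| :=
    Convex.norm_image_sub_le_of_norm_hasDerivWithin_le
      (fun r _ => (hasDerivAt_snd_of_charField
        (hE.charField.isIntegralCurve_fieldFlow t (x, v) r)).hasDerivWithinAt)
      (fun r hr => (norm_neg _).trans_le (hKE r (abs_le.1 ((abs_le.2 hr).trans ht')) _))
      (convex_Icc (-|t|) |t|) ⟨by simp, abs_nonneg t⟩ (abs_le.1 le_rfl)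
  rw [γ_self, sub_zero] at change_le
  change Q ≤ |(γ 0).2|
  linarith [abs_sub_abs_le_abs_sub v (γ 0).2, mul_le_mul_of_nonneg_left ht' hK]

end IsLipField

end CharEstimates

/-! ### The momentum bound -/

section MomentumBound

/-- The solution of the integral equation `P(t) = P₀ + C (1 + t)³ + C ∫₀ᵗ s P(s) ds`. -/
noncomputable def momentumBound (C P₀ t : ℝ) : ℝ :=
  Real.exp (C * t ^ 2 / 2) *
    (P₀ + C + ∫ s in (0 : ℝ)..t, 3 * C * (1 + s) ^ 2 * Real.exp (-(C * s ^ 2 / 2)))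

/-- The derivative of the momentum bound. -/
noncomputable def momentumRate (C P₀ t : ℝ) : ℝ :=
  3 * C * (1 + t) ^ 2 + C * t * momentumBound C P₀ t

variable {C P₀ t : ℝ}

theorem hasDerivAt_momentumBound (C P₀ t : ℝ) :
    HasDerivAt (momentumBound C P₀) (momentumRate C P₀ t) t := by
  have exponent : HasDerivAt (fun t : ℝ => C * t ^ 2 / 2) (C * t) t := by
    refine (((hasDerivAt_pow 2 t).const_mul C).div_const 2).congr_deriv ?_
    push_cast
    ring
  have hc : Continuous fun s : ℝ => 3 * C * (1 + s) ^ 2 * Real.exp (-(C * s ^ 2 / 2)) := by fun_prop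
  have integral := (intervalIntegral.integral_hasDerivAt_right (hc.intervalIntegrable 0 t)
    (hc.stronglyMeasurableAtFilter _ _) hc.continuousAt).const_add (P₀ + C)
  refine (exponent.exp.mul integral).congr_deriv ?_
  have exp_mul_exp_neg : Real.exp (C * t ^ 2 / 2) * Real.exp (-(C * t ^ 2 / 2)) = 1 := by
    rw [← Real.exp_add, add_neg_cancel, Real.exp_zero]
  rw [momentumRate, momentumBound]
  linear_combination (3 * C * (1 + t) ^ 2) * exp_mul_exp_neg

theorem continuous_momentumBound (C P₀ : ℝ) : Continuous (momentumBound C P₀) :=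
  continuous_iff_continuousAt.2 fun t => (hasDerivAt_momentumBound C P₀ t).continuousAt

theorem continuous_momentumRate (C P₀ : ℝ) : Continuous (momentumRate C P₀) := by
  unfold momentumRate
  have := continuous_momentumBound C P₀
  fun_prop

theorem momentumBound_zero (C P₀ : ℝ) : momentumBound C P₀ 0 = P₀ + C := by simp [momentumBound]

theorem hasDerivAt_mul_one_add_cube (C t : ℝ) :
    HasDerivAt (fun s => C * (1 + s) ^ 3) (3 * C * (1 + t) ^ 2) t := by
  refine ((((hasDerivAt_id t).const_add 1).pow 3).const_mul C).congr_deriv ?_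
  simp only [id, mul_one]
  push_cast
  ring

theorem momentumBound_eq (C P₀ t : ℝ) : momentumBound C P₀ t =
    P₀ + C * (1 + t) ^ 3 + C * ∫ s in (0 : ℝ)..t, s * momentumBound C P₀ s := by
  have hc := continuous_momentumBound C P₀
  have integrable_cube : IntervalIntegrable (fun s => 3 * C * (1 + s) ^ 2) volume 0 t := by
    apply Continuous.intervalIntegrable; fun_prop
  have integrable_mul :
      IntervalIntegrable (fun s => C * (s * momentumBound C P₀ s)) volume 0 t := by
    apply Continuous.intervalIntegrable; fun_prop
  have ftc := intervalIntegral.integral_eq_sub_of_hasDerivAt (a := 0) (b := t)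
    (fun s _ => hasDerivAt_momentumBound C P₀ s)
    ((continuous_momentumRate C P₀).intervalIntegrable _ _)
  simp only [momentumRate, mul_assoc C] at ftc
  rw [intervalIntegral.integral_add integrable_cube integrable_mul,
    intervalIntegral.integral_eq_sub_of_hasDerivAt (fun s _ => hasDerivAt_mul_one_add_cube C s)
      integrable_cube, intervalIntegral.integral_const_mul, momentumBound_zero] at ftc
  linarith

theorem solvesMomentumEquation_momentumBound (C P₀ : ℝ) :
    SolvesMomentumEquation C P₀ (momentumBound C P₀) :=
  ⟨(continuous_momentumBound C P₀).continuousOn, fun t _ => momentumBound_eq C P₀ t⟩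

theorem SolvesMomentumEquation.hasDerivWithinAt {P : ℝ → ℝ} (hP : SolvesMomentumEquation C P₀ P)
    (ht : 0 ≤ t) :
    HasDerivWithinAt P (3 * C * (1 + t) ^ 2 + C * (t * P t)) (Ici t) t := by
  have c_mul : ContinuousOn (fun s => s * P s) (Ici 0) := continuousOn_id.mul hP.continuousOn
  have integral : HasDerivWithinAt (fun t => ∫ s in (0 : ℝ)..t, s * P s) (t * P t) (Ici t) t := by
    refine intervalIntegral.integral_hasDerivWithinAt_right
      (c_mul.mono fun s hs => (uIcc_of_le ht ▸ hs).1).intervalIntegrable (t := Ioi t) ?_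
      ((c_mul t ht).mono (Ioi_subset_Ici ht))
    exact (c_mul.stronglyMeasurableAtFilter_nhdsWithin measurableSet_Ici t).filter_mono
      (nhdsWithin_mono _ fun s hs => ht.trans (le_of_lt hs))
  exact (((hasDerivAt_mul_one_add_cube C t).hasDerivWithinAt.const_add P₀).add
    (integral.const_mul C)).congr (fun s hs => hP.eq s (ht.trans hs)) (hP.eq t ht)

theorem SolvesMomentumEquation.eqOn {P Q : ℝ → ℝ} (hP : SolvesMomentumEquation C P₀ P)
    (hQ : SolvesMomentumEquation C P₀ Q) : EqOn Q P (Ici 0) := by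
  intro T hT
  have deriv_sub (t : ℝ) (ht : t ∈ Ico 0 T) :
      HasDerivWithinAt (fun t => Q t - P t) (C * t * (Q t - P t)) (Ici t) t :=
    ((hQ.hasDerivWithinAt ht.1).sub (hP.hasDerivWithinAt ht.1)).congr_deriv (by ring)
  have deriv_le (t : ℝ) (ht : t ∈ Ico 0 T) :
      ‖C * t * (Q t - P t)‖ ≤ |C| * T * ‖Q t - P t‖ := by
    rw [norm_mul, norm_mul, Real.norm_eq_abs C, Real.norm_of_nonneg ht.1]
    gcongr
    exact ht.2.le
  refine sub_eq_zero.1 (eq_zero_of_abs_deriv_le_mul_abs_self_of_eq_zero_right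
    ((hQ.continuousOn.sub hP.continuousOn).mono Icc_subset_Ici_self) deriv_sub ?_ deriv_le T
    ⟨hT, le_rfl⟩)
  change Q 0 - P 0 = 0
  simp [hQ.eq 0 le_rfl, hP.eq 0 le_rfl]

theorem momentumBound_nonneg (hC : 0 ≤ C) (hP : 0 ≤ P₀) (ht : 0 ≤ t) :
    0 ≤ momentumBound C P₀ t := by
  unfold momentumBound
  have : 0 ≤ ∫ s in (0 : ℝ)..t, 3 * C * (1 + s) ^ 2 * Real.exp (-(C * s ^ 2 / 2)) :=
    intervalIntegral.integral_nonneg ht fun s _ => by positivity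
  positivity

theorem momentumRate_nonneg (hC : 0 ≤ C) (hP : 0 ≤ P₀) (ht : 0 ≤ t) : 0 ≤ momentumRate C P₀ t := by
  have := momentumBound_nonneg hC hP ht
  unfold momentumRate
  positivity

theorem monotoneOn_momentumBound (hC : 0 ≤ C) (hP : 0 ≤ P₀) :
    MonotoneOn (momentumBound C P₀) (Ici 0) := by
  refine monotoneOn_of_deriv_nonneg (convex_Ici 0) (continuous_momentumBound C P₀).continuousOn
    (fun t _ => (hasDerivAt_momentumBound C P₀ t).differentiableAt.differentiableWithinAt)
    fun t ht => ?_
  rw [interior_Ici] at ht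
  rw [(hasDerivAt_momentumBound C P₀ t).deriv]
  exact momentumRate_nonneg hC hP (le_of_lt ht)

theorem monotoneOn_momentumRate (hC : 0 ≤ C) (hP : 0 ≤ P₀) :
    MonotoneOn (momentumRate C P₀) (Ici 0) := by
  intro s hs t ht hst
  have hmono := monotoneOn_momentumBound hC hP hs ht hst
  have hs0 : 0 ≤ s := hs
  have ht0 : 0 ≤ t := ht
  have := momentumBound_nonneg hC hP hs0
  unfold momentumRate
  gcongr

theorem integral_momentumBound_le (hC : 0 ≤ C) (hP : 0 ≤ P₀) (ht : 0 ≤ t) :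
    ∫ s in (0 : ℝ)..t, momentumBound C P₀ s ≤ t * momentumBound C P₀ t := by
  simpa using intervalIntegral.integral_mono_on ht
    ((continuous_momentumBound C P₀).intervalIntegrable 0 t)
    (continuous_const.intervalIntegrable 0 t (μ := volume))
    (fun s hs => monotoneOn_momentumBound hC hP hs.1 ht hs.2)

theorem integral_mul_momentumBound_le (hC : 0 ≤ C) (hP : 0 ≤ P₀) (ht : 0 ≤ t) :
    ∫ s in (0 : ℝ)..t, s * momentumBound C P₀ s ≤ t ^ 2 / 2 * momentumBound C P₀ t := by
  simpa using intervalIntegral.integral_mono_on ht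
    ((continuous_id.mul (continuous_momentumBound C P₀)).intervalIntegrable 0 t (μ := volume))
    ((continuous_id.mul continuous_const).intervalIntegrable 0 t (μ := volume))
    (fun s hs => mul_le_mul_of_nonneg_left (monotoneOn_momentumBound hC hP hs.1 ht hs.2) hs.1)

/-- The left-hand side bounds the field of a density whose momenta are at most
`momentumBound C P₀`, so the momentum bound reproduces itself along characteristics. -/
theorem add_le_momentumRate {M : ℝ} (hM : 0 ≤ M) (hC : 4 * M + 2 ≤ C) (hP : 0 ≤ P₀) (ht : 0 ≤ t) :
    2 * M + 2 * M * (∫ s in (0 : ℝ)..t, momentumBound C P₀ s) +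
      (momentumBound C P₀ t - momentumBound C P₀ 0) ≤ momentumRate C P₀ t := by
  have hC0 : 0 ≤ C := by linarith
  have hp := momentumBound_nonneg hC0 hP ht
  have bound_eq := momentumBound_eq C P₀ t
  have integral_mul_le := integral_mul_momentumBound_le hC0 hP ht
  have integral_le : M * (∫ s in (0 : ℝ)..t, momentumBound C P₀ s) ≤
      M * (t * momentumBound C P₀ t) :=
    mul_le_mul_of_nonneg_left (integral_momentumBound_le hC0 hP ht) hM
  rw [momentumBound_zero, momentumRate]
  set p := momentumBound C P₀ t
  have htp : 0 ≤ t * p := mul_nonneg ht hp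
  -- For `t ≤ 1` the integral equation controls `p`, for `t ≥ 1` the term `C t p` dominates it.
  rcases le_total t 1 with h | h
  · have integral_mul_le' : C * ∫ s in (0 : ℝ)..t, s * momentumBound C P₀ s ≤ C * (t * p / 2) :=
      mul_le_mul_of_nonneg_left (integral_mul_le.trans (by nlinarith)) hC0
    have three_le : 3 ≤ 3 + 3 * t - t ^ 3 := by
      nlinarith [mul_nonneg ht (sub_nonneg.2 h), sq_nonneg t]
    have cubic_le : C * 3 ≤ C * (3 + 3 * t - t ^ 3) := mul_le_mul_of_nonneg_left three_le hC0
    have rate_le : (4 * M) * (t * p) ≤ C * (t * p) := mul_le_mul_of_nonneg_right (by linarith) htp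
    nlinarith
  · have le_mul : p ≤ t * p := by nlinarith
    have le_mul_sq : C * 1 ≤ C * (1 + t) ^ 2 := mul_le_mul_of_nonneg_left (by nlinarith) hC0
    have rate_le : (4 * M + 2) * (t * p) ≤ C * (t * p) := mul_le_mul_of_nonneg_right hC htp
    have := mul_nonneg hM htp
    linarith

end MomentumBound

/-! ### Initial data -/

section InitialData

open scoped NNReal

/-- Initial data of the Vlasov–Klein–Gordon system with a common bound `M` on the quantities that
control the growth of the momenta. The second derivatives of the potential are only required to be
bounded by some constant. -/
structure IsC2VKGData (M : ℝ) (f₀ : ℝ × ℝ → ℝ) (u₁ u₂ : ℝ → ℝ) : Prop where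
  contDiff_f : ContDiff ℝ 1 f₀
  compactSupport_f : HasCompactSupport f₀
  contDiff_u₁ : ContDiff ℝ 2 u₁
  contDiff_u₂ : ContDiff ℝ 1 u₂
  sup_f_le : ∀ z, |f₀ z| ≤ M
  abs_u₁_le : ∀ x, |u₁ x| ≤ M
  abs_deriv_u₁_le : ∀ x, |deriv u₁ x| ≤ M
  abs_u₂_le : ∀ x, |u₂ x| ≤ M
  exists_deriv_le : ∃ K, ∀ x, |deriv (deriv u₁) x| ≤ K ∧ |deriv u₂ x| ≤ K

/-- Initial data whose momenta are at most `P₀`, together with a constant `C` for which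
`momentumBound C P₀` controls the momenta of the solution. -/
structure IsBoundedData (M C P₀ : ℝ) (f₀ : ℝ × ℝ → ℝ) (u₁ u₂ : ℝ → ℝ) : Prop
    extends IsC2VKGData M f₀ u₁ u₂ where
  const_le : 4 * M + 2 ≤ C
  nonneg : 0 ≤ P₀
  velocity_le : ∀ x v, f₀ (x, v) ≠ 0 → |v| ≤ P₀

variable {M C P₀ : ℝ} {f₀ : ℝ × ℝ → ℝ} {u₁ u₂ : ℝ → ℝ}

theorem IsVKGData.isC2VKGData (hd : IsVKGData M f₀ u₁ u₂) : IsC2VKGData M f₀ u₁ u₂ where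
  contDiff_f := hd.contDiff_f
  compactSupport_f := hd.compactSupport_f
  contDiff_u₁ := hd.contDiff_u₁.of_le (by norm_num)
  contDiff_u₂ := hd.contDiff_u₂.of_le (by norm_num)
  sup_f_le := hd.sup_f_le
  abs_u₁_le := by simpa using hd.bound_u₁ 0 (by norm_num)
  abs_deriv_u₁_le := by simpa using hd.bound_u₁ 1 (by norm_num)
  abs_u₂_le := by simpa using hd.bound_u₂ 0 (by norm_num)
  exists_deriv_le := ⟨M, fun x =>
    ⟨by simpa [iteratedDeriv_succ] using hd.bound_u₁ 2 (by norm_num) x,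
      by simpa using hd.bound_u₂ 1 (by norm_num) x⟩⟩

namespace IsC2VKGData

theorem bound_nonneg (hd : IsC2VKGData M f₀ u₁ u₂) : 0 ≤ M :=
  (abs_nonneg _).trans (hd.sup_f_le 0)

theorem exists_lipschitzWith (hd : IsC2VKGData M f₀ u₁ u₂) : ∃ Λ : ℝ≥0, LipschitzWith Λ f₀ :=
  hd.contDiff_f.lipschitzWith_of_hasCompactSupport hd.compactSupport_f one_ne_zero

theorem contDiff_deriv_u₁ (hd : IsC2VKGData M f₀ u₁ u₂) : ContDiff ℝ 1 (deriv u₁) :=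
  (contDiff_succ_iff_deriv (n := 1).1 hd.contDiff_u₁).2.2

theorem continuous_deriv_deriv_u₁ (hd : IsC2VKGData M f₀ u₁ u₂) :
    Continuous (deriv (deriv u₁)) :=
  hd.contDiff_deriv_u₁.continuous_deriv le_rfl

theorem continuous_deriv_u₂ (hd : IsC2VKGData M f₀ u₁ u₂) : Continuous (deriv u₂) :=
  hd.contDiff_u₂.continuous_deriv le_rfl

theorem hasDerivAt_u₁ (hd : IsC2VKGData M f₀ u₁ u₂) (x : ℝ) : HasDerivAt u₁ (deriv u₁ x) x :=
  (hd.contDiff_u₁.differentiable two_ne_zero x).hasDerivAt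

theorem hasDerivAt_deriv_u₁ (hd : IsC2VKGData M f₀ u₁ u₂) (x : ℝ) :
    HasDerivAt (deriv u₁) (deriv (deriv u₁) x) x :=
  (hd.contDiff_deriv_u₁.differentiable one_ne_zero x).hasDerivAt

theorem hasDerivAt_u₂ (hd : IsC2VKGData M f₀ u₁ u₂) (x : ℝ) : HasDerivAt u₂ (deriv u₂ x) x :=
  (hd.contDiff_u₂.differentiable one_ne_zero x).hasDerivAt

end IsC2VKGData

namespace IsBoundedData

theorem const_pos (hd : IsBoundedData M C P₀ f₀ u₁ u₂) : 0 < C := by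
  linarith [hd.bound_nonneg, hd.const_le]

theorem f_eq_zero (hd : IsBoundedData M C P₀ f₀ u₁ u₂) (x v : ℝ)
    (h : momentumBound C P₀ 0 ≤ |v|) : f₀ (x, v) = 0 := by
  by_contra hne
  rw [momentumBound_zero] at h
  linarith [hd.velocity_le x v hne, hd.const_pos]

end IsBoundedData

end InitialData

/-! ### One step of the iteration -/

section Step

/-- The source `-ρ - u` of the wave equation for the next potential, where `ρ` is the charge
density transported by the field `E`. -/
noncomputable def waveSource (f₀ : ℝ × ℝ → ℝ) (u E : ℝ → ℝ → ℝ) (t x : ℝ) : ℝ :=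
  -moment (fun _ => 1) (transport f₀ E) t x - u t x

/-- The Riemann invariant `∂ₜ w + σ ∂ₓ w` of the solution `w` of the wave equation with source
`waveSource f₀ u E` and initial data `(u₁, u₂)`. -/
noncomputable def riemann (f₀ : ℝ × ℝ → ℝ) (u₁ u₂ : ℝ → ℝ) (u E : ℝ → ℝ → ℝ) (σ t x : ℝ) : ℝ :=
  u₂ (x + σ * t) + σ * deriv u₁ (x + σ * t) + lineIntegral σ (waveSource f₀ u E) t x

/-- The spatial derivative of the Riemann invariant, free of derivatives of the density. -/
noncomputable def riemannDeriv (f₀ : ℝ × ℝ → ℝ) (u₁ u₂ : ℝ → ℝ) (E : ℝ → ℝ → ℝ) (σ t x : ℝ) : ℝ :=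
  deriv u₂ (x + σ * t) + σ * deriv (deriv u₁) (x + σ * t)
    + moment (coneWeight σ) (transport f₀ E) t x
    - moment (coneWeight σ) (transport f₀ E) 0 (x + σ * t)
    - lineIntegral σ (fun s y => E s y * (moment (coneWeightDeriv σ) (transport f₀ E) s y + 1)) t x

/-- The spatial derivative of the next potential. -/
noncomputable def nextField (f₀ : ℝ × ℝ → ℝ) (u₁ u₂ : ℝ → ℝ) (u E : ℝ → ℝ → ℝ) (t x : ℝ) : ℝ :=
  (riemann f₀ u₁ u₂ u E 1 t x - riemann f₀ u₁ u₂ u E (-1) t x) / 2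

/-- The time derivative of the next potential. -/
noncomputable def nextRate (f₀ : ℝ × ℝ → ℝ) (u₁ u₂ : ℝ → ℝ) (u E : ℝ → ℝ → ℝ) (t x : ℝ) : ℝ :=
  (riemann f₀ u₁ u₂ u E 1 t x + riemann f₀ u₁ u₂ u E (-1) t x) / 2

/-- The solution of the wave equation with source `waveSource f₀ u E`, which is the next potential
of the iteration. -/
noncomputable def nextPotential (f₀ : ℝ × ℝ → ℝ) (u₁ u₂ : ℝ → ℝ) (u E : ℝ → ℝ → ℝ) (t x : ℝ) : ℝ :=
  u₁ x + ∫ s in (0 : ℝ)..t, nextRate f₀ u₁ u₂ u E s x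

/-- The spatial derivative of the next field. -/
noncomputable def nextFieldDeriv (f₀ : ℝ × ℝ → ℝ) (u₁ u₂ : ℝ → ℝ) (E : ℝ → ℝ → ℝ) (t x : ℝ) : ℝ :=
  (riemannDeriv f₀ u₁ u₂ E 1 t x - riemannDeriv f₀ u₁ u₂ E (-1) t x) / 2

/-- The spatial derivative of the time derivative of the next potential. -/
noncomputable def nextRateDeriv (f₀ : ℝ × ℝ → ℝ) (u₁ u₂ : ℝ → ℝ) (E : ℝ → ℝ → ℝ) (t x : ℝ) : ℝ :=
  (riemannDeriv f₀ u₁ u₂ E 1 t x + riemannDeriv f₀ u₁ u₂ E (-1) t x) / 2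

/-- Extension to negative times by the value at time zero. -/
def clampTime (h : ℝ → ℝ → ℝ) (t x : ℝ) : ℝ := h (max t 0) x

theorem clampTime_of_nonneg {h : ℝ → ℝ → ℝ} {t : ℝ} (ht : 0 ≤ t) (x : ℝ) :
    clampTime h t x = h t x := by rw [clampTime, max_eq_left ht]

theorem continuous_clampTime {h : ℝ → ℝ → ℝ} (c : Continuous fun p : ℝ × ℝ => h p.1 p.2) :
    Continuous fun p : ℝ × ℝ => clampTime h p.1 p.2 :=
  c.comp (show Continuous fun p : ℝ × ℝ => (max p.1 0, p.2) by fun_prop)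

/-- Potential `u` and field `E` of an approximate solution, both bounded by `R t` at time `t`.
At this stage `E` need not be the derivative of `u`. -/
structure IsWeakState (R : ℝ → ℝ) (u E : ℝ → ℝ → ℝ) : Prop where
  cont_u : Continuous fun p : ℝ × ℝ => u p.1 p.2
  lip : IsLipField E
  bound_u : ∀ t x, |u t x| ≤ R (max t 0)
  bound_E : ∀ t x, |E t x| ≤ R (max t 0)

variable {M C P₀ : ℝ} {f₀ : ℝ × ℝ → ℝ} {u₁ u₂ : ℝ → ℝ} {u E : ℝ → ℝ → ℝ} {σ t x T : ℝ}

namespace IsWeakState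

theorem abs_E_le {R : ℝ → ℝ} (hs : IsWeakState R u E) (hR : MonotoneOn R (Ici 0))
    (ht : t ∈ Icc 0 T) (x : ℝ) : |E t x| ≤ R T := by
  refine (hs.bound_E t x).trans ?_
  rw [max_eq_left ht.1]
  exact hR ht.1 (ht.1.trans ht.2) ht.2

theorem transport_eq_zero (hs : IsWeakState (momentumRate C P₀) u E)
    (hd : IsBoundedData M C P₀ f₀ u₁ u₂) (ht : t ∈ Icc 0 T) (x : ℝ) {v : ℝ}
    (hv : momentumBound C P₀ T ≤ |v|) : transport f₀ E t x v = 0 :=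
  (hs.lip.isTransported f₀ t x v).eq_zero_of_velocity ht.1 (hasDerivAt_momentumBound C P₀)
    (fun s hst y _ => by simpa [max_eq_left hst.1] using hs.bound_E s y) hd.f_eq_zero
    ((monotoneOn_momentumBound hd.const_pos.le hd.nonneg ht.1 (ht.1.trans ht.2) ht.2).trans hv)

theorem hasBddVelocitySupport (hs : IsWeakState (momentumRate C P₀) u E)
    (hd : IsBoundedData M C P₀ f₀ u₁ u₂) : HasBddVelocitySupport (transport f₀ E) := by
  have hC := hd.const_pos.le
  refine hs.lip.hasBddVelocitySupport (fun T => ?_)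
    ⟨momentumBound C P₀ 0, momentumBound_nonneg hC hd.nonneg le_rfl, hd.f_eq_zero⟩
  refine ⟨momentumRate C P₀ (max T 0), momentumRate_nonneg hC hd.nonneg (le_max_right _ _),
    fun t ht x => (hs.bound_E t x).trans ?_⟩
  exact monotoneOn_momentumRate hC hd.nonneg (le_max_right t 0) (le_max_right T 0)
    (max_le_max ht.2 le_rfl)

theorem continuous_transport (hs : IsWeakState (momentumRate C P₀) u E)
    (hd : IsBoundedData M C P₀ f₀ u₁ u₂) :
    Continuous fun p : ℝ × ℝ × ℝ => transport f₀ E p.1 p.2.1 p.2.2 :=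
  hs.lip.continuous_transport hd.contDiff_f.continuous

theorem continuous_moment (hs : IsWeakState (momentumRate C P₀) u E)
    (hd : IsBoundedData M C P₀ f₀ u₁ u₂) {a : ℝ → ℝ} (ca : Continuous a) :
    Continuous fun p : ℝ × ℝ => moment a (transport f₀ E) p.1 p.2 :=
  (hs.hasBddVelocitySupport hd).continuous_moment (hs.continuous_transport hd) ca

theorem continuous_waveSource (hs : IsWeakState (momentumRate C P₀) u E)
    (hd : IsBoundedData M C P₀ f₀ u₁ u₂) :
    Continuous fun p : ℝ × ℝ => waveSource f₀ u E p.1 p.2 :=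
  (hs.continuous_moment hd continuous_const).neg.sub hs.cont_u

theorem continuous_riemann (hs : IsWeakState (momentumRate C P₀) u E)
    (hd : IsBoundedData M C P₀ f₀ u₁ u₂) (σ : ℝ) :
    Continuous fun p : ℝ × ℝ => riemann f₀ u₁ u₂ u E σ p.1 p.2 := by
  have line : Continuous fun p : ℝ × ℝ => p.2 + σ * p.1 := by fun_prop
  exact ((hd.contDiff_u₂.continuous.comp line).add
    (continuous_const.mul (hd.contDiff_deriv_u₁.continuous.comp line))).add
      (continuous_lineIntegral σ (hs.continuous_waveSource hd))

theorem continuous_nextField (hs : IsWeakState (momentumRate C P₀) u E)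
    (hd : IsBoundedData M C P₀ f₀ u₁ u₂) :
    Continuous fun p : ℝ × ℝ => nextField f₀ u₁ u₂ u E p.1 p.2 :=
  ((hs.continuous_riemann hd 1).sub (hs.continuous_riemann hd (-1))).div_const 2

theorem continuous_nextRate (hs : IsWeakState (momentumRate C P₀) u E)
    (hd : IsBoundedData M C P₀ f₀ u₁ u₂) :
    Continuous fun p : ℝ × ℝ => nextRate f₀ u₁ u₂ u E p.1 p.2 :=
  ((hs.continuous_riemann hd 1).add (hs.continuous_riemann hd (-1))).div_const 2

theorem continuous_nextRate_left (hs : IsWeakState (momentumRate C P₀) u E)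
    (hd : IsBoundedData M C P₀ f₀ u₁ u₂) (x : ℝ) :
    Continuous fun s => nextRate f₀ u₁ u₂ u E s x :=
  (hs.continuous_nextRate hd).comp (Continuous.prodMk_left x)

theorem continuous_nextPotential (hs : IsWeakState (momentumRate C P₀) u E)
    (hd : IsBoundedData M C P₀ f₀ u₁ u₂) :
    Continuous fun p : ℝ × ℝ => nextPotential f₀ u₁ u₂ u E p.1 p.2 :=
  (hd.contDiff_u₁.continuous.comp continuous_snd).add
    (intervalIntegral.continuous_parametric_intervalIntegral_of_continuous
      (f := fun (p : ℝ × ℝ) s => nextRate f₀ u₁ u₂ u E s p.2)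
      ((hs.continuous_nextRate hd).comp
        (show Continuous fun q : (ℝ × ℝ) × ℝ => (q.2, q.1.2) by fun_prop)) continuous_fst)

theorem continuous_mul_moment_add_one (hs : IsWeakState (momentumRate C P₀) u E)
    (hd : IsBoundedData M C P₀ f₀ u₁ u₂) {a : ℝ → ℝ} (ca : Continuous a) :
    Continuous fun p : ℝ × ℝ => E p.1 p.2 * (moment a (transport f₀ E) p.1 p.2 + 1) :=
  hs.lip.continuous.mul ((hs.continuous_moment hd ca).add continuous_const)

theorem continuous_riemannDeriv (hs : IsWeakState (momentumRate C P₀) u E)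
    (hd : IsBoundedData M C P₀ f₀ u₁ u₂) (hσ : |σ| = 1) :
    Continuous fun p : ℝ × ℝ => riemannDeriv f₀ u₁ u₂ E σ p.1 p.2 := by
  have line : Continuous fun p : ℝ × ℝ => p.2 + σ * p.1 := by fun_prop
  have foot : Continuous fun p : ℝ × ℝ => ((0 : ℝ), p.2 + σ * p.1) := by fun_prop
  have c_moment := hs.continuous_moment hd (continuous_coneWeight hσ)
  exact ((((hd.continuous_deriv_u₂.comp line).add
    (continuous_const.mul (hd.continuous_deriv_deriv_u₁.comp line))).add c_moment).sub
      (c_moment.comp foot)).sub (continuous_lineIntegral σ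
        (hs.continuous_mul_moment_add_one hd (continuous_coneWeightDeriv hσ)))

theorem continuous_nextFieldDeriv (hs : IsWeakState (momentumRate C P₀) u E)
    (hd : IsBoundedData M C P₀ f₀ u₁ u₂) :
    Continuous fun p : ℝ × ℝ => nextFieldDeriv f₀ u₁ u₂ E p.1 p.2 :=
  ((hs.continuous_riemannDeriv hd (by simp)).sub
    (hs.continuous_riemannDeriv hd (by simp))).div_const 2

theorem continuous_nextRateDeriv (hs : IsWeakState (momentumRate C P₀) u E)
    (hd : IsBoundedData M C P₀ f₀ u₁ u₂) :
    Continuous fun p : ℝ × ℝ => nextRateDeriv f₀ u₁ u₂ E p.1 p.2 :=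
  ((hs.continuous_riemannDeriv hd (by simp)).add
    (hs.continuous_riemannDeriv hd (by simp))).div_const 2

theorem abs_moment_le (hs : IsWeakState (momentumRate C P₀) u E)
    (hd : IsBoundedData M C P₀ f₀ u₁ u₂) {a : ℝ → ℝ} {c : ℝ} (ca : Continuous a)
    (ha : ∀ v, |v| ≤ momentumBound C P₀ T → |a v| ≤ c) (ht : t ∈ Icc 0 T) (x : ℝ) :
    |moment a (transport f₀ E) t x| ≤ 2 * momentumBound C P₀ T * c * M :=
  _root_.abs_moment_le (momentumBound_nonneg hd.const_pos.le hd.nonneg (ht.1.trans ht.2))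
    (fun _ => hs.transport_eq_zero hd ht x)
    ((hs.continuous_transport hd).comp (show Continuous fun v : ℝ => (t, x, v) by fun_prop)) ca ha
    fun _ => hd.sup_f_le _

theorem abs_waveSource_le (hs : IsWeakState (momentumRate C P₀) u E)
    (hd : IsBoundedData M C P₀ f₀ u₁ u₂) (ht : 0 ≤ t) (x : ℝ) :
    |waveSource f₀ u E t x| ≤ 2 * M * momentumBound C P₀ t + momentumRate C P₀ t := by
  have density_le := hs.abs_moment_le hd (a := fun _ => 1) (c := 1) continuous_const (by simp)
    ⟨ht, le_rfl⟩ x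
  have potential_le := hs.bound_u t x
  rw [max_eq_left ht] at potential_le
  calc |waveSource f₀ u E t x|
      ≤ |moment (fun _ => 1) (transport f₀ E) t x| + |u t x| := by
        simpa only [waveSource, abs_neg] using
          abs_sub (-moment (fun _ => 1) (transport f₀ E) t x) (u t x)
    _ ≤ 2 * M * momentumBound C P₀ t + momentumRate C P₀ t := by linarith

theorem abs_riemann_le (hs : IsWeakState (momentumRate C P₀) u E)
    (hd : IsBoundedData M C P₀ f₀ u₁ u₂) (hσ : |σ| = 1) (ht : 0 ≤ t) (x : ℝ) :
    |riemann f₀ u₁ u₂ u E σ t x| ≤ momentumRate C P₀ t := by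
  have cP := continuous_momentumBound C P₀
  have cR := continuous_momentumRate C P₀
  have source_le : |lineIntegral σ (waveSource f₀ u E) t x| ≤
      2 * M * (∫ s in (0 : ℝ)..t, momentumBound C P₀ s) +
        (momentumBound C P₀ t - momentumBound C P₀ 0) := by
    refine (abs_lineIntegral_le ht (by fun_prop)
      (fun s hst => hs.abs_waveSource_le hd hst.1 _)).trans_eq ?_
    rw [intervalIntegral.integral_add ((cP.const_mul _).intervalIntegrable _ _)
      (cR.intervalIntegrable _ _), intervalIntegral.integral_const_mul,
      intervalIntegral.integral_eq_sub_of_hasDerivAt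
        (fun s _ => hasDerivAt_momentumBound C P₀ s) (cR.intervalIntegrable _ _)]
  have datum_le : |σ * deriv u₁ (x + σ * t)| ≤ M := by
    rw [abs_mul, hσ, one_mul]
    exact hd.abs_deriv_u₁_le _
  refine le_trans ?_ (add_le_momentumRate hd.bound_nonneg hd.const_le hd.nonneg ht)
  refine (abs_add_three _ _ _).trans ?_
  linarith [hd.abs_u₂_le (x + σ * t)]

theorem abs_nextField_le (hs : IsWeakState (momentumRate C P₀) u E)
    (hd : IsBoundedData M C P₀ f₀ u₁ u₂) (ht : 0 ≤ t) (x : ℝ) :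
    |nextField f₀ u₁ u₂ u E t x| ≤ momentumRate C P₀ t :=
  abs_half_sub_le (hs.abs_riemann_le hd (by simp) ht x) (hs.abs_riemann_le hd (by simp) ht x)

theorem abs_nextRate_le (hs : IsWeakState (momentumRate C P₀) u E)
    (hd : IsBoundedData M C P₀ f₀ u₁ u₂) (ht : 0 ≤ t) (x : ℝ) :
    |nextRate f₀ u₁ u₂ u E t x| ≤ momentumRate C P₀ t :=
  abs_half_add_le (hs.abs_riemann_le hd (by simp) ht x) (hs.abs_riemann_le hd (by simp) ht x)

theorem abs_nextPotential_le (hs : IsWeakState (momentumRate C P₀) u E)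
    (hd : IsBoundedData M C P₀ f₀ u₁ u₂) (ht : 0 ≤ t) (x : ℝ) :
    |nextPotential f₀ u₁ u₂ u E t x| ≤ momentumRate C P₀ t := by
  have cR := continuous_momentumRate C P₀
  have integral_le : |∫ s in (0 : ℝ)..t, nextRate f₀ u₁ u₂ u E s x| ≤
      momentumBound C P₀ t - momentumBound C P₀ 0 := by
    refine (abs_intervalIntegral_le ht cR fun s hst => hs.abs_nextRate_le hd hst.1 x).trans_eq ?_
    exact intervalIntegral.integral_eq_sub_of_hasDerivAt
      (fun s _ => hasDerivAt_momentumBound C P₀ s) (cR.intervalIntegrable _ _)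
  have hM := hd.bound_nonneg
  have mul_integral_nonneg : 0 ≤ 2 * M * ∫ s in (0 : ℝ)..t, momentumBound C P₀ s :=
    mul_nonneg (by positivity) (intervalIntegral.integral_nonneg ht
      fun s hst => momentumBound_nonneg hd.const_pos.le hd.nonneg hst.1)
  refine le_trans ?_ (add_le_momentumRate hM hd.const_le hd.nonneg ht)
  refine (abs_add_le _ _).trans ?_
  linarith [hd.abs_u₁_le x]

end IsWeakState

namespace IsBoundedData

theorem exists_abs_moment_le (hd : IsBoundedData M C P₀ f₀ u₁ u₂) {a : ℝ → ℝ} (ca : Continuous a)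
    (hT : 0 ≤ T) :
    ∃ B, 0 ≤ B ∧ ∀ u E, IsWeakState (momentumRate C P₀) u E → ∀ t ∈ Icc 0 T, ∀ x,
      |moment a (transport f₀ E) t x| ≤ B := by
  have hQ := momentumBound_nonneg hd.const_pos.le hd.nonneg hT
  obtain ⟨c, hc⟩ := (isCompact_Icc (a := -momentumBound C P₀ T)
    (b := momentumBound C P₀ T)).exists_bound_of_continuousOn ca.continuousOn
  have hc0 : 0 ≤ c := (norm_nonneg _).trans (hc 0 ⟨by linarith, hQ⟩)
  have hM := hd.bound_nonneg
  exact ⟨2 * momentumBound C P₀ T * c * M, by positivity, fun u E hs t ht x =>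
    hs.abs_moment_le hd ca (fun v hv => hc v (abs_le.1 hv)) ht x⟩

theorem exists_riemannDeriv_bound (hd : IsBoundedData M C P₀ f₀ u₁ u₂) (hσ : |σ| = 1)
    (hT : 0 ≤ T) :
    ∃ K, ∀ u E, IsWeakState (momentumRate C P₀) u E → ∀ t ∈ Icc 0 T, ∀ x,
      |riemannDeriv f₀ u₁ u₂ E σ t x| ≤ K := by
  set R := momentumRate C P₀ T
  have hR : 0 ≤ R := momentumRate_nonneg hd.const_pos.le hd.nonneg hT
  obtain ⟨K, hK⟩ := hd.exists_deriv_le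
  obtain ⟨B, -, moment_le⟩ := hd.exists_abs_moment_le (continuous_coneWeight hσ) hT
  obtain ⟨B', hB', moment_deriv_le⟩ := hd.exists_abs_moment_le (continuous_coneWeightDeriv hσ) hT
  refine ⟨K + K + B + B + T * (R * (B' + 1)), fun u E hs t ht x => ?_⟩
  have integral_le : |lineIntegral σ
      (fun s y => E s y * (moment (coneWeightDeriv σ) (transport f₀ E) s y + 1)) t x| ≤
      T * (R * (B' + 1)) := by
    refine abs_lineIntegral_le_mul ht (by positivity) fun s hst => ?_
    have hsT : s ∈ Icc 0 T := ⟨hst.1, hst.2.trans ht.2⟩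
    rw [abs_mul]
    refine mul_le_mul (hs.abs_E_le (monotoneOn_momentumRate hd.const_pos.le hd.nonneg) hsT _) ?_
      (abs_nonneg _) hR
    exact (abs_add_le _ _).trans (by simpa using moment_deriv_le u E hs s hsT _)
  have datum_le : |σ * deriv (deriv u₁) (x + σ * t)| ≤ K := by
    rw [abs_mul, hσ, one_mul]
    exact (hK _).1
  have moment_t_le := moment_le u E hs t ht x
  have moment_zero_le := moment_le u E hs 0 ⟨le_rfl, hT⟩ (x + σ * t)
  unfold riemannDeriv
  refine (abs_sub _ _).trans (add_le_add ((abs_sub _ _).trans (add_le_add ?_ moment_zero_le))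
    integral_le)
  exact (abs_add_three _ _ _).trans (add_le_add (add_le_add (hK _).2 datum_le) moment_t_le)

theorem exists_nextFieldDeriv_bound (hd : IsBoundedData M C P₀ f₀ u₁ u₂) (hT : 0 ≤ T) :
    ∃ K, ∀ u E, IsWeakState (momentumRate C P₀) u E → ∀ t ∈ Icc 0 T, ∀ x,
      |nextFieldDeriv f₀ u₁ u₂ E t x| ≤ K := by
  obtain ⟨K₁, bound₁⟩ := hd.exists_riemannDeriv_bound (σ := 1) (by simp) hT
  obtain ⟨K₂, bound₂⟩ := hd.exists_riemannDeriv_bound (σ := -1) (by simp) hT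
  exact ⟨max K₁ K₂, fun u E hs t ht x => abs_half_sub_le
    ((bound₁ u E hs t ht x).trans (le_max_left _ _))
    ((bound₂ u E hs t ht x).trans (le_max_right _ _))⟩

end IsBoundedData

end Step

/-! ### Regularity of one step of the iteration -/

section StepRegularity

/-- Potential `u`, field `E = ∂ₓ u` and gradient `E' = ∂ₓ E` of an approximate solution. -/
structure IsState (R : ℝ → ℝ) (u E E' : ℝ → ℝ → ℝ) : Prop extends IsWeakState R u E where
  cont_E' : Continuous fun p : ℝ × ℝ => E' p.1 p.2
  deriv_u : ∀ t x, HasDerivAt (u t) (E t x) x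
  deriv_E : ∀ t x, HasDerivAt (E t) (E' t x) x

variable {M C P₀ : ℝ} {f₀ : ℝ × ℝ → ℝ} {u₁ u₂ : ℝ → ℝ} {u E E' : ℝ → ℝ → ℝ} {σ : ℝ}

theorem isLipField_of_abs_deriv_le (cE : Continuous fun p : ℝ × ℝ => E p.1 p.2)
    (hE : ∀ t x, HasDerivAt (E t) (E' t x) x)
    (hb : ∀ T, ∃ K, ∀ t ∈ Icc (-T) T, ∀ x, |E' t x| ≤ K) : IsLipField E := by
  refine ⟨cE, fun T => ?_⟩
  obtain ⟨K, hK⟩ := hb T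
  refine ⟨K.toNNReal, fun t ht => lipschitzWith_of_nnnorm_deriv_le
    (fun x => (hE t x).differentiableAt) fun x => ?_⟩
  rw [(hE t x).deriv, ← norm_toNNReal]
  exact Real.toNNReal_le_toNNReal (hK t ht x)

theorem IsWeakState.hasDerivAt_nextPotential_left (hs : IsWeakState (momentumRate C P₀) u E)
    (hd : IsBoundedData M C P₀ f₀ u₁ u₂) (t x : ℝ) :
    HasDerivAt (fun s => nextPotential f₀ u₁ u₂ u E s x) (nextRate f₀ u₁ u₂ u E t x) t := by
  have c := hs.continuous_nextRate_left hd x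
  exact (intervalIntegral.integral_hasDerivAt_right (c.intervalIntegrable 0 t)
    (c.stronglyMeasurableAtFilter _ _) c.continuousAt).const_add (u₁ x)

namespace IsState

theorem exists_deriv_waveSource (hs : IsState (momentumRate C P₀) u E E')
    (hd : IsBoundedData M C P₀ f₀ u₁ u₂) :
    ∃ g' : ℝ → ℝ → ℝ, (Continuous fun p : ℝ × ℝ => g' p.1 p.2) ∧
      (∀ t x, HasDerivAt (waveSource f₀ u E t) (g' t x) x) ∧
      ∀ σ, |σ| = 1 → ∀ t x, lineIntegral σ g' t x =
        moment (coneWeight σ) (transport f₀ E) t x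
        - moment (coneWeight σ) (transport f₀ E) 0 (x + σ * t)
        - lineIntegral σ
            (fun s y => E s y * (moment (coneWeightDeriv σ) (transport f₀ E) s y + 1)) t x := by
  obtain ⟨fx, fv, cfx, cfv, hx, hv, ht, -⟩ :=
    hs.lip.exists_transport_deriv hs.deriv_E hs.cont_E' hd.contDiff_f
  have hb := hs.hasBddVelocitySupport hd
  have cf := hs.continuous_transport hd
  have cE := hs.lip.continuous
  have c_moment : Continuous fun p : ℝ × ℝ => moment (fun _ => 1) fx p.1 p.2 :=
    (hb.deriv_right hx).continuous_moment cfx continuous_const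
  refine ⟨fun t x => -moment (fun _ => 1) fx t x - E t x, c_moment.neg.sub cE, fun t x =>
    (hb.hasDerivAt_moment_right cf cfx continuous_const hx t x).neg.sub (hs.deriv_u t x),
    fun σ hσ t x => ?_⟩
  have c_mul : Continuous fun p : ℝ × ℝ =>
      E p.1 p.2 * moment (coneWeightDeriv σ) (transport f₀ E) p.1 p.2 :=
    cE.mul (hs.continuous_moment hd (continuous_coneWeightDeriv hσ))
  simp only [mul_add, mul_one]
  rw [lineIntegral_sub (g := fun t x => -moment (fun _ => 1) fx t x) σ t x c_moment.neg cE,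
    lineIntegral_neg, hb.lineIntegral_moment_deriv cE cf cfx cfv hx hv ht hσ,
    lineIntegral_add (g := fun s y => E s y * moment (coneWeightDeriv σ) (transport f₀ E) s y)
      σ t x c_mul cE]
  ring

theorem hasDerivAt_riemann_right (hs : IsState (momentumRate C P₀) u E E')
    (hd : IsBoundedData M C P₀ f₀ u₁ u₂) (hσ : |σ| = 1) (t x : ℝ) :
    HasDerivAt (riemann f₀ u₁ u₂ u E σ t) (riemannDeriv f₀ u₁ u₂ E σ t x) x := by
  obtain ⟨g', cg', hg', lineIntegral_eq⟩ := hs.exists_deriv_waveSource hd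
  have source := hasDerivAt_lineIntegral_right σ (hs.continuous_waveSource hd) cg' hg' t x
  have rate := (hd.hasDerivAt_u₂ (x + σ * t)).comp_add_const x (σ * t)
  have gradient := ((hd.hasDerivAt_deriv_u₁ (x + σ * t)).comp_add_const x (σ * t)).const_mul σ
  refine ((rate.add gradient).add source).congr_deriv ?_
  rw [lineIntegral_eq σ hσ, riemannDeriv]
  ring

theorem hasDerivAt_riemann_left (hs : IsState (momentumRate C P₀) u E E')
    (hd : IsBoundedData M C P₀ f₀ u₁ u₂) (hσ : |σ| = 1) (t x : ℝ) :
    HasDerivAt (fun s => riemann f₀ u₁ u₂ u E σ s x)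
      (σ * riemannDeriv f₀ u₁ u₂ E σ t x + waveSource f₀ u E t x) t := by
  obtain ⟨g', cg', hg', lineIntegral_eq⟩ := hs.exists_deriv_waveSource hd
  have source := hasDerivAt_lineIntegral_left σ (hs.continuous_waveSource hd) cg' hg' t x
  have line : HasDerivAt (fun s : ℝ => x + σ * s) σ t := by
    simpa using ((hasDerivAt_id t).const_mul σ).const_add x
  have rate := (hd.hasDerivAt_u₂ (x + σ * t)).comp t line
  have gradient := ((hd.hasDerivAt_deriv_u₁ (x + σ * t)).comp t line).const_mul σ
  refine ((rate.add gradient).add source).congr_deriv ?_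
  rw [lineIntegral_eq σ hσ, riemannDeriv]
  ring

theorem hasDerivAt_nextField_right (hs : IsState (momentumRate C P₀) u E E')
    (hd : IsBoundedData M C P₀ f₀ u₁ u₂) (t x : ℝ) :
    HasDerivAt (nextField f₀ u₁ u₂ u E t) (nextFieldDeriv f₀ u₁ u₂ E t x) x :=
  ((hs.hasDerivAt_riemann_right hd (by simp) t x).sub
    (hs.hasDerivAt_riemann_right hd (by simp) t x)).div_const 2

theorem hasDerivAt_nextRate_right (hs : IsState (momentumRate C P₀) u E E')
    (hd : IsBoundedData M C P₀ f₀ u₁ u₂) (t x : ℝ) :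
    HasDerivAt (nextRate f₀ u₁ u₂ u E t) (nextRateDeriv f₀ u₁ u₂ E t x) x :=
  ((hs.hasDerivAt_riemann_right hd (by simp) t x).add
    (hs.hasDerivAt_riemann_right hd (by simp) t x)).div_const 2

theorem hasDerivAt_nextField_left (hs : IsState (momentumRate C P₀) u E E')
    (hd : IsBoundedData M C P₀ f₀ u₁ u₂) (t x : ℝ) :
    HasDerivAt (fun s => nextField f₀ u₁ u₂ u E s x) (nextRateDeriv f₀ u₁ u₂ E t x) t := by
  refine (((hs.hasDerivAt_riemann_left hd (σ := 1) (by simp) t x).sub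
    (hs.hasDerivAt_riemann_left hd (σ := -1) (by simp) t x)).div_const 2).congr_deriv ?_
  rw [nextRateDeriv]
  ring

theorem hasDerivAt_nextRate_left (hs : IsState (momentumRate C P₀) u E E')
    (hd : IsBoundedData M C P₀ f₀ u₁ u₂) (t x : ℝ) :
    HasDerivAt (fun s => nextRate f₀ u₁ u₂ u E s x)
      (nextFieldDeriv f₀ u₁ u₂ E t x + waveSource f₀ u E t x) t := by
  refine (((hs.hasDerivAt_riemann_left hd (σ := 1) (by simp) t x).add
    (hs.hasDerivAt_riemann_left hd (σ := -1) (by simp) t x)).div_const 2).congr_deriv ?_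
  rw [nextFieldDeriv]
  ring

theorem hasDerivAt_nextPotential_right (hs : IsState (momentumRate C P₀) u E E')
    (hd : IsBoundedData M C P₀ f₀ u₁ u₂) (t x : ℝ) :
    HasDerivAt (nextPotential f₀ u₁ u₂ u E t) (nextField f₀ u₁ u₂ u E t x) x := by
  have c_rateDeriv := hs.continuous_nextRateDeriv hd
  have integral := hasDerivAt_intervalIntegral (F := fun x s => nextRate f₀ u₁ u₂ u E s x)
    (F' := fun x s => nextRateDeriv f₀ u₁ u₂ E s x) 0 t
    (fun x s => hs.hasDerivAt_nextRate_right hd s x) (hs.continuous_nextRate_left hd)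
    (c_rateDeriv.comp continuous_swap) x
  have ftc : ∫ s in (0 : ℝ)..t, nextRateDeriv f₀ u₁ u₂ E s x =
      nextField f₀ u₁ u₂ u E t x - nextField f₀ u₁ u₂ u E 0 x :=
    intervalIntegral.integral_eq_sub_of_hasDerivAt (fun s _ => hs.hasDerivAt_nextField_left hd s x)
      ((c_rateDeriv.comp (Continuous.prodMk_left x)).intervalIntegrable _ _)
  have initial : nextField f₀ u₁ u₂ u E 0 x = deriv u₁ x := by
    simp only [nextField, riemann, lineIntegral, mul_zero, add_zero,
      intervalIntegral.integral_same]
    ring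
  refine ((hd.hasDerivAt_u₁ x).add integral).congr_deriv ?_
  rw [ftc, initial, add_sub_cancel]

theorem next (hs : IsState (momentumRate C P₀) u E E') (hd : IsBoundedData M C P₀ f₀ u₁ u₂) :
    IsState (momentumRate C P₀) (clampTime (nextPotential f₀ u₁ u₂ u E))
      (clampTime (nextField f₀ u₁ u₂ u E)) (clampTime (nextFieldDeriv f₀ u₁ u₂ E)) where
  cont_u := continuous_clampTime (hs.continuous_nextPotential hd)
  lip := by
    refine isLipField_of_abs_deriv_le (continuous_clampTime (hs.continuous_nextField hd))
      (fun t x => hs.hasDerivAt_nextField_right hd (max t 0) x) fun T => ?_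
    obtain ⟨K, hK⟩ := hd.exists_nextFieldDeriv_bound (le_max_right T 0)
    exact ⟨K, fun t ht x => hK u E hs.toIsWeakState (max t 0)
      ⟨le_max_right _ _, max_le_max ht.2 le_rfl⟩ x⟩
  bound_u _ x := hs.abs_nextPotential_le hd (le_max_right _ _) x
  bound_E _ x := hs.abs_nextField_le hd (le_max_right _ _) x
  cont_E' := continuous_clampTime (hs.continuous_nextFieldDeriv hd)
  deriv_u _ x := hs.hasDerivAt_nextPotential_right hd _ x
  deriv_E _ x := hs.hasDerivAt_nextField_right hd _ x

end IsState

end StepRegularity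

/-! ### Contraction -/

section Contraction

open scoped NNReal

/-- On the times `[0, T]`, the functions `g` and `h` have distance at most `D` in the supremum norm
with weight `exp (-l * t)`, for which the iteration is a contraction when `l` is large. -/
def ExpClose (T l D : ℝ) (g h : ℝ → ℝ → ℝ) : Prop :=
  ∀ t ∈ Icc 0 T, ∀ x, |g t x - h t x| ≤ D * Real.exp (l * t)

variable {M C P₀ : ℝ} {f₀ : ℝ × ℝ → ℝ} {u₁ u₂ : ℝ → ℝ} {g h : ℝ → ℝ → ℝ}
  {σ T l D : ℝ}

theorem integral_mul_exp_le {c l t : ℝ} (hc : 0 ≤ c) (hl : 0 < l) :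
    ∫ s in (0 : ℝ)..t, c * Real.exp (l * s) ≤ c / l * Real.exp (l * t) := by
  have antideriv (s : ℝ) :
      HasDerivAt (fun s => c / l * Real.exp (l * s)) (c * Real.exp (l * s)) s := by
    refine ((((hasDerivAt_id s).const_mul l).exp).const_mul (c / l)).congr_deriv ?_
    simp only [id]
    field_simp
  rw [intervalIntegral.integral_eq_sub_of_hasDerivAt (fun s _ => antideriv s)
    (by apply Continuous.intervalIntegrable; fun_prop)]
  exact sub_le_self _ (by positivity)

namespace ExpClose

theorem of_abs_sub_le (hD : 0 ≤ D) (hl : 0 ≤ l) (H : ∀ t ∈ Icc 0 T, ∀ x, |g t x - h t x| ≤ D) :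
    ExpClose T l D g h := fun t ht x =>
  (H t ht x).trans (le_mul_of_one_le_right hD (Real.one_le_exp (mul_nonneg hl ht.1)))

theorem clampTime (H : ExpClose T l D g h) : ExpClose T l D (clampTime g) (clampTime h) :=
  fun t ht x => by simpa only [clampTime_of_nonneg ht.1] using H t ht x

theorem abs_clampTime_sub_le (H : ExpClose T l D g h) (hT : 0 ≤ T) (hD : 0 ≤ D) (hl : 0 ≤ l)
    {t : ℝ} (ht : t ≤ T) (x : ℝ) :
    |_root_.clampTime g t x - _root_.clampTime h t x| ≤ D * Real.exp (l * T) := by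
  have ht' : max t 0 ≤ T := max_le ht hT
  exact (H (max t 0) ⟨le_max_right _ _, ht'⟩ x).trans (by gcongr)

theorem lineIntegral (H : ExpClose T l D g h) (hD : 0 ≤ D) (hl : 0 < l)
    (cg : Continuous fun p : ℝ × ℝ => g p.1 p.2) (ch : Continuous fun p : ℝ × ℝ => h p.1 p.2) :
    ExpClose T l (D / l) (lineIntegral σ g) (lineIntegral σ h) := fun t ht x => by
  rw [← lineIntegral_sub σ t x cg ch]
  exact (abs_lineIntegral_le ht.1 (by fun_prop) fun s hs => H s ⟨hs.1, hs.2.trans ht.2⟩ _).trans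
    (integral_mul_exp_le hD hl)

theorem integral (H : ExpClose T l D g h) (hD : 0 ≤ D) (hl : 0 < l)
    (cg : ∀ x, Continuous fun s => g s x) (ch : ∀ x, Continuous fun s => h s x) :
    ExpClose T l (D / l) (fun t x => ∫ s in (0 : ℝ)..t, g s x)
      (fun t x => ∫ s in (0 : ℝ)..t, h s x) := fun t ht x => by
  rw [← intervalIntegral.integral_sub ((cg x).intervalIntegrable _ _)
    ((ch x).intervalIntegrable _ _)]
  exact (abs_intervalIntegral_le ht.1 (by fun_prop) fun s hs => H s ⟨hs.1, hs.2.trans ht.2⟩ x).trans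
    (integral_mul_exp_le hD hl)

end ExpClose

theorem abs_mul_sub_mul_le (a b c d : ℝ) :
    |a * b - c * d| ≤ |a| * |b - d| + |a - c| * |d| := by
  rw [← abs_mul, ← abs_mul]
  exact (congrArg abs (by ring)).trans_le (abs_add_le (a * (b - d)) ((a - c) * d))

namespace IsBoundedData

theorem exists_abs_moment_sub_le (hd : IsBoundedData M C P₀ f₀ u₁ u₂) {a : ℝ → ℝ}
    (ca : Continuous a) (hT : 0 ≤ T) (L : ℝ≥0) :
    ∃ k, 0 ≤ k ∧ ∀ u E u' F, IsWeakState (momentumRate C P₀) u E →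
      IsWeakState (momentumRate C P₀) u' F → (∀ s ∈ Icc 0 T, LipschitzWith L (E s)) →
      ∀ t ∈ Icc 0 T, ∀ ε, 0 ≤ ε → (∀ s ∈ Icc 0 t, ∀ y, |E s y - F s y| ≤ ε) → ∀ x,
        |moment a (transport f₀ E) t x - moment a (transport f₀ F) t x| ≤ k * ε := by
  obtain ⟨Λ, hf₀⟩ := hd.exists_lipschitzWith
  set Q := momentumBound C P₀ T
  have hQ : 0 ≤ Q := momentumBound_nonneg hd.const_pos.le hd.nonneg hT
  obtain ⟨c, hc⟩ := (isCompact_Icc (a := -Q) (b := Q)).exists_bound_of_continuousOn ca.continuousOn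
  have hc0 : 0 ≤ c := (norm_nonneg _).trans (hc 0 ⟨by linarith, hQ⟩)
  refine ⟨2 * Q * c * (Λ * (T * Real.exp ((1 + L) * T))), by positivity,
    fun u E u' F hs hs' hlip t ht ε hε hdiff x => ?_⟩
  have slice : Continuous fun v : ℝ => (t, x, v) := by fun_prop
  have transport_sub_le (v : ℝ) : |transport f₀ E t x v - transport f₀ F t x v| ≤
      Λ * (ε * T * Real.exp ((1 + L) * T)) := by
    refine ((hs.lip.isTransported f₀ t x v).abs_sub_le (hs'.lip.isTransported f₀ t x v) ht.1 hf₀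
      L.coe_nonneg hε (fun s hst y y' _ _ => (hlip s ⟨hst.1, hst.2.trans ht.2⟩).dist_le_mul y y')
      fun s hst y _ => hdiff s hst y).trans ?_
    obtain ⟨_, htT⟩ := ht
    gcongr
  refine (_root_.abs_moment_sub_le hQ (fun v => hs.transport_eq_zero hd ht x)
    (fun v => hs'.transport_eq_zero hd ht x) ((hs.continuous_transport hd).comp slice)
    ((hs'.continuous_transport hd).comp slice) ca (fun v hv => hc v (abs_le.1 hv))
    transport_sub_le).trans_eq ?_
  ring

theorem exists_expClose_waveSource (hd : IsBoundedData M C P₀ f₀ u₁ u₂) (hT : 0 ≤ T) (L : ℝ≥0) :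
    ∃ k, 1 ≤ k ∧ ∀ u E u' F, IsWeakState (momentumRate C P₀) u E →
      IsWeakState (momentumRate C P₀) u' F → (∀ s ∈ Icc 0 T, LipschitzWith L (E s)) →
      ∀ l D, 0 ≤ l → 0 ≤ D → ExpClose T l D u u' → ExpClose T l D E F →
        ExpClose T l (k * D) (waveSource f₀ u E) (waveSource f₀ u' F) := by
  obtain ⟨k, hk, moment_sub_le⟩ :=
    hd.exists_abs_moment_sub_le (a := fun _ => 1) continuous_const hT L
  refine ⟨k + 1, by linarith, fun u E u' F hs hs' hlip l D hl hD hu hE t ht x => ?_⟩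
  have density_sub_le := moment_sub_le u E u' F hs hs' hlip t ht (D * Real.exp (l * t))
    (by positivity) (fun s hst y => (hE s ⟨hst.1, hst.2.trans ht.2⟩ y).trans
      (by have := hst.2; gcongr)) x
  calc |waveSource f₀ u E t x - waveSource f₀ u' F t x|
      = |(moment (fun _ => 1) (transport f₀ E) t x - moment (fun _ => 1) (transport f₀ F) t x) +
          (u t x - u' t x)| := by
        rw [← abs_neg, waveSource, waveSource]
        ring_nf
    _ ≤ k * (D * Real.exp (l * t)) + D * Real.exp (l * t) :=
        (abs_add_le _ _).trans (add_le_add density_sub_le (hu t ht x))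
    _ = (k + 1) * D * Real.exp (l * t) := by ring

theorem exists_contraction (hd : IsBoundedData M C P₀ f₀ u₁ u₂) (hT : 0 ≤ T) (L : ℝ≥0) :
    ∃ l, 0 < l ∧ ∀ u E u' F, IsWeakState (momentumRate C P₀) u E →
      IsWeakState (momentumRate C P₀) u' F → (∀ s ∈ Icc 0 T, LipschitzWith L (E s)) →
      ∀ D, 0 ≤ D → ExpClose T l D u u' → ExpClose T l D E F →
        ExpClose T l (D / 2) (nextPotential f₀ u₁ u₂ u E) (nextPotential f₀ u₁ u₂ u' F) ∧
        ExpClose T l (D / 2) (nextField f₀ u₁ u₂ u E) (nextField f₀ u₁ u₂ u' F) := by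
  obtain ⟨k, hk, source_close⟩ := hd.exists_expClose_waveSource hT L
  refine ⟨2 * k, by linarith, fun u E u' F hs hs' hlip D hD hu hE => ?_⟩
  have riemann_close (σ : ℝ) : ExpClose T (2 * k) (D / 2) (riemann f₀ u₁ u₂ u E σ)
      (riemann f₀ u₁ u₂ u' F σ) := fun t ht x => by
    have := (source_close u E u' F hs hs' hlip (2 * k) D (by positivity) hD hu hE).lineIntegral
      (σ := σ) (by positivity) (by positivity) (hs.continuous_waveSource hd)
      (hs'.continuous_waveSource hd) t ht x
    rw [riemann, riemann, add_sub_add_left_eq_sub]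
    exact this.trans_eq (by field_simp)
  have rate_close : ExpClose T (2 * k) (D / 2) (nextRate f₀ u₁ u₂ u E)
      (nextRate f₀ u₁ u₂ u' F) := fun t ht x => by
    rw [nextRate, nextRate, ← sub_div, add_sub_add_comm]
    exact abs_half_add_le (riemann_close 1 t ht x) (riemann_close (-1) t ht x)
  refine ⟨fun t ht x => ?_, fun t ht x => ?_⟩
  · have integral_close := rate_close.integral (by positivity) (by positivity)
      (hs.continuous_nextRate_left hd) (hs'.continuous_nextRate_left hd) t ht x
    rw [nextPotential, nextPotential, add_sub_add_left_eq_sub]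
    refine integral_close.trans (mul_le_mul_of_nonneg_right ?_ (Real.exp_pos _).le)
    exact div_le_self (by positivity) (by linarith)
  · rw [nextField, nextField, ← sub_div, sub_sub_sub_comm]
    exact abs_half_sub_le (riemann_close 1 t ht x) (riemann_close (-1) t ht x)

theorem exists_riemannDeriv_sub_le (hd : IsBoundedData M C P₀ f₀ u₁ u₂) (hσ : |σ| = 1)
    (hT : 0 ≤ T) (L : ℝ≥0) :
    ∃ k, ∀ u E u' F, IsWeakState (momentumRate C P₀) u E →
      IsWeakState (momentumRate C P₀) u' F → (∀ s ∈ Icc 0 T, LipschitzWith L (E s)) →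
      ∀ ε, 0 ≤ ε → (∀ s ∈ Icc 0 T, ∀ y, |E s y - F s y| ≤ ε) → ∀ t ∈ Icc 0 T, ∀ x,
        |riemannDeriv f₀ u₁ u₂ E σ t x - riemannDeriv f₀ u₁ u₂ F σ t x| ≤ k * ε := by
  have c_weight := continuous_coneWeight hσ
  have c_weightDeriv := continuous_coneWeightDeriv hσ
  set R := momentumRate C P₀ T
  have hR : 0 ≤ R := momentumRate_nonneg hd.const_pos.le hd.nonneg hT
  obtain ⟨B, hB, moment_le⟩ := hd.exists_abs_moment_le c_weightDeriv hT
  obtain ⟨k, -, weight_sub_le⟩ := hd.exists_abs_moment_sub_le c_weight hT L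
  obtain ⟨k', hk', weightDeriv_sub_le⟩ := hd.exists_abs_moment_sub_le c_weightDeriv hT L
  refine ⟨k + k + T * (R * k' + (B + 1)), fun u E u' F hs hs' hlip ε hε hdiff t ht x => ?_⟩
  set m := moment (coneWeightDeriv σ) (transport f₀ E)
  set m' := moment (coneWeightDeriv σ) (transport f₀ F)
  have close {s : ℝ} (hs : s ∈ Icc 0 T) : ∀ r ∈ Icc 0 s, ∀ y, |E r y - F r y| ≤ ε :=
    fun r hr => hdiff r ⟨hr.1, hr.2.trans hs.2⟩
  have integral_sub_le : |lineIntegral σ (fun s y => E s y * (m s y + 1)) t x -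
      lineIntegral σ (fun s y => F s y * (m' s y + 1)) t x| ≤
      T * ((R * k' + (B + 1)) * ε) := by
    rw [← lineIntegral_sub σ t x (hs.continuous_mul_moment_add_one hd c_weightDeriv)
      (hs'.continuous_mul_moment_add_one hd c_weightDeriv)]
    refine abs_lineIntegral_le_mul ht (by positivity) fun s hst => ?_
    have hsT : s ∈ Icc 0 T := ⟨hst.1, hst.2.trans ht.2⟩
    set y := x + σ * (t - s)
    have field_le := hs.abs_E_le (monotoneOn_momentumRate hd.const_pos.le hd.nonneg) hsT y
    have moment_sub_le := weightDeriv_sub_le u E u' F hs hs' hlip s hsT ε hε (close hsT) y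
    have moment_add_one_le : |m' s y + 1| ≤ B + 1 :=
      (abs_add_le _ _).trans (by simpa using moment_le u' F hs' s hsT y)
    calc |E s y * (m s y + 1) - F s y * (m' s y + 1)|
        ≤ |E s y| * |m s y + 1 - (m' s y + 1)| + |E s y - F s y| * |m' s y + 1| :=
          abs_mul_sub_mul_le _ _ _ _
      _ ≤ R * (k' * ε) + ε * (B + 1) := by
          rw [add_sub_add_right_eq_sub]
          gcongr
          exact hdiff s hsT y
      _ = (R * k' + (B + 1)) * ε := by ring
  have moment_t_sub_le := weight_sub_le u E u' F hs hs' hlip t ht ε hε (close ht) x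
  have moment_zero_sub_le := weight_sub_le u E u' F hs hs' hlip 0 ⟨le_rfl, hT⟩ ε hε
    (close ⟨le_rfl, hT⟩) (x + σ * t)
  rw [abs_le] at *
  rw [riemannDeriv, riemannDeriv]
  constructor <;> linarith

theorem exists_nextFieldDeriv_sub_le (hd : IsBoundedData M C P₀ f₀ u₁ u₂) (hT : 0 ≤ T) (L : ℝ≥0) :
    ∃ k, ∀ u E u' F, IsWeakState (momentumRate C P₀) u E →
      IsWeakState (momentumRate C P₀) u' F → (∀ s ∈ Icc 0 T, LipschitzWith L (E s)) →
      ∀ ε, 0 ≤ ε → (∀ s ∈ Icc 0 T, ∀ y, |E s y - F s y| ≤ ε) → ∀ t ∈ Icc 0 T, ∀ x,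
        |nextFieldDeriv f₀ u₁ u₂ E t x - nextFieldDeriv f₀ u₁ u₂ F t x| ≤ k * ε := by
  obtain ⟨k₁, h₁⟩ := hd.exists_riemannDeriv_sub_le (σ := 1) (by simp) hT L
  obtain ⟨k₂, h₂⟩ := hd.exists_riemannDeriv_sub_le (σ := -1) (by simp) hT L
  refine ⟨max k₁ k₂, fun u E u' F hs hs' hlip ε hε hdiff t ht x => ?_⟩
  rw [nextFieldDeriv, nextFieldDeriv, ← sub_div, sub_sub_sub_comm]
  refine abs_half_sub_le ((h₁ u E u' F hs hs' hlip ε hε hdiff t ht x).trans ?_)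
    ((h₂ u E u' F hs hs' hlip ε hε hdiff t ht x).trans ?_)
  · exact mul_le_mul_of_nonneg_right (le_max_left _ _) hε
  · exact mul_le_mul_of_nonneg_right (le_max_right _ _) hε

end IsBoundedData

end Contraction

/-! ### The fixed point of the iteration -/

section GeometricLimit

open Filter Topology

/-- The sequence `h` converges to `g` at least as fast as `(1 / 2) ^ n`, uniformly in space and on
times bounded above. -/
def IsGeometricLimit (h : ℕ → ℝ → ℝ → ℝ) (g : ℝ → ℝ → ℝ) : Prop :=
  ∀ T, ∃ c, 0 ≤ c ∧ ∀ n, ∀ t ≤ T, ∀ x, |h n t x - g t x| ≤ c / 2 ^ n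

variable {h : ℕ → ℝ → ℝ → ℝ} {g : ℝ → ℝ → ℝ}

theorem tendsto_div_two_pow (c : ℝ) : Tendsto (fun n : ℕ => c / 2 ^ n) atTop (𝓝 0) := by
  simpa [div_eq_mul_inv] using (tendsto_pow_atTop_nhds_zero_of_lt_one (r := (1 / 2 : ℝ))
    (by norm_num) (by norm_num)).const_mul c

theorem tendsto_of_abs_sub_le_div_two_pow {a : ℕ → ℝ} {b c : ℝ}
    (H : ∀ n, |a n - b| ≤ c / 2 ^ n) : Tendsto a atTop (𝓝 b) :=
  tendsto_iff_dist_tendsto_zero.2 (squeeze_zero (fun _ => dist_nonneg) H (tendsto_div_two_pow c))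

theorem tendstoUniformly_of_abs_sub_le_div_two_pow {a : ℕ → ℝ → ℝ} {b : ℝ → ℝ} {c : ℝ}
    (H : ∀ n x, |a n x - b x| ≤ c / 2 ^ n) : TendstoUniformly a b atTop := by
  rw [Metric.tendstoUniformly_iff]
  intro ε hε
  filter_upwards [(tendsto_div_two_pow c).eventually_lt_const hε] with n hn x
  rw [dist_comm]
  exact (H n x).trans_lt hn

theorem exists_isGeometricLimit
    (H : ∀ T, ∃ c, ∀ n, ∀ t ≤ T, ∀ x, |h n t x - h (n + 1) t x| ≤ c / 2 / 2 ^ n) :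
    ∃ g, IsGeometricLimit h g := by
  have exists_lim (t x : ℝ) : ∃ a, Tendsto (fun n => h n t x) atTop (𝓝 a) := by
    obtain ⟨c, hc⟩ := H t
    exact cauchySeq_tendsto_of_complete
      (cauchySeq_of_le_geometric_two (C := c) fun n => hc n t le_rfl x)
  choose g hg using exists_lim
  refine ⟨g, fun T => ?_⟩
  obtain ⟨c, hc⟩ := H T
  have sub_le (n : ℕ) (t : ℝ) (ht : t ≤ T) (x : ℝ) : |h n t x - g t x| ≤ c / 2 ^ n :=
    dist_le_of_le_geometric_two_of_tendsto (fun n => hc n t ht x) (hg t x) n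
  exact ⟨c, by simpa using (abs_nonneg _).trans (sub_le 0 T le_rfl 0), sub_le⟩

namespace IsGeometricLimit

theorem tendsto (H : IsGeometricLimit h g) (t x : ℝ) :
    Tendsto (fun n => h n t x) atTop (𝓝 (g t x)) := by
  obtain ⟨c, -, hc⟩ := H t
  exact tendsto_of_abs_sub_le_div_two_pow fun n => hc n t le_rfl x

theorem tendstoUniformly (H : IsGeometricLimit h g) (t : ℝ) :
    TendstoUniformly (fun n => h n t) (g t) atTop := by
  obtain ⟨c, -, hc⟩ := H t
  exact tendstoUniformly_of_abs_sub_le_div_two_pow fun n => hc n t le_rfl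

theorem continuous (H : IsGeometricLimit h g) (ch : ∀ n, Continuous fun p : ℝ × ℝ => h n p.1 p.2) :
    Continuous fun p : ℝ × ℝ => g p.1 p.2 := by
  refine continuous_of_locally_uniform_approx_of_continuousAt fun p U hU => ?_
  obtain ⟨ε, hε, hεU⟩ := Metric.mem_uniformity_dist.1 hU
  obtain ⟨c, -, hc⟩ := H (p.1 + 1)
  obtain ⟨n, hn⟩ := ((tendsto_div_two_pow c).eventually_lt_const hε).exists
  refine ⟨{q | q.1 < p.1 + 1}, (continuous_fst.isOpen_preimage _ isOpen_Iio).mem_nhds (by simp),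
    fun q => h n q.1 q.2, (ch n).continuousAt, fun q hq => hεU ?_⟩
  rw [dist_comm]
  exact (hc n q.1 (le_of_lt hq) q.2).trans_lt hn

end IsGeometricLimit

end GeometricLimit

section Iteration

open Filter
open scoped NNReal

variable {M C P₀ : ℝ} {f₀ : ℝ × ℝ → ℝ} {u₁ u₂ : ℝ → ℝ} {u E : ℝ → ℝ → ℝ}

/-- The Picard iteration for the pair of the potential and the field. -/
noncomputable def picardSeq (f₀ : ℝ × ℝ → ℝ) (u₁ u₂ : ℝ → ℝ) :
    ℕ → (ℝ → ℝ → ℝ) × (ℝ → ℝ → ℝ)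
  | 0 => (fun _ _ => 0, fun _ _ => 0)
  | n + 1 =>
    let p := picardSeq f₀ u₁ u₂ n
    (clampTime (nextPotential f₀ u₁ u₂ p.1 p.2), clampTime (nextField f₀ u₁ u₂ p.1 p.2))

theorem clampTime_picardSeq (f₀ : ℝ × ℝ → ℝ) (u₁ u₂ : ℝ → ℝ) (n : ℕ) :
    clampTime (picardSeq f₀ u₁ u₂ n).1 = (picardSeq f₀ u₁ u₂ n).1 ∧
      clampTime (picardSeq f₀ u₁ u₂ n).2 = (picardSeq f₀ u₁ u₂ n).2 := by
  constructor <;> funext t x <;> cases n <;> simp [picardSeq, clampTime]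

namespace IsBoundedData

theorem exists_isState_picardSeq (hd : IsBoundedData M C P₀ f₀ u₁ u₂) (n : ℕ) :
    ∃ E', IsState (momentumRate C P₀) (picardSeq f₀ u₁ u₂ n).1 (picardSeq f₀ u₁ u₂ n).2 E' := by
  induction n with
  | zero =>
    have zero_le (t _x : ℝ) : |(0 : ℝ)| ≤ momentumRate C P₀ (max t 0) := by
      rw [abs_zero]
      exact momentumRate_nonneg hd.const_pos.le hd.nonneg (le_max_right _ _)
    have zero_lip : IsLipField fun _ _ : ℝ => (0 : ℝ) :=
      ⟨continuous_const, fun _ => ⟨0, fun _ _ => LipschitzWith.const 0⟩⟩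
    exact ⟨fun _ _ => 0, ⟨continuous_const, zero_lip, zero_le, zero_le⟩, continuous_const,
      fun _ x => hasDerivAt_const x 0, fun _ x => hasDerivAt_const x 0⟩
  | succ n ih =>
    obtain ⟨E', hs⟩ := ih
    exact ⟨_, hs.next hd⟩

theorem isWeakState_picardSeq (hd : IsBoundedData M C P₀ f₀ u₁ u₂) (n : ℕ) :
    IsWeakState (momentumRate C P₀) (picardSeq f₀ u₁ u₂ n).1 (picardSeq f₀ u₁ u₂ n).2 :=
  let ⟨_, hs⟩ := hd.exists_isState_picardSeq n
  hs.toIsWeakState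

theorem hasDerivAt_picardSeq_succ (hd : IsBoundedData M C P₀ f₀ u₁ u₂) (n : ℕ) (t x : ℝ) :
    HasDerivAt ((picardSeq f₀ u₁ u₂ (n + 1)).2 t)
      (clampTime (nextFieldDeriv f₀ u₁ u₂ (picardSeq f₀ u₁ u₂ n).2) t x) x :=
  let ⟨_, hs⟩ := hd.exists_isState_picardSeq n
  hs.hasDerivAt_nextField_right hd (max t 0) x

theorem exists_lipschitzWith_picardSeq (hd : IsBoundedData M C P₀ f₀ u₁ u₂) (T : ℝ) :
    ∃ L : ℝ≥0, ∀ n, ∀ t ≤ T, LipschitzWith L ((picardSeq f₀ u₁ u₂ n).2 t) := by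
  obtain ⟨K, hK⟩ := hd.exists_nextFieldDeriv_bound (le_max_right T 0)
  refine ⟨K.toNNReal, fun n t ht => ?_⟩
  cases n with
  | zero => exact LipschitzWith.const' 0
  | succ n =>
    have deriv_eq := hd.hasDerivAt_picardSeq_succ n t
    refine lipschitzWith_of_nnnorm_deriv_le (fun x => (deriv_eq x).differentiableAt) fun x => ?_
    rw [(deriv_eq x).deriv, ← norm_toNNReal]
    exact Real.toNNReal_le_toNNReal (hK _ _ (hd.isWeakState_picardSeq n) (max t 0)
      ⟨le_max_right _ _, max_le_max ht le_rfl⟩ x)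

theorem exists_expClose_picardSeq_succ (hd : IsBoundedData M C P₀ f₀ u₁ u₂) {T : ℝ}
    (hT : 0 ≤ T) :
    ∃ l D, 0 ≤ l ∧ 0 ≤ D ∧ ∀ n,
      ExpClose T l (D / 2 ^ n) (picardSeq f₀ u₁ u₂ n).1 (picardSeq f₀ u₁ u₂ (n + 1)).1 ∧
      ExpClose T l (D / 2 ^ n) (picardSeq f₀ u₁ u₂ n).2 (picardSeq f₀ u₁ u₂ (n + 1)).2 := by
  obtain ⟨L, hlip⟩ := hd.exists_lipschitzWith_picardSeq T
  obtain ⟨l, hl, contraction⟩ := hd.exists_contraction hT L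
  have hR := monotoneOn_momentumRate hd.const_pos.le hd.nonneg
  have hD := momentumRate_nonneg hd.const_pos.le hd.nonneg hT
  refine ⟨l, momentumRate C P₀ T, hl.le, hD, fun n => ?_⟩
  induction n with
  | zero =>
    have first := hd.isWeakState_picardSeq 1
    rw [pow_zero, div_one]
    refine ⟨.of_abs_sub_le hD hl.le fun t ht x => ?_, .of_abs_sub_le hD hl.le fun t ht x => ?_⟩
    · refine le_trans ?_ (hR ht.1 hT ht.2)
      simpa [picardSeq, max_eq_left ht.1] using first.bound_u t x
    · simpa [picardSeq] using first.abs_E_le hR ht x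
  | succ n ih =>
    have next := contraction _ _ _ _ (hd.isWeakState_picardSeq n)
      (hd.isWeakState_picardSeq (n + 1)) (fun s hs => hlip n s hs.2) _ (by positivity) ih.1 ih.2
    rw [pow_succ, ← div_div]
    exact ⟨next.1.clampTime, next.2.clampTime⟩

theorem exists_isGeometricLimit_picardSeq (hd : IsBoundedData M C P₀ f₀ u₁ u₂) :
    ∃ u E, IsGeometricLimit (fun n => (picardSeq f₀ u₁ u₂ n).1) u ∧
      IsGeometricLimit (fun n => (picardSeq f₀ u₁ u₂ n).2) E := by
  have sub_le (T : ℝ) : ∃ c, ∀ n, ∀ t ≤ T, ∀ x,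
      |(picardSeq f₀ u₁ u₂ n).1 t x - (picardSeq f₀ u₁ u₂ (n + 1)).1 t x| ≤ c / 2 / 2 ^ n ∧
      |(picardSeq f₀ u₁ u₂ n).2 t x - (picardSeq f₀ u₁ u₂ (n + 1)).2 t x| ≤ c / 2 / 2 ^ n := by
    have hT : 0 ≤ max T 0 := le_max_right _ _
    obtain ⟨l, D, hl, hD, close⟩ := hd.exists_expClose_picardSeq_succ hT
    refine ⟨2 * (D * Real.exp (l * max T 0)), fun n t ht x => ?_⟩
    have ht' : t ≤ max T 0 := ht.trans (le_max_left _ _)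
    have potential_le := (close n).1.abs_clampTime_sub_le hT (by positivity) hl ht' x
    have field_le := (close n).2.abs_clampTime_sub_le hT (by positivity) hl ht' x
    rw [(clampTime_picardSeq f₀ u₁ u₂ n).1, (clampTime_picardSeq f₀ u₁ u₂ (n + 1)).1]
      at potential_le
    rw [(clampTime_picardSeq f₀ u₁ u₂ n).2, (clampTime_picardSeq f₀ u₁ u₂ (n + 1)).2] at field_le
    rw [mul_div_cancel_left₀ _ two_ne_zero, ← div_mul_eq_mul_div]
    exact ⟨potential_le, field_le⟩
  obtain ⟨u, hu⟩ := exists_isGeometricLimit fun T =>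
    let ⟨c, hc⟩ := sub_le T
    ⟨c, fun n t ht x => (hc n t ht x).1⟩
  obtain ⟨E, hE⟩ := exists_isGeometricLimit fun T =>
    let ⟨c, hc⟩ := sub_le T
    ⟨c, fun n t ht x => (hc n t ht x).2⟩
  exact ⟨u, E, hu, hE⟩

theorem isWeakState_of_isGeometricLimit (hd : IsBoundedData M C P₀ f₀ u₁ u₂)
    (hu : IsGeometricLimit (fun n => (picardSeq f₀ u₁ u₂ n).1) u)
    (hE : IsGeometricLimit (fun n => (picardSeq f₀ u₁ u₂ n).2) E) :
    IsWeakState (momentumRate C P₀) u E where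
  cont_u := hu.continuous fun n => (hd.isWeakState_picardSeq n).cont_u
  lip := by
    refine ⟨hE.continuous fun n => (hd.isWeakState_picardSeq n).lip.continuous, fun T => ?_⟩
    obtain ⟨L, hlip⟩ := hd.exists_lipschitzWith_picardSeq T
    exact ⟨L, fun t ht => .of_dist_le_mul fun x y => le_of_tendsto'
      ((hE.tendsto t x).dist (hE.tendsto t y)) fun n => (hlip n t ht.2).dist_le_mul x y⟩
  bound_u t x := le_of_tendsto' (hu.tendsto t x).abs
    fun n => (hd.isWeakState_picardSeq n).bound_u t x
  bound_E t x := le_of_tendsto' (hE.tendsto t x).abs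
    fun n => (hd.isWeakState_picardSeq n).bound_E t x

theorem next_eq_of_isGeometricLimit (hd : IsBoundedData M C P₀ f₀ u₁ u₂)
    (hu : IsGeometricLimit (fun n => (picardSeq f₀ u₁ u₂ n).1) u)
    (hE : IsGeometricLimit (fun n => (picardSeq f₀ u₁ u₂ n).2) E) {t : ℝ} (ht : 0 ≤ t) (x : ℝ) :
    nextPotential f₀ u₁ u₂ u E t x = u t x ∧ nextField f₀ u₁ u₂ u E t x = E t x := by
  obtain ⟨L, hlip⟩ := hd.exists_lipschitzWith_picardSeq t
  obtain ⟨l, hl, contraction⟩ := hd.exists_contraction ht L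
  obtain ⟨c, hc, potential_sub_le⟩ := hu t
  obtain ⟨c', -, field_sub_le⟩ := hE t
  have close (n : ℕ) := contraction _ _ _ _ (hd.isWeakState_picardSeq n)
    (hd.isWeakState_of_isGeometricLimit hu hE) (fun s hs => hlip n s hs.2)
    (max c c' / 2 ^ n) (by positivity)
    (.of_abs_sub_le (by positivity) hl.le fun s hs y => (potential_sub_le n s hs.2 y).trans
      (by gcongr; exact le_max_left _ _))
    (.of_abs_sub_le (by positivity) hl.le fun s hs y => (field_sub_le n s hs.2 y).trans
      (by gcongr; exact le_max_right _ _))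
  have bound_eq (n : ℕ) : max c c' / 2 ^ n / 2 * Real.exp (l * t) =
      max c c' / 2 * Real.exp (l * t) / 2 ^ n := by ring
  have next_tendsto_next := And.intro
    (tendsto_of_abs_sub_le_div_two_pow fun n =>
      ((close n).1 t ⟨ht, le_rfl⟩ x).trans_eq (bound_eq n))
    (tendsto_of_abs_sub_le_div_two_pow fun n =>
      ((close n).2 t ⟨ht, le_rfl⟩ x).trans_eq (bound_eq n))
  have next_tendsto := And.intro ((hu.tendsto t x).comp (tendsto_add_atTop_nat 1))
    ((hE.tendsto t x).comp (tendsto_add_atTop_nat 1))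
  simp only [Function.comp_def, picardSeq, clampTime_of_nonneg ht] at next_tendsto
  exact ⟨tendsto_nhds_unique next_tendsto_next.1 next_tendsto.1,
    tendsto_nhds_unique next_tendsto_next.2 next_tendsto.2⟩

theorem isState_of_isGeometricLimit (hd : IsBoundedData M C P₀ f₀ u₁ u₂)
    (hu : IsGeometricLimit (fun n => (picardSeq f₀ u₁ u₂ n).1) u)
    (hE : IsGeometricLimit (fun n => (picardSeq f₀ u₁ u₂ n).2) E) :
    IsState (momentumRate C P₀) u E (clampTime (nextFieldDeriv f₀ u₁ u₂ E)) where
  toIsWeakState := hd.isWeakState_of_isGeometricLimit hu hE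
  cont_E' := continuous_clampTime
    ((hd.isWeakState_of_isGeometricLimit hu hE).continuous_nextFieldDeriv hd)
  deriv_u t x := by
    refine hasDerivAt_of_tendstoUniformly (hE.tendstoUniformly t) (.of_forall fun n y => ?_)
      (hu.tendsto t) x
    obtain ⟨_, hs⟩ := hd.exists_isState_picardSeq n
    exact hs.deriv_u t y
  deriv_E t x := by
    have hT : 0 ≤ max t 0 := le_max_right _ _
    obtain ⟨L, hlip⟩ := hd.exists_lipschitzWith_picardSeq (max t 0)
    obtain ⟨k, fieldDeriv_sub_le⟩ := hd.exists_nextFieldDeriv_sub_le hT L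
    obtain ⟨c, hc, field_sub_le⟩ := hE (max t 0)
    refine hasDerivAt_of_tendstoUniformly
      (tendstoUniformly_of_abs_sub_le_div_two_pow (c := k * c) fun n y => ?_)
      (.of_forall fun n => hd.hasDerivAt_picardSeq_succ n t)
      (fun y => (hE.tendsto t y).comp (tendsto_add_atTop_nat 1)) x
    rw [mul_div_assoc]
    exact fieldDeriv_sub_le _ _ _ _ (hd.isWeakState_picardSeq n)
      (hd.isWeakState_of_isGeometricLimit hu hE) (fun s hs => hlip n s hs.2) _ (by positivity)
      (fun s hs => field_sub_le n s hs.2) _ ⟨hT, le_rfl⟩ y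

theorem exists_fixedPoint (hd : IsBoundedData M C P₀ f₀ u₁ u₂) :
    ∃ u E E' : ℝ → ℝ → ℝ, IsState (momentumRate C P₀) u E E' ∧
      ∀ t, 0 ≤ t → ∀ x, nextPotential f₀ u₁ u₂ u E t x = u t x ∧
        nextField f₀ u₁ u₂ u E t x = E t x := by
  obtain ⟨u, E, hu, hE⟩ := hd.exists_isGeometricLimit_picardSeq
  exact ⟨u, E, _, hd.isState_of_isGeometricLimit hu hE,
    fun t ht x => hd.next_eq_of_isGeometricLimit hu hE ht x⟩

end IsBoundedData

end Iteration

/-! ### The solution given by the fixed point -/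

section Solution

variable {M C P₀ : ℝ} {f₀ : ℝ × ℝ → ℝ} {u₁ u₂ : ℝ → ℝ} {u E E' : ℝ → ℝ → ℝ}

theorem nextRate_zero (x : ℝ) : nextRate f₀ u₁ u₂ u E 0 x = u₂ x := by
  simp only [nextRate, riemann, lineIntegral, mul_zero, add_zero, intervalIntegral.integral_same]
  ring

namespace IsWeakState

theorem integrable_transport (hs : IsWeakState (momentumRate C P₀) u E)
    (hd : IsBoundedData M C P₀ f₀ u₁ u₂) {t : ℝ} (ht : 0 ≤ t) (x : ℝ) :
    Integrable fun v => transport f₀ E t x v := by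
  have compact_support : HasCompactSupport fun v => transport f₀ E t x v := by
    refine HasCompactSupport.intro (isCompact_Icc (a := -momentumBound C P₀ t)
      (b := momentumBound C P₀ t)) fun v hv => hs.transport_eq_zero hd ⟨ht, le_rfl⟩ x ?_
    exact not_lt.1 fun h => hv (abs_le.1 h.le)
  exact ((hs.continuous_transport hd).comp (show Continuous fun v : ℝ => (t, x, v) by
    fun_prop)).integrable_of_hasCompactSupport compact_support

theorem transport_eq_zero_of_position (hs : IsWeakState (momentumRate C P₀) u E)
    (hd : IsBoundedData M C P₀ f₀ u₁ u₂) {R₀ t : ℝ}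
    (hR : ∀ x v, f₀ (x, v) ≠ 0 → |x| ≤ R₀) (ht : 0 ≤ t) (x v : ℝ) (hx : R₀ + t ≤ |x|) :
    transport f₀ E t x v = 0 :=
  (hs.lip.isTransported f₀ t x v).eq_zero_of_position ht
    (fun _ w => eq_zero_of_le_abs (hd.contDiff_f.continuous.comp (Continuous.prodMk_left w))
      fun y => hR y w) hx

end IsWeakState

namespace IsState

theorem contDiff_nextPotential (hs : IsState (momentumRate C P₀) u E E')
    (hd : IsBoundedData M C P₀ f₀ u₁ u₂) :
    ContDiff ℝ 2 fun p : ℝ × ℝ => nextPotential f₀ u₁ u₂ u E p.1 p.2 :=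
  contDiff_two_of_partial_deriv (hs.hasDerivAt_nextPotential_left hd)
    (hs.hasDerivAt_nextPotential_right hd)
    (contDiff_one_of_partial_deriv (hs.hasDerivAt_nextRate_left hd)
      (hs.hasDerivAt_nextRate_right hd)
      ((hs.continuous_nextFieldDeriv hd).add (hs.continuous_waveSource hd))
      (hs.continuous_nextRateDeriv hd))
    (contDiff_one_of_partial_deriv (hs.hasDerivAt_nextField_left hd)
      (hs.hasDerivAt_nextField_right hd) (hs.continuous_nextRateDeriv hd)
      (hs.continuous_nextFieldDeriv hd))

theorem waveEquation_nextPotential (hs : IsState (momentumRate C P₀) u E E')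
    (hd : IsBoundedData M C P₀ f₀ u₁ u₂) {t : ℝ} (ht : 0 ≤ t) (x : ℝ) :
    iteratedDerivWithin 2 (fun s => nextPotential f₀ u₁ u₂ u E s x) (Ici 0) t
      - iteratedDeriv 2 (nextPotential f₀ u₁ u₂ u E t) x = waveSource f₀ u E t x := by
  rw [iteratedDerivWithin_two_Ici_eq (fun s => hs.hasDerivAt_nextPotential_left hd s x)
      (hs.hasDerivAt_nextRate_left hd t x) ht, iteratedDeriv_succ, iteratedDeriv_one,
    funext fun y => (hs.hasDerivAt_nextPotential_right hd t y).deriv,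
    (hs.hasDerivAt_nextField_right hd t x).deriv, add_sub_cancel_left]

theorem isGlobalVKGSolution (hs : IsState (momentumRate C P₀) u E E')
    (hd : IsBoundedData M C P₀ f₀ u₁ u₂)
    (hfix : ∀ t, 0 ≤ t → ∀ x, nextPotential f₀ u₁ u₂ u E t x = u t x ∧
      nextField f₀ u₁ u₂ u E t x = E t x) :
    IsGlobalVKGSolution f₀ u₁ u₂ (fun p => transport f₀ E p.1 p.2.1 p.2.2)
      (fun p => nextPotential f₀ u₁ u₂ u E p.1 p.2) := by
  obtain ⟨fx, fv, -, -, hx, hv, ht, contDiff_transport⟩ :=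
    hs.lip.exists_transport_deriv hs.deriv_E hs.cont_E' hd.contDiff_f
  exact {
    contDiffOn_f := contDiff_transport.contDiffOn
    contDiffOn_u := (hs.contDiff_nextPotential hd).contDiffOn
    vlasov := fun t ht0 x v => by
      rw [derivWithin_Ici_eq (ht t x v) ht0, (hx t x v).deriv,
        (hs.hasDerivAt_nextPotential_right hd t x).deriv, (hv t x v).deriv, (hfix t ht0 x).2]
      ring
    integrable_f := fun t ht0 => hs.integrable_transport hd ht0
    kleinGordon := fun t ht0 x => by
      rw [hs.waveEquation_nextPotential hd ht0, (hfix t ht0 x).1, waveSource, sub_add_cancel]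
      simp only [moment, one_mul]
    init_f := hs.lip.transport_zero f₀
    init_u := fun x => by simp [nextPotential]
    init_dtu := fun x => by
      rw [derivWithin_Ici_eq (hs.hasDerivAt_nextPotential_left hd 0 x) le_rfl, nextRate_zero] }

end IsState

end Solution

/-! ### Functions on a half-space -/

/-- The space-time `[0, ∞[ × F`. -/
abbrev halfSpace (F : Type*) : Set (ℝ × F) := Ici 0 ×ˢ univ

section HalfSpace

open Filter Topology

namespace halfSpace

variable {F G : Type*} {t : ℝ}

theorem mem (ht : 0 ≤ t) (x : F) : (t, x) ∈ halfSpace F := ⟨ht, mem_univ x⟩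

variable [TopologicalSpace F]

theorem mem_nhds (ht : 0 < t) (x : F) : halfSpace F ∈ 𝓝 (t, x) :=
  prod_mem_nhds (Ici_mem_nhds ht) univ_mem

theorem continuousOn_curve [TopologicalSpace G] {φ : ℝ × F → G} (h : ContinuousOn φ (halfSpace F))
    {b : ℝ → F} (hb : ContinuousOn b (Icc 0 t)) :
    ContinuousOn (fun s => φ (s, b s)) (Icc 0 t) :=
  h.comp (continuousOn_id.prodMk hb) fun _ hs => mem hs.1 _

end halfSpace

variable {F G : Type*} [NormedAddCommGroup F] [NormedSpace ℝ F] [NormedAddCommGroup G]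
  [NormedSpace ℝ G]

/-- The derivative of `φ` in the direction `a`, one-sided at the time `0`. -/
noncomputable def dirDeriv (φ : ℝ × F → G) (a p : ℝ × F) : G :=
  fderivWithin ℝ φ (halfSpace F) p a

/-- The time derivative of `φ`, one-sided at the time `0`. -/
noncomputable abbrev timeDeriv (φ : ℝ × F → G) (p : ℝ × F) : G := dirDeriv φ (1, 0) p

/-- The spatial derivative of `φ` in one space dimension. -/
noncomputable abbrev spaceDeriv (φ : ℝ × ℝ → G) (p : ℝ × ℝ) : G := dirDeriv φ (0, 1) p

variable {φ : ℝ × F → G} {t : ℝ}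

namespace halfSpace

theorem uniqueDiffOn : UniqueDiffOn ℝ (halfSpace F) :=
  (uniqueDiffOn_Ici 0).prod uniqueDiffOn_univ

theorem derivWithin_time (h : DifferentiableOn ℝ φ (halfSpace F)) (ht : 0 ≤ t) (x : F) :
    derivWithin (fun s => φ (s, x)) (Ici 0) t = timeDeriv φ (t, x) :=
  ((h (t, x) (mem ht x)).hasFDerivWithinAt.comp_hasDerivWithinAt t
    ((hasDerivWithinAt_id t (Ici 0)).prodMk (hasDerivWithinAt_const t (Ici 0) x))
    fun _ hs => mem hs x).derivWithin (uniqueDiffOn_Ici 0 t ht)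

theorem hasDerivAt_slice (h : DifferentiableOn ℝ φ (halfSpace F)) (ht : 0 ≤ t) {b : ℝ → F} {b' : F}
    {y : ℝ} (hb : HasDerivAt b b' y) :
    HasDerivAt (fun y => φ (t, b y)) (dirDeriv φ (0, b') (t, b y)) y := by
  rw [← hasDerivWithinAt_univ] at hb ⊢
  exact (h (t, b y) (mem ht _)).hasFDerivWithinAt.comp_hasDerivWithinAt y
    ((hasDerivWithinAt_const y univ t).prodMk hb) fun _ _ => mem ht _

theorem hasDerivAt_space {φ : ℝ × ℝ → G} (h : DifferentiableOn ℝ φ (halfSpace ℝ)) (ht : 0 ≤ t)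
    (x : ℝ) : HasDerivAt (fun y => φ (t, y)) (spaceDeriv φ (t, x)) x :=
  hasDerivAt_slice h ht (hasDerivAt_id x)

theorem hasDerivAt_curve (h : DifferentiableOn ℝ φ (halfSpace F)) (ht : 0 < t) {b : ℝ → F} {b' : F}
    (hb : HasDerivAt b b' t) :
    HasDerivAt (fun s => φ (s, b s)) (dirDeriv φ (1, b') (t, b t)) t :=
  ((h (t, b t) (mem ht.le _)).hasFDerivWithinAt.hasFDerivAt
    (mem_nhds ht _)).comp_hasDerivAt t ((hasDerivAt_id t).prodMk hb)

theorem contDiffOn_dirDeriv (h : ContDiffOn ℝ 2 φ (halfSpace F)) (a : ℝ × F) :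
    ContDiffOn ℝ 1 (dirDeriv φ a) (halfSpace F) :=
  (h.fderivWithin (m := 1) uniqueDiffOn (by norm_num)).clm_apply contDiffOn_const

theorem continuousOn_dirDeriv (h : ContDiffOn ℝ 1 φ (halfSpace F)) (a : ℝ × F) :
    ContinuousOn (dirDeriv φ a) (halfSpace F) :=
  (h.continuousOn_fderivWithin uniqueDiffOn le_rfl).clm_apply continuousOn_const

theorem dirDeriv_dirDeriv_eq_fderiv (h : ContDiffOn ℝ 2 φ (halfSpace F)) (ht : 0 < t) (x : F)
    (a b : ℝ × F) : dirDeriv (dirDeriv φ a) b (t, x) = fderiv ℝ (fderiv ℝ φ) (t, x) b a := by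
  have fderivWithin_eq : fderivWithin ℝ φ (halfSpace F) =ᶠ[𝓝 (t, x)] fderiv ℝ φ := by
    filter_upwards [eventually_mem_nhds_iff.2 (mem_nhds ht x)] with p hp
    exact fderivWithin_of_mem_nhds hp
  have dirDeriv_eq : dirDeriv φ a =ᶠ[𝓝 (t, x)] fun p => fderiv ℝ φ p a :=
    fderivWithin_eq.mono fun p hp => by rw [dirDeriv, hp]
  have differentiable_fderiv : DifferentiableAt ℝ (fderiv ℝ φ) (t, x) :=
    ((h.contDiffAt (mem_nhds ht x)).fderiv_right (m := 1) (by norm_num)).differentiableAt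
      one_ne_zero
  rw [dirDeriv, fderivWithin_of_mem_nhds (mem_nhds ht x), dirDeriv_eq.fderiv_eq,
    (differentiable_fderiv.hasFDerivAt.clm_apply (hasFDerivAt_const a (t, x))).fderiv]
  simp

theorem dirDeriv_comm (h : ContDiffOn ℝ 2 φ (halfSpace F)) (ht : 0 < t) (x : F) (a b : ℝ × F) :
    dirDeriv (dirDeriv φ a) b (t, x) = dirDeriv (dirDeriv φ b) a (t, x) := by
  rw [dirDeriv_dirDeriv_eq_fderiv h ht, dirDeriv_dirDeriv_eq_fderiv h ht]
  exact (h.contDiffAt (mem_nhds ht x)).isSymmSndFDerivAt (by simp) b a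

end halfSpace

theorem eq_add_integral_of_hasDerivAt_Ioo [CompleteSpace G] {h h' : ℝ → G} (ht : 0 ≤ t)
    (hc : ContinuousOn h (Icc 0 t)) (hd : ∀ s ∈ Ioo 0 t, HasDerivAt h (h' s) s)
    (hc' : ContinuousOn h' (Icc 0 t)) : h t = h 0 + ∫ s in (0 : ℝ)..t, h' s := by
  rw [intervalIntegral.integral_eq_sub_of_hasDerivAt_of_le ht hc hd
    (hc'.intervalIntegrable_of_Icc ht), add_sub_cancel]

end HalfSpace

/-! ### Representation of arbitrary solutions -/

section Representation

variable {f₀ : ℝ × ℝ → ℝ} {u₁ u₂ : ℝ → ℝ} {g : ℝ × ℝ × ℝ → ℝ} {w : ℝ × ℝ → ℝ} {t : ℝ}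

/-- The source `-ρ - w` of the wave equation satisfied by the potential `w` of the density `g`. -/
noncomputable def chargeSource (g : ℝ × ℝ × ℝ → ℝ) (w : ℝ × ℝ → ℝ) (t x : ℝ) : ℝ :=
  -(∫ v, g (t, x, v)) - w (t, x)

namespace IsGlobalVKGSolution

theorem differentiableOn_u (h : IsGlobalVKGSolution f₀ u₁ u₂ g w) :
    DifferentiableOn ℝ w (halfSpace ℝ) :=
  h.contDiffOn_u.differentiableOn two_ne_zero

theorem differentiableOn_dirDeriv_u (h : IsGlobalVKGSolution f₀ u₁ u₂ g w) (a : ℝ × ℝ) :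
    DifferentiableOn ℝ (dirDeriv w a) (halfSpace ℝ) :=
  (halfSpace.contDiffOn_dirDeriv h.contDiffOn_u a).differentiableOn one_ne_zero

theorem continuousOn_dirDeriv_u (h : IsGlobalVKGSolution f₀ u₁ u₂ g w) (a : ℝ × ℝ) :
    ContinuousOn (dirDeriv w a) (halfSpace ℝ) :=
  (h.differentiableOn_dirDeriv_u a).continuousOn

theorem deriv_u (h : IsGlobalVKGSolution f₀ u₁ u₂ g w) (ht : 0 ≤ t) (x : ℝ) :
    deriv (fun y => w (t, y)) x = spaceDeriv w (t, x) :=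
  (halfSpace.hasDerivAt_space h.differentiableOn_u ht x).deriv

theorem timeDeriv_u_zero (h : IsGlobalVKGSolution f₀ u₁ u₂ g w) (x : ℝ) :
    timeDeriv w (0, x) = u₂ x := by
  rw [← h.init_dtu, halfSpace.derivWithin_time h.differentiableOn_u le_rfl]

theorem spaceDeriv_u_zero (h : IsGlobalVKGSolution f₀ u₁ u₂ g w) (x : ℝ) :
    spaceDeriv w (0, x) = deriv u₁ x := by
  simp only [← h.deriv_u le_rfl, h.init_u]

theorem waveEquation (h : IsGlobalVKGSolution f₀ u₁ u₂ g w) (ht : 0 ≤ t) (x : ℝ) :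
    timeDeriv (timeDeriv w) (t, x) - spaceDeriv (spaceDeriv w) (t, x) = chargeSource g w t x := by
  have timeDeriv_eq {s : ℝ} (hs : s ∈ Ici 0) :
      iteratedDerivWithin 1 (fun s => w (s, x)) (Ici 0) s = timeDeriv w (s, x) := by
    rw [iteratedDerivWithin_one, halfSpace.derivWithin_time h.differentiableOn_u hs]
  have time : iteratedDerivWithin 2 (fun s => w (s, x)) (Ici 0) t =
      timeDeriv (timeDeriv w) (t, x) := by
    rw [iteratedDerivWithin_succ, derivWithin_congr (fun _ => timeDeriv_eq) (timeDeriv_eq ht),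
      halfSpace.derivWithin_time (h.differentiableOn_dirDeriv_u _) ht]
  have space : iteratedDeriv 2 (fun y => w (t, y)) x = spaceDeriv (spaceDeriv w) (t, x) := by
    rw [iteratedDeriv_succ, iteratedDeriv_one, funext (h.deriv_u ht),
      (halfSpace.hasDerivAt_space (h.differentiableOn_dirDeriv_u _) ht x).deriv]
  rw [← time, ← space, chargeSource, ← h.kleinGordon t ht x]
  ring

theorem continuousOn_chargeSource (h : IsGlobalVKGSolution f₀ u₁ u₂ g w) :
    ContinuousOn (fun p : ℝ × ℝ => chargeSource g w p.1 p.2) (halfSpace ℝ) := by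
  have second_deriv (a : ℝ × ℝ) := halfSpace.continuousOn_dirDeriv
    (halfSpace.contDiffOn_dirDeriv h.contDiffOn_u a) a
  exact ((second_deriv (1, 0)).sub (second_deriv (0, 1))).congr
    fun p hp => (h.waveEquation hp.1 p.2).symm

theorem hasDerivAt_riemann_along_line (h : IsGlobalVKGSolution f₀ u₁ u₂ g w) {σ s : ℝ}
    (hσ : σ ^ 2 = 1) (hs : 0 < s) (t x : ℝ) :
    HasDerivAt (fun s => timeDeriv w (s, x + σ * (t - s)) + σ * spaceDeriv w (s, x + σ * (t - s)))
      (chargeSource g w s (x + σ * (t - s))) s := by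
  have line : HasDerivAt (fun s : ℝ => x + σ * (t - s)) (-σ) s := by
    simpa using (((hasDerivAt_id s).const_sub t).const_mul σ).const_add x
  refine ((halfSpace.hasDerivAt_curve (h.differentiableOn_dirDeriv_u (1, 0)) hs line).add
    ((halfSpace.hasDerivAt_curve (h.differentiableOn_dirDeriv_u (0, 1)) hs line).const_mul
      σ)).congr_deriv ?_
  set p : ℝ × ℝ := (s, x + σ * (t - s))
  have split (φ : ℝ × ℝ → ℝ) : dirDeriv φ (1, -σ) p = timeDeriv φ p - σ * spaceDeriv φ p := by
    have direction_eq : ((1, -σ) : ℝ × ℝ) = (1, 0) - σ • (0, 1) := by simp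
    simp only [dirDeriv, direction_eq, map_sub, map_smul, smul_eq_mul]
  have mixed : timeDeriv (spaceDeriv w) p = spaceDeriv (timeDeriv w) p :=
    halfSpace.dirDeriv_comm h.contDiffOn_u hs _ _ _
  rw [split, split, mixed, ← h.waveEquation hs.le]
  linear_combination (-spaceDeriv (spaceDeriv w) p) * hσ

theorem riemann_eq (h : IsGlobalVKGSolution f₀ u₁ u₂ g w) {σ : ℝ} (hσ : σ ^ 2 = 1)
    (ht : 0 ≤ t) (x : ℝ) :
    timeDeriv w (t, x) + σ * spaceDeriv w (t, x) =
      u₂ (x + σ * t) + σ * deriv u₁ (x + σ * t) + lineIntegral σ (chargeSource g w) t x := by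
  have line : ContinuousOn (fun s : ℝ => x + σ * (t - s)) (Icc 0 t) := by fun_prop
  have integrated := eq_add_integral_of_hasDerivAt_Ioo
    (h := fun s => timeDeriv w (s, x + σ * (t - s)) + σ * spaceDeriv w (s, x + σ * (t - s))) ht
    ((halfSpace.continuousOn_curve (h.continuousOn_dirDeriv_u (1, 0)) line).add
      (continuousOn_const.mul
        (halfSpace.continuousOn_curve (h.continuousOn_dirDeriv_u (0, 1)) line)))
    (fun s hs => h.hasDerivAt_riemann_along_line hσ hs.1 t x)
    (halfSpace.continuousOn_curve h.continuousOn_chargeSource line)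
  simpa only [sub_self, mul_zero, add_zero, sub_zero, h.timeDeriv_u_zero, h.spaceDeriv_u_zero,
    lineIntegral] using integrated

theorem potential_eq (h : IsGlobalVKGSolution f₀ u₁ u₂ g w) (ht : 0 ≤ t) (x : ℝ) :
    w (t, x) = u₁ x + ∫ s in (0 : ℝ)..t, timeDeriv w (s, x) := by
  rw [← h.init_u x]
  exact eq_add_integral_of_hasDerivAt_Ioo ht
    (halfSpace.continuousOn_curve h.contDiffOn_u.continuousOn continuousOn_const)
    (fun s hs => halfSpace.hasDerivAt_curve h.differentiableOn_u hs.1 (hasDerivAt_const s x))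
    (halfSpace.continuousOn_curve (h.continuousOn_dirDeriv_u _) continuousOn_const)

theorem hasDerivAt_along_char (h : IsGlobalVKGSolution f₀ u₁ u₂ g w) {E : ℝ → ℝ → ℝ} {s : ℝ}
    {γ : ℝ → ℝ × ℝ} (hs : 0 < s) (hγ : HasDerivAt γ (charField E s (γ s)) s)
    (hE : E s (γ s).1 = spaceDeriv w (s, (γ s).1)) :
    HasDerivAt (fun s => g (s, γ s)) 0 s := by
  have hg := h.contDiffOn_f.differentiableOn one_ne_zero
  have vlasov := h.vlasov s hs.le (γ s).1 (γ s).2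
  have dx : deriv (fun y => g (s, y, (γ s).2)) (γ s).1 = dirDeriv g (0, 1, 0) (s, γ s) :=
    (halfSpace.hasDerivAt_slice hg hs.le
      ((hasDerivAt_id (γ s).1).prodMk (hasDerivAt_const _ (γ s).2))).deriv
  have dv : deriv (fun v => g (s, (γ s).1, v)) (γ s).2 = dirDeriv g (0, 0, 1) (s, γ s) :=
    (halfSpace.hasDerivAt_slice hg hs.le
      ((hasDerivAt_const _ (γ s).1).prodMk (hasDerivAt_id (γ s).2))).deriv
  rw [halfSpace.derivWithin_time hg hs.le, dx, dv, h.deriv_u hs.le, ← hE] at vlasov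
  have split : ((1, charField E s (γ s)) : ℝ × ℝ × ℝ) =
      (1, 0) + relVelocity (γ s).2 • (0, 1, 0) - E s (γ s).1 • (0, 0, 1) := by
    simp [charField]
  refine (halfSpace.hasDerivAt_curve hg hs hγ).congr_deriv (Eq.trans ?_ vlasov)
  simp only [dirDeriv, split, map_sub, map_add, map_smul, smul_eq_mul]

theorem isTransported (h : IsGlobalVKGSolution f₀ u₁ u₂ g w) {E : ℝ → ℝ → ℝ} (hE : IsLipField E)
    {x : ℝ} (ht : 0 ≤ t)
    (hEw : ∀ s ∈ Icc 0 t, ∀ y, |y - x| ≤ t - s → E s y = spaceDeriv w (s, y)) (v : ℝ) :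
    IsTransported f₀ E (fun t x v => g (t, x, v)) t x v := by
  obtain ⟨γ, hγ, isChar, -⟩ := hE.isTransported f₀ t x v
  have in_cone (s : ℝ) (hs : s ∈ Icc 0 t) : |(γ s).1 - x| ≤ t - s := by
    simpa only [hγ] using isChar.abs_fst_sub_le hs
  have integrated := eq_add_integral_of_hasDerivAt_Ioo (h' := fun _ => 0) ht
    (halfSpace.continuousOn_curve h.contDiffOn_f.continuousOn
      fun s hs => (isChar s hs).continuousAt.continuousWithinAt)
    (fun s hs => h.hasDerivAt_along_char hs.1 (isChar s (Ioo_subset_Icc_self hs))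
      (hEw s (Ioo_subset_Icc_self hs) _ (in_cone s (Ioo_subset_Icc_self hs)))) continuousOn_const
  refine ⟨γ, hγ, isChar, ?_⟩
  simpa only [hγ, intervalIntegral.integral_zero, add_zero] using
    integrated.trans (by rw [intervalIntegral.integral_zero, add_zero, ← h.init_f])

end IsGlobalVKGSolution

end Representation

/-! ### Uniqueness -/

section Uniqueness

open Filter
open scoped NNReal

/-- The part of the domain of dependence of the point `(R, 0)` at nonnegative times. -/
def lightCone (R : ℝ) : Set (ℝ × ℝ) := {p | 0 ≤ p.1 ∧ |p.2| ≤ R - p.1}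

/-- On the light cone of `(R, 0)`, the functions `φ` and `ψ` have distance at most `D` in the
supremum norm with weight `exp (-l * t)`. -/
def ConeClose (R l D : ℝ) (φ ψ : ℝ × ℝ → ℝ) : Prop :=
  ∀ p ∈ lightCone R, |φ p - ψ p| ≤ D * Real.exp (l * p.1)

/-- The spatial derivative of `w` on the rectangle `[0, R] × [-R, R]`, extended by precomposition
with the nearest-point projection so as to be Lipschitz in space on the whole line. -/
noncomputable def clampedField (w : ℝ × ℝ → ℝ) (R t x : ℝ) : ℝ :=
  spaceDeriv w (max 0 (min R t), max (-R) (min R x))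

variable {f₀ : ℝ × ℝ → ℝ} {u₁ u₂ : ℝ → ℝ} {f g : ℝ × ℝ × ℝ → ℝ} {u w φ ψ : ℝ × ℝ → ℝ}
  {R l D s t x y : ℝ}

theorem exists_abs_le_of_continuousOn_halfSpace (hφ : ContinuousOn φ (halfSpace ℝ)) (R : ℝ) :
    ∃ K, 0 ≤ K ∧ ∀ p ∈ Icc 0 R ×ˢ Icc (-R) R, |φ p| ≤ K := by
  obtain ⟨K, hK⟩ := (isCompact_Icc.prod isCompact_Icc).exists_bound_of_continuousOn
    (hφ.mono (t := Icc 0 R ×ˢ Icc (-R) R) fun p hp => halfSpace.mem hp.1.1 p.2)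
  exact ⟨max 0 K, le_max_left _ _, fun p hp => (hK p hp).trans (le_max_right _ _)⟩

namespace lightCone

theorem mem_rectangle (h : (t, x) ∈ lightCone R) : (t, x) ∈ Icc 0 R ×ˢ Icc (-R) R := by
  obtain ⟨ht, hx⟩ : 0 ≤ t ∧ |x| ≤ R - t := h
  exact ⟨⟨ht, by linarith [abs_nonneg x]⟩, abs_le.1 (by linarith)⟩

theorem mem_of_abs_sub_le (h : (t, x) ∈ lightCone R) (hs : 0 ≤ s) (hy : |y - x| ≤ t - s) :
    (s, y) ∈ lightCone R := by
  obtain ⟨-, hx⟩ : 0 ≤ t ∧ |x| ≤ R - t := h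
  exact ⟨hs, by linarith [abs_sub_abs_le_abs_sub y x]⟩

theorem mem_apex (ht : 0 ≤ t) (x : ℝ) : (t, x) ∈ lightCone (t + |x|) :=
  ⟨ht, by simp⟩

end lightCone

namespace ConeClose

theorem mono {D' : ℝ} (H : ConeClose R l D φ ψ) (hD : D ≤ D') : ConeClose R l D' φ ψ :=
  fun p hp => (H p hp).trans (mul_le_mul_of_nonneg_right hD (Real.exp_nonneg _))

theorem exists_of_continuousOn (hl : 0 ≤ l) (hφ : ContinuousOn φ (halfSpace ℝ))
    (hψ : ContinuousOn ψ (halfSpace ℝ)) (R : ℝ) : ∃ D, 0 ≤ D ∧ ConeClose R l D φ ψ := by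
  obtain ⟨D, hD, sub_le⟩ := exists_abs_le_of_continuousOn_halfSpace (hφ.sub hψ) R
  exact ⟨D, hD, fun p hp => (sub_le p (lightCone.mem_rectangle hp)).trans
    (le_mul_of_one_le_right hD (Real.one_le_exp (mul_nonneg hl hp.1)))⟩

theorem eq_of_forall_div_two_pow {p : ℝ × ℝ} (H : ∀ n : ℕ, ConeClose R l (D / 2 ^ n) φ ψ)
    (hp : p ∈ lightCone R) : φ p = ψ p :=
  tendsto_nhds_unique tendsto_const_nhds (tendsto_of_abs_sub_le_div_two_pow
    (c := D * Real.exp (l * p.1)) fun n => (H n p hp).trans_eq (div_mul_eq_mul_div _ _ _))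

theorem lineIntegral {σ : ℝ} (H : ConeClose R l D φ ψ) (hD : 0 ≤ D) (hl : 0 < l) (hσ : |σ| ≤ 1)
    (hφ : ContinuousOn φ (halfSpace ℝ)) (hψ : ContinuousOn ψ (halfSpace ℝ)) :
    ConeClose R l (D / l) (fun p => lineIntegral σ (fun s y => φ (s, y)) p.1 p.2)
      (fun p => lineIntegral σ (fun s y => ψ (s, y)) p.1 p.2) := by
  rintro ⟨t, x⟩ hp
  have line : ContinuousOn (fun s : ℝ => x + σ * (t - s)) (Icc 0 t) := by fun_prop
  have difference_le (s : ℝ) (hs : s ∈ Icc 0 t) :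
      |φ (s, x + σ * (t - s)) - ψ (s, x + σ * (t - s))| ≤ D * Real.exp (l * s) := by
    refine H _ (lightCone.mem_of_abs_sub_le hp hs.1 ?_)
    rw [add_sub_cancel_left, abs_mul, abs_of_nonneg (sub_nonneg.2 hs.2)]
    exact mul_le_of_le_one_left (sub_nonneg.2 hs.2) hσ
  simp only [_root_.lineIntegral]
  rw [← intervalIntegral.integral_sub
    ((halfSpace.continuousOn_curve hφ line).intervalIntegrable_of_Icc hp.1)
    ((halfSpace.continuousOn_curve hψ line).intervalIntegrable_of_Icc hp.1)]
  exact (abs_intervalIntegral_le hp.1 (by fun_prop) difference_le).trans (integral_mul_exp_le hD hl)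

end ConeClose

theorem clampedField_eq (h : (t, x) ∈ Icc 0 R ×ˢ Icc (-R) R) :
    clampedField w R t x = spaceDeriv w (t, x) := by
  rw [clampedField, min_eq_right h.1.2, max_eq_right h.1.1, min_eq_right h.2.2,
    max_eq_right h.2.1]

theorem clamp_mem_rectangle (hR : 0 ≤ R) (t x : ℝ) :
    (max 0 (min R t), max (-R) (min R x)) ∈ Icc 0 R ×ˢ Icc (-R) R :=
  ⟨⟨le_max_left _ _, max_le hR (min_le_left _ _)⟩,
    ⟨le_max_left _ _, max_le (neg_le_self hR) (min_le_left _ _)⟩⟩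

namespace IsGlobalVKGSolution

theorem exists_lipschitzWith_clampedField (h : IsGlobalVKGSolution f₀ u₁ u₂ g w) (hR : 0 ≤ R) :
    ∃ L : ℝ≥0, ∀ t, LipschitzWith L (clampedField w R t) := by
  obtain ⟨L, hL, deriv_le⟩ := exists_abs_le_of_continuousOn_halfSpace
    (halfSpace.continuousOn_dirDeriv (halfSpace.contDiffOn_dirDeriv h.contDiffOn_u (0, 1)) (0, 1)) R
  lift L to ℝ≥0 using hL
  refine ⟨L, fun t => ?_⟩
  have clamp_lipschitz : LipschitzWith 1 fun x => max (-R) (min R x) :=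
    (LipschitzWith.id.const_min R).const_max (-R)
  have lipschitzOn : LipschitzOnWith L (fun x => spaceDeriv w (max 0 (min R t), x))
      (Icc (-R) R) :=
    (convex_Icc _ _).lipschitzOnWith_of_nnnorm_hasDerivWithin_le
      (fun x _ => (halfSpace.hasDerivAt_space (h.differentiableOn_dirDeriv_u _)
        (le_max_left _ _) x).hasDerivWithinAt)
      fun x hx => deriv_le _ ⟨(clamp_mem_rectangle hR t x).1, hx⟩
  rw [← lipschitzOnWith_univ, ← mul_one L]
  exact lipschitzOn.comp clamp_lipschitz.lipschitzOnWith fun x _ =>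
    (clamp_mem_rectangle hR t x).2

theorem isLipField_clampedField (h : IsGlobalVKGSolution f₀ u₁ u₂ g w) (hR : 0 ≤ R) :
    IsLipField (clampedField w R) where
  continuous := (h.continuousOn_dirDeriv_u (0, 1)).comp_continuous
    (f := fun p : ℝ × ℝ => (max 0 (min R p.1), max (-R) (min R p.2))) (by fun_prop)
    fun p => halfSpace.mem (le_max_left _ _) _
  lipschitzWith _ := (h.exists_lipschitzWith_clampedField hR).imp fun _ lip t _ => lip t

theorem isTransported_clampedField (h : IsGlobalVKGSolution f₀ u₁ u₂ g w)
    (hp : (t, x) ∈ lightCone R) (v : ℝ) :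
    IsTransported f₀ (clampedField w R) (fun t x v => g (t, x, v)) t x v := by
  have ht := (lightCone.mem_rectangle hp).1
  exact h.isTransported (h.isLipField_clampedField (ht.1.trans ht.2)) ht.1
    (fun s hs y hy => clampedField_eq (lightCone.mem_rectangle
      (lightCone.mem_of_abs_sub_le hp hs.1 hy))) v

theorem exists_velocity_bound (h : IsGlobalVKGSolution f₀ u₁ u₂ g w) (hf₀ : HasCompactSupport f₀)
    (R : ℝ) :
    ∃ Q, 0 ≤ Q ∧ ∀ t x, (t, x) ∈ lightCone R → ∀ v, Q ≤ |v| → g (t, x, v) = 0 := by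
  obtain ⟨Q₀, hQ₀, f₀_eq_zero⟩ := hf₀.exists_pos_le_norm
  obtain ⟨K, hK, field_le⟩ :=
    exists_abs_le_of_continuousOn_halfSpace (h.continuousOn_dirDeriv_u (0, 1)) R
  refine ⟨Q₀ + K * max R 0, by positivity, fun t x hp v hv => ?_⟩
  have ht := (lightCone.mem_rectangle hp).1
  refine (h.isTransported_clampedField hp v).eq_zero_of_velocity ht.1 (B := fun s => Q₀ + K * s)
    (B' := fun _ => K) (fun s => by simpa using ((hasDerivAt_id s).const_mul K).const_add Q₀)
    (fun s _ y _ => field_le _ (clamp_mem_rectangle (ht.1.trans ht.2) s y))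
    (fun x v hv => f₀_eq_zero _ (le_trans (by simpa using hv) (norm_snd_le (x, v))))
    (le_trans ?_ hv)
  gcongr
  exact ht.2.trans (le_max_left _ _)

theorem continuous_velocity (h : IsGlobalVKGSolution f₀ u₁ u₂ g w) (ht : 0 ≤ t) (x : ℝ) :
    Continuous fun v => g (t, x, v) :=
  h.contDiffOn_f.continuousOn.comp_continuous (by fun_prop) fun _ => halfSpace.mem ht _

theorem abs_density_sub_le (h : IsGlobalVKGSolution f₀ u₁ u₂ g w)
    (h' : IsGlobalVKGSolution f₀ u₁ u₂ f u) {Λ L : ℝ≥0} (hf₀ : LipschitzWith Λ f₀)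
    (hL : ∀ t, LipschitzWith L (clampedField w R t)) (hp : (t, x) ∈ lightCone R) {ε : ℝ}
    (hε : 0 ≤ ε)
    (hfield : ∀ s ∈ Icc 0 t, ∀ y, (s, y) ∈ lightCone R →
      |spaceDeriv w (s, y) - spaceDeriv u (s, y)| ≤ ε) (v : ℝ) :
    |g (t, x, v) - f (t, x, v)| ≤ Λ * (ε * t * Real.exp ((1 + L) * t)) := by
  refine (h.isTransported_clampedField hp v).abs_sub_le (h'.isTransported_clampedField hp v) hp.1
    hf₀ L.coe_nonneg hε (fun s _ y y' _ _ => (hL s).dist_le_mul y y') fun s hs y hy => ?_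
  have hq := lightCone.mem_of_abs_sub_le hp hs.1 hy
  rw [clampedField_eq (lightCone.mem_rectangle hq), clampedField_eq (lightCone.mem_rectangle hq)]
  exact hfield s hs y hq

theorem exists_coneClose_chargeSource (h : IsGlobalVKGSolution f₀ u₁ u₂ g w)
    (h' : IsGlobalVKGSolution f₀ u₁ u₂ f u) {Λ : ℝ≥0} (hf₀ : LipschitzWith Λ f₀)
    (hf₀' : HasCompactSupport f₀) (hR : 0 ≤ R) :
    ∃ k, 0 ≤ k ∧ ∀ l, 0 ≤ l → ∀ D, 0 ≤ D → ConeClose R l D w u →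
      ConeClose R l D (spaceDeriv w) (spaceDeriv u) →
      ConeClose R l (k * D) (fun p => chargeSource g w p.1 p.2)
        (fun p => chargeSource f u p.1 p.2) := by
  obtain ⟨L, hL⟩ := h.exists_lipschitzWith_clampedField hR
  obtain ⟨Q, hQ, g_eq_zero⟩ := h.exists_velocity_bound hf₀' R
  obtain ⟨Q', hQ', f_eq_zero⟩ := h'.exists_velocity_bound hf₀' R
  set B : ℝ := Λ * (R * Real.exp ((1 + L) * R))
  refine ⟨2 * (Q + Q') * B + 1, by positivity, fun l hl D hD potential_close field_close => ?_⟩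
  rintro ⟨t, x⟩ hp
  obtain ⟨ht, htR⟩ := (lightCone.mem_rectangle hp).1
  have density_sub_le (v : ℝ) : |g (t, x, v) - f (t, x, v)| ≤ B * (D * Real.exp (l * t)) := by
    have sub_le := h.abs_density_sub_le h' hf₀ hL hp (ε := D * Real.exp (l * t)) (by positivity)
      (fun s hs y hq => (field_close _ hq).trans (by have := hs.2; dsimp only; gcongr)) v
    calc |g (t, x, v) - f (t, x, v)|
        ≤ Λ * (D * Real.exp (l * t) * R * Real.exp ((1 + L) * R)) := sub_le.trans (by gcongr)
      _ = B * (D * Real.exp (l * t)) := by ring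
  have charge_sub_le := abs_moment_sub_le (f := fun t x v => g (t, x, v))
    (g := fun t x v => f (t, x, v)) (a := fun _ => 1) (c := 1) (Q := Q + Q') (by positivity)
    (fun v hv => g_eq_zero t x hp v (by linarith)) (fun v hv => f_eq_zero t x hp v (by linarith))
    (h.continuous_velocity ht x) (h'.continuous_velocity ht x) continuous_const (by simp)
    density_sub_le
  simp only [moment, one_mul] at charge_sub_le
  calc |chargeSource g w t x - chargeSource f u t x|
      = |-((∫ v, g (t, x, v)) - ∫ v, f (t, x, v)) - (w (t, x) - u (t, x))| := by
        rw [chargeSource, chargeSource]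
        ring_nf
    _ ≤ |(∫ v, g (t, x, v)) - ∫ v, f (t, x, v)| + |w (t, x) - u (t, x)| := by
        rw [← abs_neg ((∫ v, g (t, x, v)) - ∫ v, f (t, x, v))]
        exact abs_sub _ _
    _ ≤ 2 * (Q + Q') * 1 * (B * (D * Real.exp (l * t))) + D * Real.exp (l * t) :=
        add_le_add charge_sub_le (potential_close _ hp)
    _ = (2 * (Q + Q') * B + 1) * D * Real.exp (l * t) := by ring

theorem coneClose_derivs (h : IsGlobalVKGSolution f₀ u₁ u₂ g w)
    (h' : IsGlobalVKGSolution f₀ u₁ u₂ f u) (hD : 0 ≤ D) (hl : 0 < l)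
    (H : ConeClose R l D (fun p => chargeSource g w p.1 p.2) fun p => chargeSource f u p.1 p.2) :
    ConeClose R l (D / l) (timeDeriv w) (timeDeriv u) ∧
      ConeClose R l (D / l) (spaceDeriv w) (spaceDeriv u) := by
  have riemann_close {σ : ℝ} (hσ : |σ| = 1) : ConeClose R l (D / l)
      (fun p => timeDeriv w p + σ * spaceDeriv w p)
      (fun p => timeDeriv u p + σ * spaceDeriv u p) := by
    rintro ⟨t, x⟩ hp
    have hσ_sq : σ ^ 2 = 1 := by rw [← sq_abs, hσ, one_pow]
    dsimp only
    rw [h.riemann_eq hσ_sq hp.1, h'.riemann_eq hσ_sq hp.1, add_sub_add_left_eq_sub]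
    exact H.lineIntegral hD hl hσ.le h.continuousOn_chargeSource h'.continuousOn_chargeSource _ hp
  constructor
  · intro p hp
    convert abs_half_add_le (riemann_close (σ := 1) (by simp) p hp)
      (riemann_close (σ := -1) (by simp) p hp) using 2
    ring
  · intro p hp
    convert abs_half_sub_le (riemann_close (σ := 1) (by simp) p hp)
      (riemann_close (σ := -1) (by simp) p hp) using 2
    ring

theorem coneClose_potential (h : IsGlobalVKGSolution f₀ u₁ u₂ g w)
    (h' : IsGlobalVKGSolution f₀ u₁ u₂ f u) (hD : 0 ≤ D) (hl : 0 < l)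
    (H : ConeClose R l D (timeDeriv w) (timeDeriv u)) : ConeClose R l (D / l) w u := by
  rintro ⟨t, x⟩ hp
  rw [h.potential_eq hp.1, h'.potential_eq hp.1, add_sub_add_left_eq_sub]
  simpa only [lineIntegral, zero_mul, add_zero] using H.lineIntegral (σ := 0) hD hl (by simp)
    (h.continuousOn_dirDeriv_u _) (h'.continuousOn_dirDeriv_u _) _ hp

theorem exists_cone_contraction (h : IsGlobalVKGSolution f₀ u₁ u₂ g w)
    (h' : IsGlobalVKGSolution f₀ u₁ u₂ f u) {Λ : ℝ≥0} (hf₀ : LipschitzWith Λ f₀)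
    (hf₀' : HasCompactSupport f₀) (hR : 0 ≤ R) :
    ∃ l, 0 < l ∧ ∀ D, 0 ≤ D → ConeClose R l D w u →
      ConeClose R l D (spaceDeriv w) (spaceDeriv u) →
      ConeClose R l (D / 2) w u ∧ ConeClose R l (D / 2) (spaceDeriv w) (spaceDeriv u) := by
  obtain ⟨k, hk, source_close⟩ := h.exists_coneClose_chargeSource h' hf₀ hf₀' hR
  have hl : 0 < 2 * (k + 1) := by positivity
  refine ⟨2 * (k + 1), hl, fun D hD potential_close field_close => ?_⟩
  have half : k * D / (2 * (k + 1)) ≤ D / 2 := by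
    rw [div_le_div_iff₀ hl two_pos]
    nlinarith
  have derivs_close := h.coneClose_derivs h' (by positivity) hl
    (source_close _ hl.le D hD potential_close field_close)
  have half_div_le : D / 2 / (2 * (k + 1)) ≤ D / 2 := div_le_self (by positivity) (by linarith)
  exact ⟨(h.coneClose_potential h' (by positivity) hl (derivs_close.1.mono half)).mono half_div_le,
    derivs_close.2.mono half⟩

theorem eqOn_lightCone (h : IsGlobalVKGSolution f₀ u₁ u₂ g w)
    (h' : IsGlobalVKGSolution f₀ u₁ u₂ f u) {Λ : ℝ≥0} (hf₀ : LipschitzWith Λ f₀)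
    (hf₀' : HasCompactSupport f₀) (hR : 0 ≤ R) :
    EqOn w u (lightCone R) ∧ EqOn (spaceDeriv w) (spaceDeriv u) (lightCone R) := by
  obtain ⟨l, hl, contraction⟩ := h.exists_cone_contraction h' hf₀ hf₀' hR
  obtain ⟨D₁, hD₁, potential_close⟩ := ConeClose.exists_of_continuousOn hl.le
    h.contDiffOn_u.continuousOn h'.contDiffOn_u.continuousOn R
  obtain ⟨D₂, -, field_close⟩ := ConeClose.exists_of_continuousOn hl.le
    (h.continuousOn_dirDeriv_u (0, 1)) (h'.continuousOn_dirDeriv_u (0, 1)) R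
  set D := max D₁ D₂
  have hD : 0 ≤ D := hD₁.trans (le_max_left _ _)
  have close (n : ℕ) : ConeClose R l (D / 2 ^ n) w u ∧
      ConeClose R l (D / 2 ^ n) (spaceDeriv w) (spaceDeriv u) := by
    induction n with
    | zero =>
      rw [pow_zero, div_one]
      exact ⟨potential_close.mono (le_max_left _ _), field_close.mono (le_max_right _ _)⟩
    | succ n ih =>
      rw [pow_succ, ← div_div]
      exact contraction _ (div_nonneg hD (by positivity)) ih.1 ih.2
  exact ⟨fun p hp => ConeClose.eq_of_forall_div_two_pow (fun n => (close n).1) hp,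
    fun p hp => ConeClose.eq_of_forall_div_two_pow (fun n => (close n).2) hp⟩

theorem eqOn (h : IsGlobalVKGSolution f₀ u₁ u₂ g w) (h' : IsGlobalVKGSolution f₀ u₁ u₂ f u)
    {Λ : ℝ≥0} (hf₀ : LipschitzWith Λ f₀) (hf₀' : HasCompactSupport f₀) :
    EqOn g f (halfSpace (ℝ × ℝ)) ∧ EqOn w u (halfSpace ℝ) := by
  constructor
  · rintro ⟨t, x, v⟩ ⟨ht, -⟩
    have hR : 0 ≤ t + |x| := add_nonneg ht (abs_nonneg x)
    obtain ⟨L, hL⟩ := h.exists_lipschitzWith_clampedField hR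
    have density_sub_le := h.abs_density_sub_le h' hf₀ hL (lightCone.mem_apex ht x) le_rfl
      (fun s _ y hq => by rw [(h.eqOn_lightCone h' hf₀ hf₀' hR).2 hq, sub_self, abs_zero]) v
    simpa only [zero_mul, mul_zero, abs_nonpos_iff, sub_eq_zero] using density_sub_le
  · rintro ⟨t, x⟩ ⟨ht, -⟩
    exact (h.eqOn_lightCone h' hf₀ hf₀' (add_nonneg ht (abs_nonneg x))).1 (lightCone.mem_apex ht x)

end IsGlobalVKGSolution

end Uniqueness

/-! ### Existence, uniqueness and support -/

section Main

variable {M C P₀ : ℝ} {f₀ : ℝ × ℝ → ℝ} {u₁ u₂ : ℝ → ℝ}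

theorem IsBoundedData.exists_solution (hd : IsBoundedData M C P₀ f₀ u₁ u₂) :
    ∃ f u, IsGlobalVKGSolution f₀ u₁ u₂ f u ∧
      ((∀ z, 0 ≤ f₀ z) → ∀ t ≥ 0, ∀ x v, 0 ≤ f (t, x, v)) ∧
      ∀ R₀, (∀ x v, f₀ (x, v) ≠ 0 → |x| ≤ R₀) →
        ∀ t ≥ 0, ∀ x v, R₀ + t ≤ |x| ∨ momentumBound C P₀ t ≤ |v| → f (t, x, v) = 0 := by
  obtain ⟨u, E, E', hs, hfix⟩ := hd.exists_fixedPoint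
  refine ⟨_, _, hs.isGlobalVKGSolution hd hfix, fun hpos t _ x v => hpos _,
    fun R₀ hR t ht x v h => ?_⟩
  exact h.elim (hs.transport_eq_zero_of_position hd hR ht x v)
    (hs.transport_eq_zero hd ⟨ht, le_rfl⟩ x)

namespace IsC2VKGData

theorem exists_isBoundedData (hd : IsC2VKGData M f₀ u₁ u₂) (hC : 4 * M + 2 ≤ C) :
    ∃ P₀, IsBoundedData M C P₀ f₀ u₁ u₂ := by
  obtain ⟨P₀, hP, f_eq_zero⟩ := hd.compactSupport_f.exists_pos_le_norm
  refine ⟨P₀, hd, hC, hP.le, fun x v hne => ?_⟩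
  exact (norm_snd_le (x, v)).trans (not_le.1 fun h => hne (f_eq_zero _ h)).le

theorem eqOn (hd : IsC2VKGData M f₀ u₁ u₂) {f g : ℝ × ℝ × ℝ → ℝ} {u w : ℝ × ℝ → ℝ}
    (hg : IsGlobalVKGSolution f₀ u₁ u₂ g w) (hf : IsGlobalVKGSolution f₀ u₁ u₂ f u) :
    EqOn g f (halfSpace (ℝ × ℝ)) ∧ EqOn w u (halfSpace ℝ) := by
  obtain ⟨Λ, hΛ⟩ := hd.exists_lipschitzWith
  exact hg.eqOn hf hΛ hd.compactSupport_f

theorem eq_zero_of_support_le (hd : IsC2VKGData M f₀ u₁ u₂) (hC : 4 * M + 2 ≤ C)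
    {f : ℝ × ℝ × ℝ → ℝ} {u : ℝ × ℝ → ℝ} (hf : IsGlobalVKGSolution f₀ u₁ u₂ f u) {R₀ : ℝ}
    (hsupp : ∀ x v, f₀ (x, v) ≠ 0 → |x| ≤ R₀ ∧ |v| ≤ P₀) {t : ℝ} (ht : 0 ≤ t) {x v : ℝ}
    (hxv : R₀ + t ≤ |x| ∨ momentumBound C P₀ t ≤ |v|) : f (t, x, v) = 0 := by
  rcases le_or_gt 0 P₀ with hP | hP
  · have hb : IsBoundedData M C P₀ f₀ u₁ u₂ := ⟨hd, hC, hP, fun x v h => (hsupp x v h).2⟩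
    obtain ⟨g, w, hg, -, g_eq_zero⟩ := hb.exists_solution
    rw [(hd.eqOn hf hg).1 (halfSpace.mem ht (x, v))]
    exact g_eq_zero R₀ (fun x v h => (hsupp x v h).1) t ht x v hxv
  · have f₀_eq_zero (x v : ℝ) : f₀ (x, v) = 0 := by
      by_contra hne
      exact absurd ((abs_nonneg v).trans (hsupp x v hne).2) hP.not_ge
    obtain ⟨P₁, hb⟩ := hd.exists_isBoundedData hC
    obtain ⟨g, w, hg, -, g_eq_zero⟩ := hb.exists_solution
    rw [(hd.eqOn hf hg).1 (halfSpace.mem ht (x, v))]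
    exact g_eq_zero (-t) (fun x v h => absurd (f₀_eq_zero x v) h) t ht x v (by simp)

end IsC2VKGData

end Main

theorem theorem4p1_general (M : ℝ) :
    ∃ C : ℝ, 0 < C ∧
      ∀ (f₀ : ℝ × ℝ → ℝ) (u₁ u₂ : ℝ → ℝ), IsC2VKGData M f₀ u₁ u₂ →
        ∃ (f : ℝ × ℝ × ℝ → ℝ) (u : ℝ × ℝ → ℝ),
          IsGlobalVKGSolution f₀ u₁ u₂ f u ∧
          (∀ (g : ℝ × ℝ × ℝ → ℝ) (w : ℝ × ℝ → ℝ), IsGlobalVKGSolution f₀ u₁ u₂ g w →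
            EqOn g f (Ici (0 : ℝ) ×ˢ univ) ∧ EqOn w u (Ici (0 : ℝ) ×ˢ univ)) ∧
          ((∀ z, 0 ≤ f₀ z) → ∀ t ≥ 0, ∀ x v, 0 ≤ f (t, x, v)) ∧
          ∀ R₀ P₀ : ℝ, (∀ x v, f₀ (x, v) ≠ 0 → |x| ≤ R₀ ∧ |v| ≤ P₀) →
            ∃ P : ℝ → ℝ, SolvesMomentumEquation C P₀ P ∧
              (∀ Q : ℝ → ℝ, SolvesMomentumEquation C P₀ Q → EqOn Q P (Ici 0)) ∧
              ∀ t ≥ 0, ∀ x v, R₀ + t ≤ |x| ∨ P t ≤ |v| → f (t, x, v) = 0 := by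
  refine ⟨4 * |M| + 2, by positivity, fun f₀ u₁ u₂ hd => ?_⟩
  have hC : 4 * M + 2 ≤ 4 * |M| + 2 := by linarith [le_abs_self M]
  obtain ⟨P₁, hb⟩ := hd.exists_isBoundedData hC
  obtain ⟨f, u, hf, f_nonneg, -⟩ := hb.exists_solution
  refine ⟨f, u, hf, fun g w hg => hd.eqOn hg hf, f_nonneg, fun R₀ P₀ hsupp => ?_⟩
  have hP := solvesMomentumEquation_momentumBound (4 * |M| + 2) P₀
  exact ⟨_, hP, fun Q hQ => hP.eqOn hQ, fun t ht x v => hd.eq_zero_of_support_le hC hf hsupp ht⟩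

theorem theorem4p1 (M : ℝ) :
    ∃ C : ℝ, 0 < C ∧
      ∀ (f₀ : ℝ × ℝ → ℝ) (u₁ u₂ : ℝ → ℝ), IsVKGData M f₀ u₁ u₂ →
        ∃ (f : ℝ × ℝ × ℝ → ℝ) (u : ℝ × ℝ → ℝ),
          IsGlobalVKGSolution f₀ u₁ u₂ f u ∧
          (∀ (g : ℝ × ℝ × ℝ → ℝ) (w : ℝ × ℝ → ℝ), IsGlobalVKGSolution f₀ u₁ u₂ g w →
            EqOn g f (Ici (0 : ℝ) ×ˢ univ) ∧ EqOn w u (Ici (0 : ℝ) ×ˢ univ)) ∧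
          ((∀ z, 0 ≤ f₀ z) → ∀ t ≥ 0, ∀ x v, 0 ≤ f (t, x, v)) ∧
          ∀ R₀ P₀ : ℝ, (∀ x v, f₀ (x, v) ≠ 0 → |x| ≤ R₀ ∧ |v| ≤ P₀) →
            ∃ P : ℝ → ℝ, SolvesMomentumEquation C P₀ P ∧
              (∀ Q : ℝ → ℝ, SolvesMomentumEquation C P₀ Q → EqOn Q P (Ici 0)) ∧
              ∀ t ≥ 0, ∀ x v, R₀ + t ≤ |x| ∨ P t ≤ |v| → f (t, x, v) = 0 := by
  obtain ⟨C, hC, h⟩ := theorem4p1_general M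
  exact ⟨C, hC, fun f₀ u₁ u₂ hd => h f₀ u₁ u₂ hd.isC2VKGData⟩
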